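/- Let $M$ be a connected smooth $n$-manifold and let $F_0:M\hookrightarrow\mathbb S^{n+1}\subset\mathbb R^{n+2}$ be an isoparametric hypersurface, i.e. a smooth embedding with a smooth unit normal field $\nu_0$ (tangent to the sphere) whose principal curvatures, counted with multiplicity, are constant; let $g$ be the number of distinct principal curvatures. Let $g_0$ be the metric induced by $F_0$, $\nabla^0$ its Levi-Civita connection, and $A_0$ the shape operator, $d\nu_0=-dF_0\,A_0$. Put $$\hat F_0=\tfrac1{\sqrt2}(F_0+i\nu_0):M\to\mathbb C^{n+2},\qquad \hat g(X,Y)=\mathrm{Re}\,\langle d\hat F_0X,d\hat F_0Y\rangle_h,$$ where $\langle\cdot,\cdot\rangle_h$ is the standard Hermitian inner product, $$\alpha(X,Y,Z)=g_0\big((\nabla^0_XA_0)Y,Z\big),\qquad B_0=(A_0+i\,\mathrm{Id})(A_0-i\,\mathrm{Id})^{-1},$$ and extend $\hat g$ and $\alpha$ complex multilinearly to $TM\otimes\mathbb C$. Let $T(X,Y,Z,W)=\mathrm{Im}\big(\hat g(B_0X,Y)\,\hat g(B_0^{-1}Z,W)\big)$, and let $\mathrm{tr}_{\hat g}$ denote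 the trace over the two arguments marked $\cdot$ with respect to $\hat g$ (the sum over a $\hat g$-orthonormal basis). Then, for all real tangent vectors $X,Y,Z,W$ at any point of $M$, $$\begin{aligned} -4i\,g^2\,T(X,Y,Z,W)=\sum_{\ell,j=0}^{g-1}\mathrm{tr}_{\hat g}\Big\{ &\alpha(B_0^{-\ell}Y,B_0^{-j}W,\cdot)\sum_{k=0}^{j-1}\big\{\alpha(B_0^{\ell}X,B_0^{k+1}Z,B_0^{j-k-1}\cdot)+\alpha(B_0^{\ell}X,B_0^{k}Z,B_0^{j-k}\cdot)\big\}\\ +\,&\alpha(B_0^{-\ell}Y,B_0^{-j}Z,\cdot)\sum_{k=0}^{j-1}\big\{\alpha(B_0^{\ell}X,B_0^{k+1}W,B_0^{j-k-1}\cdot)+\alpha(B_0^{\ell}X,B_0^{k}W,B_0^{j-k}\cdot)\big\}\\ -\,&\alpha(B_0^{-j}W,B_0^{-\ell}Y,\cdot)\sum_{k=0}^{\ell-1}\big\{\alpha(B_0^{j}Z,B_0^{k+1}X,B_0^{\ell-k-1}\cdot)+\alpha(B_0^{j}Z,B_0^{k}X,B_0^{\ell-k}\cdot)\big\}\\ -\,&\alpha(B_0^{-j}W,B_0^{-\ell}X,\cdot)\sum_{k=0}^{\ell-1}\big\{\alpha(B_0^{j}Z,B_0^{k+1}Y,B_0^{\ell-k-1}\cdot)+\alpha(B_0^{j}Z,B_0^{k}Y,B_0^{\ell-k}\cdot)\big\}\Big\}.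 \end{aligned}$$ -/

import Mathlib

open scoped Manifold ContDiff Matrix

namespace Isoparametric

noncomputable section

/-! ### Hypersurfaces in a coordinate system

`f N : ℝⁿ → ℝⁿ⁺²` is a parametrized hypersurface of the unit sphere together with its unit normal
field.  The indices `i j k` refer to the coordinate basis `∂₁, …, ∂ₙ`; a field of endomorphisms is
given by the matrices `S k j = Sᵏⱼ`, that is `S ∂ⱼ = ∑ₖ Sᵏⱼ ∂ₖ`. -/

/-- The partial derivative `∂ᵢ h` at `x`. -/
def partialDeriv {n : ℕ} {V : Type*} [NormedAddCommGroup V] [NormedSpace ℝ V]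
    (h : EuclideanSpace ℝ (Fin n) → V) (i : Fin n) (x : EuclideanSpace ℝ (Fin n)) : V :=
  fderiv ℝ h x (EuclideanSpace.single i 1)

/-- The induced metric `g₀(∂ᵢ, ∂ⱼ) = ⟨df ∂ᵢ, df ∂ⱼ⟩`. -/
def firstForm {n : ℕ} (f : EuclideanSpace ℝ (Fin n) → EuclideanSpace ℝ (Fin (n + 2)))
    (x : EuclideanSpace ℝ (Fin n)) : Matrix (Fin n) (Fin n) ℝ :=
  Matrix.of fun i j => inner ℝ (partialDeriv f i x) (partialDeriv f j x)

/-- The second fundamental form `-⟨df ∂ᵢ, dN ∂ⱼ⟩ = g₀(∂ᵢ, A₀ ∂ⱼ)`. -/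
def secondForm {n : ℕ} (f N : EuclideanSpace ℝ (Fin n) → EuclideanSpace ℝ (Fin (n + 2)))
    (x : EuclideanSpace ℝ (Fin n)) : Matrix (Fin n) (Fin n) ℝ :=
  Matrix.of fun i j => -inner ℝ (partialDeriv f i x) (partialDeriv N j x)

/-- The shape operator `A₀`, determined by `dN = -df A₀`. -/
def shapeOperator {n : ℕ} (f N : EuclideanSpace ℝ (Fin n) → EuclideanSpace ℝ (Fin (n + 2)))
    (x : EuclideanSpace ℝ (Fin n)) : Matrix (Fin n) (Fin n) ℝ :=
  (firstForm f x)⁻¹ * secondForm f N x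

/-- The Christoffel symbols `Γᵏᵢⱼ` of the Levi-Civita connection of the metric `G`. -/
def christoffel {n : ℕ} (G : EuclideanSpace ℝ (Fin n) → Matrix (Fin n) (Fin n) ℝ)
    (k i j : Fin n) (x : EuclideanSpace ℝ (Fin n)) : ℝ :=
  (1 / 2) * ∑ l, (G x)⁻¹ k l *
    (partialDeriv (fun y => G y j l) i x + partialDeriv (fun y => G y i l) j x
      - partialDeriv (fun y => G y i j) l x)

/-- The component `((∇_{∂ᵢ} S) ∂ⱼ)ᵏ` of the covariant derivative of the field of endomorphisms `S`
with respect to the Levi-Civita connection of `G`. -/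
def covDeriv {n : ℕ} (G S : EuclideanSpace ℝ (Fin n) → Matrix (Fin n) (Fin n) ℝ)
    (i j k : Fin n) (x : EuclideanSpace ℝ (Fin n)) : ℝ :=
  partialDeriv (fun y => S y k j) i x
    + ∑ m, christoffel G k i m x * S x m j - ∑ m, christoffel G m i j x * S x k m

/-- `α(∂ᵢ, ∂ⱼ, ∂ₖ) = g₀((∇⁰_{∂ᵢ} A₀) ∂ⱼ, ∂ₖ)`, where `∇⁰` is the Levi-Civita connection of `g₀`. -/
def alphaCoord {n : ℕ} (f N : EuclideanSpace ℝ (Fin n) → EuclideanSpace ℝ (Fin (n + 2)))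
    (i j k : Fin n) (x : EuclideanSpace ℝ (Fin n)) : ℝ :=
  ∑ m, covDeriv (firstForm f) (shapeOperator f N) i j m x * firstForm f x m k

/-- The lift `(f + i N) / √2` to the Stiefel manifold, as a subset of `ℂⁿ⁺²`. -/
def stiefelLift {n : ℕ} (f N : EuclideanSpace ℝ (Fin n) → EuclideanSpace ℝ (Fin (n + 2)))
    (x : EuclideanSpace ℝ (Fin n)) : EuclideanSpace ℂ (Fin (n + 2)) :=
  WithLp.toLp 2 fun a => ((f x a : ℂ) + Complex.I * (N x a : ℂ)) / (Real.sqrt 2 : ℂ)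

/-- The metric `ĝ`: the pull-back under the lift to the Stiefel manifold of the real part of the
standard Hermitian inner product of `ℂⁿ⁺²`. -/
def gHatCoord {n : ℕ} (f N : EuclideanSpace ℝ (Fin n) → EuclideanSpace ℝ (Fin (n + 2)))
    (x : EuclideanSpace ℝ (Fin n)) : Matrix (Fin n) (Fin n) ℝ :=
  Matrix.of fun i j =>
    (inner ℂ (partialDeriv (stiefelLift f N) i x) (partialDeriv (stiefelLift f N) j x)).re

/-! ### Isoparametric hypersurfaces -/

section Manifold

variable {n : ℕ} {M : Type*} [TopologicalSpace M] [ChartedSpace (EuclideanSpace ℝ (Fin n)) M]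

/-- The differential of a map from `M` to a Euclidean space. -/
def differential {m : ℕ} (F : M → EuclideanSpace ℝ (Fin m)) (p : M) :
    TangentSpace 𝓘(ℝ, EuclideanSpace ℝ (Fin n)) p →L[ℝ] EuclideanSpace ℝ (Fin m) :=
  mfderiv 𝓘(ℝ, EuclideanSpace ℝ (Fin n)) 𝓘(ℝ, EuclideanSpace ℝ (Fin m)) F p

/-- The space `{v ∈ T_pM | dν v = -κ dF v}` of principal vectors with principal curvature `κ`; since
`dν = -dF A₀` with `dF` injective, this is the eigenspace of the shape operator `A₀` for `κ`. -/
def principalSpace (F ν : M → EuclideanSpace ℝ (Fin (n + 2))) (p : M) (κ : ℝ) :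
    Submodule ℝ (TangentSpace 𝓘(ℝ, EuclideanSpace ℝ (Fin n)) p) :=
  ((differential ν p + κ • differential F p :
    TangentSpace 𝓘(ℝ, EuclideanSpace ℝ (Fin n)) p →L[ℝ] EuclideanSpace ℝ (Fin (n + 2))) :
    TangentSpace 𝓘(ℝ, EuclideanSpace ℝ (Fin n)) p →ₗ[ℝ] EuclideanSpace ℝ (Fin (n + 2))).ker

/-- The set of principal curvatures at `p`. -/
def principalCurvatures (F ν : M → EuclideanSpace ℝ (Fin (n + 2))) (p : M) : Set ℝ :=
  {κ | principalSpace F ν p κ ≠ ⊥}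

/-- `F` is an isoparametric hypersurface of the unit sphere of `ℝⁿ⁺²` with unit normal field `ν`:
a smooth embedding into the sphere whose principal curvatures, counted with multiplicity, are
constant. -/
structure IsIsoparametric (F ν : M → EuclideanSpace ℝ (Fin (n + 2))) : Prop where
  smooth : ContMDiff 𝓘(ℝ, EuclideanSpace ℝ (Fin n)) 𝓘(ℝ, EuclideanSpace ℝ (Fin (n + 2))) ∞ F
  isEmbedding : Topology.IsEmbedding F
  immersion : ∀ p : M, Function.Injective (differential (n := n) F p)
  mem_sphere : ∀ p, ‖F p‖ = 1
  normal_smooth :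
    ContMDiff 𝓘(ℝ, EuclideanSpace ℝ (Fin n)) 𝓘(ℝ, EuclideanSpace ℝ (Fin (n + 2))) ∞ ν
  normal_norm : ∀ p, ‖ν p‖ = 1
  normal_orth_position : ∀ p, inner ℝ (ν p) (F p) = 0
  normal_orth_tangent : ∀ p (v : TangentSpace 𝓘(ℝ, EuclideanSpace ℝ (Fin n)) p),
    inner ℝ (ν p) (differential F p v) = 0
  principal_const : ∀ (p q : M) (κ : ℝ),
    Module.finrank ℝ (principalSpace F ν p κ) = Module.finrank ℝ (principalSpace F ν q κ)

/-! ### The invariants at a point `p`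

All tensors at `p` are computed in the preferred chart at `p`, through which Mathlib identifies
`T_pM` with `ℝⁿ`.  Elements of `T_pM ⊗ ℂ` are written as vectors in `Fin n → ℂ`. -/

/-- A map on `M`, written in the preferred chart at `p`. -/
def inChart {V : Type*} (p : M) (h : M → V) : EuclideanSpace ℝ (Fin n) → V :=
  fun x => h ((chartAt (EuclideanSpace ℝ (Fin n)) p).symm x)

/-- The real tangent vector `X` as an element of `T_pM ⊗ ℂ`. -/
def toComplex {p : M} (X : TangentSpace 𝓘(ℝ, EuclideanSpace ℝ (Fin n)) p) : Fin n → ℂ :=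
  fun i => (((show EuclideanSpace ℝ (Fin n) from X) i : ℝ) : ℂ)

/-- The matrix of `ĝ` at `p`. -/
def gHatMatrix (F ν : M → EuclideanSpace ℝ (Fin (n + 2))) (p : M) : Matrix (Fin n) (Fin n) ℝ :=
  gHatCoord (inChart p F) (inChart p ν) (chartAt (EuclideanSpace ℝ (Fin n)) p p)

/-- The complex bilinear extension of `ĝ` at `p`. -/
def gHat (F ν : M → EuclideanSpace ℝ (Fin (n + 2))) (p : M) (x y : Fin n → ℂ) : ℂ :=
  ∑ i, ∑ j, (gHatMatrix F ν p i j : ℂ) * x i * y j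

/-- The complex trilinear extension of `α` at `p`. -/
def alpha (F ν : M → EuclideanSpace ℝ (Fin (n + 2))) (p : M) (x y z : Fin n → ℂ) : ℂ :=
  ∑ i, ∑ j, ∑ k,
    (alphaCoord (inChart p F) (inChart p ν) i j k (chartAt (EuclideanSpace ℝ (Fin n)) p p) : ℂ)
      * x i * y j * z k

/-- The shape operator `A₀` at `p`, extended to `T_pM ⊗ ℂ`. -/
def shapeC (F ν : M → EuclideanSpace ℝ (Fin (n + 2))) (p : M) : Matrix (Fin n) (Fin n) ℂ :=
  (shapeOperator (inChart p F) (inChart p ν) (chartAt (EuclideanSpace ℝ (Fin n)) p p)).map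
    Complex.ofReal

/-- `B₀ = (A₀ + i) (A₀ - i)⁻¹` at `p`. -/
def opB (F ν : M → EuclideanSpace ℝ (Fin (n + 2))) (p : M) : Matrix (Fin n) (Fin n) ℂ :=
  (shapeC F ν p + Complex.I • (1 : Matrix (Fin n) (Fin n) ℂ)) *
    (shapeC F ν p - Complex.I • (1 : Matrix (Fin n) (Fin n) ℂ))⁻¹

/-- The vector `B₀ᵏ v`, for an integer `k`. -/
def powB (F ν : M → EuclideanSpace ℝ (Fin (n + 2))) (p : M) (k : ℤ) (v : Fin n → ℂ) : Fin n → ℂ :=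
  (opB F ν p ^ k) *ᵥ v

/-- `T(X, Y, Z, W) = Im (ĝ(B₀ X, Y) ĝ(B₀⁻¹ Z, W))`. -/
def tensorT (F ν : M → EuclideanSpace ℝ (Fin (n + 2))) (p : M)
    (X Y Z W : TangentSpace 𝓘(ℝ, EuclideanSpace ℝ (Fin n)) p) : ℝ :=
  (gHat F ν p (powB F ν p 1 (toComplex X)) (toComplex Y) *
    gHat F ν p (powB F ν p (-1) (toComplex Z)) (toComplex W)).im

/-- The trace with respect to `ĝ` of a complex bilinear form `β` on `T_pM ⊗ ℂ`. -/
def traceHat (F ν : M → EuclideanSpace ℝ (Fin (n + 2))) (p : M)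
    (β : (Fin n → ℂ) → (Fin n → ℂ) → ℂ) : ℂ :=
  ∑ a, ∑ b, ((gHatMatrix F ν p)⁻¹ a b : ℂ) * β (Pi.single a 1) (Pi.single b 1)

end Manifold

end

end Isoparametric

open Isoparametric

/-! Both sides are real multilinear in the four vectors, so they need only be compared on a
`g₀`-orthonormal basis of principal vectors. There `B₀` is diagonal, with eigenvalues `cayley c = (c
+ i) / (c - i)`, which is `exp (2iθ)` for `c = cot θ`. Everything rests on two facts about
isoparametric hypersurfaces: the principal curvatures are equally spaced in `θ`, that is, quotients
of eigenvalues of `B₀` are `g`-th roots of unity (`cayley_div_pow_card`), and Cartan's identity for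
the cubic form `α`, here for two pairs of principal vectors (`cartan_polarized`).

Both facts come from focal maps. For a principal curvature `a`, the map `φ = a f + N` is constant
along the leaves of the principal distribution of `a`. It has constant rank, so the tangent space
and the second fundamental form of its image are constant along a leaf (`fderiv_P_eq_zero`,
`fderiv_focalForm`). The normal `η = a N - f` turns along a great circle when the point moves along
a suitable curve in the leaf (`exists_leaf_curve`). Hence the shape operators of the focal image are
`cos s K₀ + sin s K₁`, while their eigenvalues `(1 + a c) / (a - c) = cot (θ_c - θ_a)` do not depend
on `s`. Analytic continuation to `s = π` shows that these eigenvalues are symmetric about `0`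
(`exists_reflection`); thus the angles are closed under reflection in each of them, and a finite
group argument gives equal spacing. Differentiating the eigenvalue equation at `s = 0` gives
Cartan's identity (`cartan_aux`).

With eigenvalues `x, y, r, s` for the four vectors and `e` for the vector of the trace, the sum over
`k` is a geometric sum, which leaves `(x/y)^l (r + e)/(r - e) ((r/s)^j - (e/s)^j)`. Summing over `l`
and `j` is orthogonality of characters: it yields `g² (r + e)/(r - e)` if `x = y` and `r = s`, and
`0` otherwise (`sum_sum_pow`). The degenerate cases `e = r` and `e = s` do not contribute, because
`α` vanishes on two vectors with the same principal curvature. In the combination of the four terms,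
the coefficients, including the weight of the `ĝ`-trace, collapse to `-2i (c - a) / ((a - e)(c -
e))` (`cayley_coefficient`), which is the kernel in Cartan's identity. -/

open scoped Topology

namespace Isoparametric

set_option linter.unusedSectionVars false

/-! ### Maps of constant rank: the image geometry is constant along fibres -/

/-- A smooth map `φ` on the open set `U` whose differential has constant rank: `P` is the orthogonal
projection onto the range of `dφ`, `ρ` a right inverse of `dφ` on this range, and `τ` a projection
onto the kernel of `dφ`. -/
structure ConstantRank {V W : Type*} [NormedAddCommGroup V] [NormedSpace ℝ V]
    [NormedAddCommGroup W] [InnerProductSpace ℝ W] (U : Set V) (φ : V → W) (P : V → W →L[ℝ] W)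
    (ρ : V → W →L[ℝ] V) (τ : V → V →L[ℝ] V) : Prop where
  isOpen : IsOpen U
  smooth : ContDiffOn ℝ ∞ φ U
  smooth_P : ContDiffOn ℝ ∞ P U
  smooth_ρ : ContDiffOn ℝ ∞ ρ U
  smooth_τ : ContDiffOn ℝ ∞ τ U
  idem : ∀ z ∈ U, ∀ u, P z (P z u) = P z u
  symm : ∀ z ∈ U, ∀ u w, inner ℝ (P z u) w = inner ℝ u (P z w)
  P_deriv : ∀ z ∈ U, ∀ v, P z (fderiv ℝ φ z v) = fderiv ℝ φ z v
  deriv_ρ : ∀ z ∈ U, ∀ u, fderiv ℝ φ z (ρ z u) = P z u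
  deriv_τ : ∀ z ∈ U, ∀ v, fderiv ℝ φ z (τ z v) = 0
  τ_eq : ∀ z ∈ U, ∀ v, fderiv ℝ φ z v = 0 → τ z v = v

section
variable {V W : Type*} [NormedAddCommGroup V] [NormedSpace ℝ V]
    [NormedAddCommGroup W] [InnerProductSpace ℝ W] {U : Set V} {φ : V → W} {P : V → W →L[ℝ] W}
    {ρ : V → W →L[ℝ] V} {τ : V → V →L[ℝ] V}

theorem smoothOn_fderiv {E F : Type*} [NormedAddCommGroup E] [NormedSpace ℝ E]
    [NormedAddCommGroup F] [NormedSpace ℝ F] {U : Set E} (hU : IsOpen U) {h : E → F}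
    (hh : ContDiffOn ℝ ∞ h U) : ContDiffOn ℝ ∞ (fderiv ℝ h) U :=
  hh.fderiv_of_isOpen hU (by simp)

theorem hasFDerivAt_of_smoothOn {E F : Type*} [NormedAddCommGroup E] [NormedSpace ℝ E]
    [NormedAddCommGroup F] [NormedSpace ℝ F] {U : Set E} (hU : IsOpen U) {h : E → F}
    (hh : ContDiffOn ℝ ∞ h U) {z : E} (hz : z ∈ U) : HasFDerivAt h (fderiv ℝ h z) z :=
  ((hh.contDiffAt (hU.mem_nhds hz)).differentiableAt (by simp)).hasFDerivAt

theorem fderiv_fderiv_comm {E F : Type*} [NormedAddCommGroup E] [NormedSpace ℝ E]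
    [NormedAddCommGroup F] [NormedSpace ℝ F] {U : Set E} (hU : IsOpen U) {h : E → F}
    (hh : ContDiffOn ℝ ∞ h U) {z : E} (hz : z ∈ U) (v w : E) :
    fderiv ℝ (fderiv ℝ h) z v w = fderiv ℝ (fderiv ℝ h) z w v :=
  ((hh.contDiffAt (hU.mem_nhds hz)).isSymmSndFDerivAt
    (by simp only [minSmoothness_of_isRCLikeNormedField]; exact WithTop.coe_le_coe.2 (le_top : (2 : ℕ∞) ≤ ⊤))) v w

/-- If `a z (b z)` is locally a function `c z`, the product rule computes its derivative. -/
theorem fderiv_apply_apply {E F H : Type*} [NormedAddCommGroup E] [NormedSpace ℝ E]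
    [NormedAddCommGroup F] [NormedSpace ℝ F] [NormedAddCommGroup H] [NormedSpace ℝ H]
    {U : Set E} (hU : IsOpen U) {a : E → F →L[ℝ] H} {b : E → F} {c : E → H}
    (ha : ContDiffOn ℝ ∞ a U) (hb : ContDiffOn ℝ ∞ b U) (hc : ∀ z ∈ U, a z (b z) = c z)
    {z : E} (hz : z ∈ U) (v : E) :
    fderiv ℝ c z v = a z (fderiv ℝ b z v) + fderiv ℝ a z v (b z) := by
  have h := (hasFDerivAt_of_smoothOn hU ha hz).clm_apply (hasFDerivAt_of_smoothOn hU hb hz)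
  have h2 : HasFDerivAt c _ z := h.congr_of_eventuallyEq
    (by filter_upwards [hU.mem_nhds hz] with y hy using (hc y hy).symm)
  rw [h2.fderiv]
  simp

theorem fderiv_clm_apply_const {E F H : Type*} [NormedAddCommGroup E] [NormedSpace ℝ E]
    [NormedAddCommGroup F] [NormedSpace ℝ F] [NormedAddCommGroup H] [NormedSpace ℝ H]
    {U : Set E} (hU : IsOpen U) {a : E → F →L[ℝ] H} (ha : ContDiffOn ℝ ∞ a U) (u : F)
    {z : E} (hz : z ∈ U) (v : E) :
    fderiv ℝ (fun y => a y u) z v = fderiv ℝ a z v u := by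
  have := fderiv_apply_apply hU ha (contDiffOn_const (c := u)) (fun _ _ => rfl) hz v
  simpa using this

/-- The derivative of the tangent projection in the direction of a tangent vector of the image. -/
noncomputable def focalForm (P : V → W →L[ℝ] W) (ρ : V → W →L[ℝ] V) (z : V) :
    W →L[ℝ] W →L[ℝ] W := (fderiv ℝ P z).comp (ρ z)

namespace ConstantRank

variable (h : ConstantRank U φ P ρ τ)
include h

theorem inner_fderiv_P {z : V} (hz : z ∈ U) (T : V) (u w : W) :
    inner ℝ (fderiv ℝ P z T u) w = (inner ℝ u (fderiv ℝ P z T w) : ℝ) := by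
  have d := hasFDerivAt_of_smoothOn h.isOpen h.smooth_P hz
  have d1 := (d.clm_apply (hasFDerivAt_const u z)).inner ℝ (hasFDerivAt_const w z)
  have d2 := (hasFDerivAt_const u z).inner ℝ (d.clm_apply (hasFDerivAt_const w z))
  have d3 := d1.congr_of_eventuallyEq (f₁ := fun y => inner ℝ u (P y w))
    (by filter_upwards [h.isOpen.mem_nhds hz] with y hy using (h.symm y hy u w).symm)
  have := congrArg (fun L => L T) (d3.unique d2)
  simpa using this

/-- The tangent space of the image is constant along the fibres. -/
theorem fderiv_P_eq_zero {z : V} (hz : z ∈ U) {T : V} (hT : fderiv ℝ φ z T = 0) :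
    fderiv ℝ P z T = 0 := by
  have hdφ := smoothOn_fderiv h.isOpen h.smooth
  -- Differentiating `P dφ = dφ` along `T` leaves the normal part of `d²φ(T, v)`. Differentiating
  -- `dφ τ = 0` along `v` shows that this second derivative is tangent.
  have h1 : ∀ v, fderiv ℝ P z T (fderiv ℝ φ z v) = 0 := by
    intro v
    have e1 := fderiv_apply_apply h.isOpen h.smooth_P
      (hdφ.clm_apply (contDiffOn_const (c := v))) (fun y hy => h.P_deriv y hy v) hz T
    rw [fderiv_clm_apply_const h.isOpen hdφ v hz T] at e1
    have e2 := fderiv_apply_apply h.isOpen hdφ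
      (h.smooth_τ.clm_apply (contDiffOn_const (c := T))) (fun y hy => h.deriv_τ y hy T) hz v
    rw [h.τ_eq z hz T hT, fderiv_fderiv_comm h.isOpen h.smooth hz v T] at e2
    simp only [fderiv_fun_const, Pi.zero_apply, zero_apply] at e2
    have e3 : fderiv ℝ (fderiv ℝ φ) z T v
        = - fderiv ℝ φ z (fderiv ℝ (fun y => τ y T) z v) := by
      rw [eq_neg_iff_add_eq_zero, add_comm]; exact e2.symm
    rw [e3, map_neg, h.P_deriv z hz] at e1
    simpa using e1
  have h2 : ∀ u, fderiv ℝ P z T (P z u) = 0 := fun u => by rw [← h.deriv_ρ z hz u]; exact h1 _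
  -- So `dP` kills the range of `P`. Being symmetric, it also takes values in the complement,
  -- whereas `P² = P` now forces its values into the range.
  ext u
  have e := fderiv_apply_apply h.isOpen h.smooth_P
      (h.smooth_P.clm_apply (contDiffOn_const (c := u))) (fun y hy => h.idem y hy u) hz T
  rw [fderiv_clm_apply_const h.isOpen h.smooth_P u hz T, h2, add_zero] at e
  rw [e]
  refine ext_inner_right ℝ fun w => ?_
  rw [h.symm z hz, h.inner_fderiv_P hz, h2]
  simp

theorem smooth_focalForm : ContDiffOn ℝ ∞ (focalForm P ρ) U :=
  (smoothOn_fderiv h.isOpen h.smooth_P).clm_comp h.smooth_ρ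

/-- The second fundamental form of the image is constant along the fibres. -/
theorem fderiv_focalForm {z : V} (hz : z ∈ U) {T : V} (hT : fderiv ℝ φ z T = 0) :
    fderiv ℝ (focalForm P ρ) z T = 0 := by
  have hdφ := smoothOn_fderiv h.isOpen h.smooth
  have hdP := smoothOn_fderiv h.isOpen h.smooth_P
  have hρ := fun u : W => h.smooth_ρ.clm_apply (contDiffOn_const (c := u))
  have hτ := fun u : V => h.smooth_τ.clm_apply (contDiffOn_const (c := u))
  ext1 u
  have e1 := fderiv_apply_apply h.isOpen hdP (hρ u)
    (c := fun y => focalForm P ρ y u) (fun y hy => rfl) hz T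
  rw [fderiv_clm_apply_const h.isOpen h.smooth_focalForm u hz T] at e1
  have e2 := fderiv_apply_apply h.isOpen hdP (hτ T) (c := fun _ => 0)
    (fun y hy => h.fderiv_P_eq_zero hy (h.deriv_τ y hy T)) hz (ρ z u)
  simp only [fderiv_fun_const, Pi.zero_apply, zero_apply] at e2
  rw [h.τ_eq z hz T hT, fderiv_fderiv_comm h.isOpen h.smooth_P hz _ T] at e2
  have e3 := fderiv_apply_apply h.isOpen hdφ (hρ u) (fun y hy => h.deriv_ρ y hy u) hz T
  rw [fderiv_clm_apply_const h.isOpen h.smooth_P u hz T, h.fderiv_P_eq_zero hz hT] at e3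
  simp only [zero_apply] at e3
  have e4 := fderiv_apply_apply h.isOpen hdφ (hτ T) (fun y hy => h.deriv_τ y hy T) hz (ρ z u)
  simp only [fderiv_fun_const, Pi.zero_apply, zero_apply] at e4
  rw [h.τ_eq z hz T hT, fderiv_fderiv_comm h.isOpen h.smooth hz _ T] at e4
  -- The two derivatives differ by a vertical vector, a substitute for the bracket of a horizontal
  -- and a vertical field being vertical. On vertical vectors `dP` vanishes.
  have e5 : fderiv ℝ φ z (fderiv ℝ (fun y => ρ y u) z T
      - fderiv ℝ (fun y => τ y T) z (ρ z u)) = 0 := by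
    rw [map_sub, sub_eq_zero]; exact add_right_cancel (e3.symm.trans e4)
  have e6 := h.fderiv_P_eq_zero hz e5
  rw [map_sub, sub_eq_zero] at e6
  rw [e1, e6]
  exact e2.symm

/-- The shape operator of the image in the direction of a normal field `η`. -/
theorem focalForm_apply {η : V → W} (hη : ContDiffOn ℝ ∞ η U) (hP : ∀ z ∈ U, P z (η z) = 0)
    {z : V} (hz : z ∈ U) (u : W) :
    focalForm P ρ z u (η z) = - P z (fderiv ℝ η z (ρ z u)) := by
  have e := fderiv_apply_apply h.isOpen h.smooth_P hη hP hz (ρ z u)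
  simp only [fderiv_fun_const, Pi.zero_apply, zero_apply] at e
  rw [eq_neg_iff_add_eq_zero, add_comm]; exact e.symm

/-- Differentiate `P² = P` and apply the result to a normal vector. -/
theorem P_fderiv_P {z : V} (hz : z ∈ U) (T : V) {ξ : W} (hξ : P z ξ = 0) :
    P z (fderiv ℝ P z T ξ) = fderiv ℝ P z T ξ := by
  have e := fderiv_apply_apply h.isOpen h.smooth_P
      (h.smooth_P.clm_apply (contDiffOn_const (c := ξ))) (fun y hy => h.idem y hy ξ) hz T
  rw [fderiv_clm_apply_const h.isOpen h.smooth_P ξ hz T, hξ, map_zero, add_zero] at e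
  exact e.symm

/-- The shape operator of the image in the direction of a normal vector `ξ` is symmetric. -/
theorem inner_focalForm {z : V} (hz : z ∈ U) {ξ : W} (hξ : P z ξ = 0) (u w : W) :
    (inner ℝ (focalForm P ρ z u ξ) w : ℝ) = inner ℝ u (focalForm P ρ z w ξ) := by
  have hdφ := smoothOn_fderiv h.isOpen h.smooth
  -- The form is the `ξ`-component of `d²φ`, which is symmetric.
  have key : ∀ u w, (inner ℝ (focalForm P ρ z u ξ) w : ℝ)
      = inner ℝ ξ (fderiv ℝ (fderiv ℝ φ) z (ρ z u) (ρ z w)) := by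
    intro u w
    have e := fderiv_apply_apply h.isOpen h.smooth_P
      (hdφ.clm_apply (contDiffOn_const (c := ρ z w))) (fun y hy => h.P_deriv y hy _) hz (ρ z u)
    rw [fderiv_clm_apply_const h.isOpen hdφ _ hz, h.deriv_ρ z hz] at e
    rw [e, inner_add_right, ← h.symm z hz, hξ, inner_zero_left, zero_add, ← h.inner_fderiv_P hz,
      ← h.symm z hz, h.P_fderiv_P hz _ hξ]
    rfl
  rw [key, real_inner_comm _ u, key, fderiv_fderiv_comm h.isOpen h.smooth hz]

end ConstantRank
end

/-! ### Hypersurfaces of the sphere: shape operator and principal vectors -/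

section
variable {V W : Type*} [NormedAddCommGroup V] [InnerProductSpace ℝ V] [FiniteDimensional ℝ V]
    [NormedAddCommGroup W] [InnerProductSpace ℝ W] [FiniteDimensional ℝ W]

/-- A parametrized hypersurface of the unit sphere with unit normal field `N` and constant set `Λ`
of principal curvatures. -/
structure LocalIsoparametric (U : Set V) (f N : V → W) (Λ : Finset ℝ) : Prop where
  isOpen : IsOpen U
  finrank_eq : Module.finrank ℝ W = Module.finrank ℝ V + 2
  smooth : ContDiffOn ℝ ∞ f U
  smooth_normal : ContDiffOn ℝ ∞ N U
  injective : ∀ z ∈ U, Function.Injective (fderiv ℝ f z)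
  norm_f : ∀ z ∈ U, inner ℝ (f z) (f z) = (1 : ℝ)
  norm_N : ∀ z ∈ U, inner ℝ (N z) (N z) = (1 : ℝ)
  inner_N_f : ∀ z ∈ U, inner ℝ (N z) (f z) = (0 : ℝ)
  inner_N_deriv : ∀ z ∈ U, ∀ v, inner ℝ (N z) (fderiv ℝ f z v) = (0 : ℝ)
  mem_iff : ∀ z ∈ U, ∀ κ, κ ∈ Λ ↔ ∃ v, v ≠ 0 ∧ fderiv ℝ N z v = -(κ • fderiv ℝ f z v)

/-- The left inverse `(dfᵀ df)⁻¹ dfᵀ` of `df`. -/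
noncomputable def leftInv (f : V → W) (z : V) : W →L[ℝ] V :=
  (Ring.inverse ((ContinuousLinearMap.adjoint (fderiv ℝ f z)).comp (fderiv ℝ f z))).comp
    (ContinuousLinearMap.adjoint (fderiv ℝ f z))

/-- The shape operator, with `dN = -df A`. -/
noncomputable def shape (f N : V → W) (z : V) : V →L[ℝ] V :=
  -((leftInv f z).comp (fderiv ℝ N z))

/-- The projection onto the principal space for `c`, a polynomial in the shape operator. -/
noncomputable def eigenProj (Λ : Finset ℝ) (f N : V → W) (c : ℝ) (z : V) : V →L[ℝ] V :=
  Polynomial.aeval (shape f N z) (Lagrange.basis Λ id c)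

theorem isUnit_gram (L : V →L[ℝ] W) (hL : Function.Injective L) :
    IsUnit ((ContinuousLinearMap.adjoint L).comp L) := by
  rw [ContinuousLinearMap.isUnit_iff_bijective]
  have hinj : Function.Injective ((ContinuousLinearMap.adjoint L).comp L) := by
    rw [injective_iff_map_eq_zero]
    intro v hv
    apply hL
    rw [map_zero, ← inner_self_eq_zero (𝕜 := ℝ), ← ContinuousLinearMap.adjoint_inner_left]
    rw [ContinuousLinearMap.comp_apply] at hv
    rw [hv, inner_zero_left]
  exact ⟨hinj, (LinearMap.injective_iff_surjective
    (f := (((ContinuousLinearMap.adjoint L).comp L : V →L[ℝ] V) : V →ₗ[ℝ] V))).1 hinj⟩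

theorem contDiffOn_aeval {U : Set V} {A : V → V →L[ℝ] V} (hA : ContDiffOn ℝ ∞ A U)
    (p : Polynomial ℝ) : ContDiffOn ℝ ∞ (fun z => Polynomial.aeval (A z) p) U := by
  induction p using Polynomial.induction_on' with
  | add p q hp hq => simpa using hp.add hq
  | monomial k a =>
    simp only [Polynomial.aeval_monomial]
    exact contDiffOn_const.mul (hA.pow k)

theorem aeval_apply_eigenvector {A : V →L[ℝ] V} {c : ℝ} {v : V} (h : A v = c • v)
    (p : Polynomial ℝ) : Polynomial.aeval A p v = p.eval c • v := by
  induction p using Polynomial.induction_on' with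
  | add p q hp hq => simp [hp, hq, add_smul]
  | monomial k a =>
    have : (A ^ k) v = c ^ k • v := by
      induction k with
      | zero => simp
      | succ k ih => rw [pow_succ, mul_apply_eq_comp, h, map_smul, ih, smul_smul,
          pow_succ, mul_comm]
    simp [Polynomial.aeval_monomial, this, Algebra.algebraMap_eq_smul_one, mul_smul]

namespace LocalIsoparametric

variable {U : Set V} {f N : V → W} {Λ : Finset ℝ} (h : LocalIsoparametric U f N Λ)
include h

theorem leftInv_apply {z : V} (hz : z ∈ U) (v : V) : leftInv f z (fderiv ℝ f z v) = v := by
  have := Ring.inverse_mul_cancel _ (isUnit_gram _ (h.injective z hz))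
  exact congrArg (fun L : V →L[ℝ] V => L v) this

theorem leftInv_eq_zero {z : V} {w : W} (hw : ∀ v, inner ℝ w (fderiv ℝ f z v) = (0 : ℝ)) :
    leftInv f z w = 0 := by
  have : ContinuousLinearMap.adjoint (fderiv ℝ f z) w = 0 := by
    refine ext_inner_right ℝ fun v => ?_
    rw [ContinuousLinearMap.adjoint_inner_left, hw, inner_zero_left]
  simp [leftInv, this]

theorem inner_f_deriv {z : V} (hz : z ∈ U) (v : V) :
    inner ℝ (f z) (fderiv ℝ f z v) = (0 : ℝ) := by
  have d := hasFDerivAt_of_smoothOn h.isOpen h.smooth hz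
  have d1 := (d.inner ℝ d).congr_of_eventuallyEq (f₁ := fun _ => (1 : ℝ))
    (by filter_upwards [h.isOpen.mem_nhds hz] with y hy using (h.norm_f y hy).symm)
  have := congrArg (fun L => L v) (d1.unique (hasFDerivAt_const _ _))
  simp [real_inner_comm] at this
  linarith

theorem inner_N_deriv_N {z : V} (hz : z ∈ U) (v : V) :
    inner ℝ (N z) (fderiv ℝ N z v) = (0 : ℝ) := by
  have d := hasFDerivAt_of_smoothOn h.isOpen h.smooth_normal hz
  have d1 := (d.inner ℝ d).congr_of_eventuallyEq (f₁ := fun _ => (1 : ℝ))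
    (by filter_upwards [h.isOpen.mem_nhds hz] with y hy using (h.norm_N y hy).symm)
  have := congrArg (fun L => L v) (d1.unique (hasFDerivAt_const _ _))
  simp [real_inner_comm] at this
  linarith

theorem inner_f_deriv_N {z : V} (hz : z ∈ U) (v : V) :
    inner ℝ (f z) (fderiv ℝ N z v) = (0 : ℝ) := by
  have d := hasFDerivAt_of_smoothOn h.isOpen h.smooth_normal hz
  have d' := hasFDerivAt_of_smoothOn h.isOpen h.smooth hz
  have d1 := (d.inner ℝ d').congr_of_eventuallyEq (f₁ := fun _ => (0 : ℝ))
    (by filter_upwards [h.isOpen.mem_nhds hz] with y hy using (h.inner_N_f y hy).symm)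
  have := congrArg (fun L => L v) (d1.unique (hasFDerivAt_const _ _))
  simp [h.inner_N_deriv z hz] at this
  rw [real_inner_comm]; exact this

theorem inner_deriv_N {z : V} (hz : z ∈ U) (v w : V) :
    inner ℝ (fderiv ℝ N z v) (fderiv ℝ f z w) =
      - inner ℝ (N z) (fderiv ℝ (fderiv ℝ f) z v w) := by
  have d := hasFDerivAt_of_smoothOn h.isOpen h.smooth_normal hz
  have d' := (hasFDerivAt_of_smoothOn h.isOpen (smoothOn_fderiv h.isOpen h.smooth) hz).clm_apply
    (hasFDerivAt_const w z)
  have d1 := (d.inner ℝ d').congr_of_eventuallyEq (f₁ := fun _ => (0 : ℝ))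
    (by filter_upwards [h.isOpen.mem_nhds hz] with y hy using (h.inner_N_deriv y hy w).symm)
  have := congrArg (fun L => L v) (d1.unique (hasFDerivAt_const _ _))
  simp at this
  linarith

/-- Both sides equal minus the `N`-component of `d²f(v, w)`: the second fundamental form is
symmetric. -/
theorem inner_deriv_N_comm {z : V} (hz : z ∈ U) (v w : V) :
    inner ℝ (fderiv ℝ N z v) (fderiv ℝ f z w) =
      (inner ℝ (fderiv ℝ f z v) (fderiv ℝ N z w) : ℝ) := by
  rw [h.inner_deriv_N hz, fderiv_fderiv_comm h.isOpen h.smooth hz, ← h.inner_deriv_N hz,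
    real_inner_comm]

/-- Dimension count: the range of `df` lies in the complement of the orthonormal pair `f, N`, and
the ambient dimension is larger by exactly two. -/
theorem mem_range {z : V} (hz : z ∈ U) {w : W} (hf : inner ℝ (f z) w = (0 : ℝ))
    (hN : inner ℝ (N z) w = (0 : ℝ)) : ∃ v, fderiv ℝ f z v = w := by
  set R := LinearMap.range (fderiv ℝ f z : V →ₗ[ℝ] W)
  have ho : Orthonormal ℝ ![f z, N z] := by
    rw [orthonormal_iff_ite]
    have h1 := h.norm_f z hz
    have h2 := h.norm_N z hz
    have h3 := h.inner_N_f z hz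
    have h4 : inner ℝ (f z) (N z) = (0 : ℝ) := by rw [real_inner_comm]; exact h3
    intro i j
    fin_cases i <;> fin_cases j <;> simp_all
  set S := Submodule.span ℝ (Set.range ![f z, N z])
  have hS : Module.finrank ℝ S = 2 := by
    simpa using finrank_span_eq_card ho.linearIndependent
  have hmem : ∀ u, u ∈ Sᗮ ↔ inner ℝ (f z) u = (0 : ℝ) ∧ inner ℝ (N z) u = (0 : ℝ) := by
    intro u
    rw [Submodule.mem_orthogonal]
    constructor
    · intro hu
      exact ⟨hu _ (Submodule.subset_span ⟨0, rfl⟩), hu _ (Submodule.subset_span ⟨1, rfl⟩)⟩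
    · rintro ⟨h1, h2⟩ x hx
      induction hx using Submodule.span_induction with
      | mem x hx =>
        obtain ⟨i, rfl⟩ := hx
        fin_cases i
        · exact h1
        · exact h2
      | zero => simp
      | add x y _ _ hx hy => rw [inner_add_left, hx, hy, add_zero]
      | smul c x _ hx => rw [inner_smul_left, hx, mul_zero]
  have hle : R ≤ Sᗮ := by
    rintro _ ⟨v, rfl⟩
    exact (hmem _).2 ⟨h.inner_f_deriv hz v, h.inner_N_deriv z hz v⟩
  have hR : Module.finrank ℝ R = Module.finrank ℝ V :=
    LinearMap.finrank_range_of_inj (h.injective z hz)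
  have hSo := Submodule.finrank_add_finrank_orthogonal S
  have := Submodule.eq_of_le_of_finrank_eq hle (by rw [hR]; have := h.finrank_eq; omega)
  have hw : w ∈ R := this ▸ (hmem w).2 ⟨hf, hN⟩
  exact hw

theorem deriv_leftInv {z : V} (hz : z ∈ U) (w : W) :
    fderiv ℝ f z (leftInv f z w) = w - (inner ℝ (f z) w : ℝ) • f z - (inner ℝ (N z) w : ℝ) • N z := by
  have h3 := h.inner_N_f z hz
  have h4 : inner ℝ (f z) (N z) = (0 : ℝ) := by rw [real_inner_comm]; exact h3
  obtain ⟨v, hv⟩ := h.mem_range hz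
    (w := w - (inner ℝ (f z) w : ℝ) • f z - (inner ℝ (N z) w : ℝ) • N z)
    (by simp only [inner_sub_right, inner_smul_right, h.norm_f z hz, h4, mul_one, mul_zero,
      sub_self])
    (by simp only [inner_sub_right, inner_smul_right, h.norm_N z hz, h3, mul_one, mul_zero,
      sub_zero, sub_self])
  rw [← hv]
  congr 1
  have e1 : leftInv f z (f z) = 0 := h.leftInv_eq_zero (h.inner_f_deriv hz)
  have e2 : leftInv f z (N z) = 0 := h.leftInv_eq_zero (h.inner_N_deriv z hz)
  have := congrArg (leftInv f z) hv
  rw [h.leftInv_apply hz] at this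
  simp [e1, e2] at this
  exact this.symm

theorem deriv_N {z : V} (hz : z ∈ U) (v : V) :
    fderiv ℝ N z v = - fderiv ℝ f z (shape f N z v) := by
  simp [shape, h.deriv_leftInv hz, h.inner_f_deriv_N hz, h.inner_N_deriv_N hz]

theorem smooth_leftInv : ContDiffOn ℝ ∞ (leftInv f) U := by
  have hd := smoothOn_fderiv h.isOpen h.smooth
  have ha : ContDiffOn ℝ ∞ (fun z => ContinuousLinearMap.adjoint (fderiv ℝ f z)) U := by
    have := (ContinuousLinearMap.adjoint (𝕜 := ℝ) (E := V) (F := W)).toContinuousLinearEquiv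
      |>.contDiff (n := ∞)
    exact ContDiff.comp_contDiffOn (g := fun L : V →L[ℝ] W => ContinuousLinearMap.adjoint L) this hd
  refine ContDiffOn.clm_comp ?_ ha
  intro z hz
  obtain ⟨u, hu⟩ := isUnit_gram _ (h.injective z hz)
  have h1 : ContDiffAt ℝ ∞ (Ring.inverse : (V →L[ℝ] V) → (V →L[ℝ] V)) (u : V →L[ℝ] V) :=
    contDiffAt_ringInverse ℝ u
  rw [hu] at h1
  exact ContDiffAt.comp_contDiffWithinAt z h1 ((ha.clm_comp hd) z hz)

theorem smooth_shape : ContDiffOn ℝ ∞ (shape f N) U :=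
  (h.smooth_leftInv.clm_comp (smoothOn_fderiv h.isOpen h.smooth_normal)).neg

theorem smooth_eigenProj (c : ℝ) : ContDiffOn ℝ ∞ (eigenProj Λ f N c) U :=
  contDiffOn_aeval h.smooth_shape _

/-- A `g₀`-orthonormal basis of principal vectors. -/
theorem exists_principal_basis {z : V} (hz : z ∈ U) :
    ∃ (b : Module.Basis (Fin (Module.finrank ℝ V)) ℝ V) (lam : Fin (Module.finrank ℝ V) → ℝ),
      (∀ i j, inner ℝ (fderiv ℝ f z (b i)) (fderiv ℝ f z (b j)) = (if i = j then 1 else 0 : ℝ)) ∧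
      (∀ i, shape f N z (b i) = lam i • b i) ∧ (∀ i, lam i ∈ Λ) := by
  set L : V →ₗ[ℝ] W := (fderiv ℝ f z : V →ₗ[ℝ] W) with hLdef
  have hL : Function.Injective L := h.injective z hz
  set e := LinearEquiv.ofInjective L hL
  have he : ∀ v, ((e v : L.range) : W) = fderiv ℝ f z v := fun v => rfl
  -- The inner product of `V` is not `g₀`. Transported to the range of `df`, where `g₀` is the
  -- ambient inner product, the shape operator is symmetric and the spectral theorem applies.
  set A' : L.range →ₗ[ℝ] L.range :=
    e.toLinearMap ∘ₗ (shape f N z : V →ₗ[ℝ] V) ∘ₗ e.symm.toLinearMap with hA'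
  have hsymm : A'.IsSymmetric := by
    intro x y
    obtain ⟨v, rfl⟩ := e.surjective x
    obtain ⟨w, rfl⟩ := e.surjective y
    have h1 := h.inner_deriv_N_comm hz v w
    rw [h.deriv_N hz, h.deriv_N hz, inner_neg_left, inner_neg_right, neg_inj] at h1
    simpa [hA', Submodule.coe_inner, he] using h1
  have hn : Module.finrank ℝ L.range = Module.finrank ℝ V := LinearMap.finrank_range_of_inj hL
  set ob := hsymm.eigenvectorBasis hn
  set lam := hsymm.eigenvalues hn
  have hob : ∀ i, A' (ob i) = lam i • ob i := fun i => hsymm.apply_eigenvectorBasis hn i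
  refine ⟨ob.toBasis.map e.symm, lam, ?_, ?_, ?_⟩
  · intro i j
    have := orthonormal_iff_ite.1 ob.orthonormal i j
    rw [← this, Submodule.coe_inner, ← he, ← he]
    simp
  · intro i
    have := congrArg e.symm (hob i)
    simpa [hA'] using this
  · intro i
    refine (h.mem_iff z hz _).2 ⟨(ob.toBasis.map e.symm) i, Module.Basis.ne_zero _ _, ?_⟩
    have := congrArg e.symm (hob i)
    rw [h.deriv_N hz, ← map_smul]
    congr 2
    simpa [hA'] using this

end LocalIsoparametric
end

/-! ### Focal maps -/

section
variable {V W : Type*} [NormedAddCommGroup V] [InnerProductSpace ℝ V] [FiniteDimensional ℝ V]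
    [NormedAddCommGroup W] [InnerProductSpace ℝ W] [FiniteDimensional ℝ W]

/-- A `g₀`-orthonormal basis of principal vectors at `z`. -/
structure PrincipalFrame (f N : V → W) (Λ : Finset ℝ) (z : V) {ι : Type*}
    (b : Module.Basis ι ℝ V) (lam : ι → ℝ) : Prop where
  orth : ∀ i j, inner ℝ (fderiv ℝ f z (b i)) (fderiv ℝ f z (b j)) =
    (open Classical in if i = j then 1 else 0 : ℝ)
  shape_b : ∀ i, shape f N z (b i) = lam i • b i
  mem : ∀ i, lam i ∈ Λ

/-- The multiple `a f + N` of the focal map. -/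
def focalMap (f N : V → W) (a : ℝ) (z : V) : W := a • f z + N z

/-- The normal field `a N - f` of the focal map. -/
def focalNormal (f N : V → W) (a : ℝ) (z : V) : W := a • N z - f z

/-- The orthogonal projection onto the range of the differential of the focal map. -/
noncomputable def focalProj (Λ : Finset ℝ) (f N : V → W) (a : ℝ) (z : V) : W →L[ℝ] W :=
  (fderiv ℝ f z).comp ((ContinuousLinearMap.id ℝ V - eigenProj Λ f N a z).comp (leftInv f z))

/-- A right inverse of the differential of the focal map on its range. -/
noncomputable def focalInv (Λ : Finset ℝ) (f N : V → W) (a : ℝ) (z : V) : W →L[ℝ] V :=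
  (∑ e ∈ Λ.erase a, (a - e)⁻¹ • eigenProj Λ f N e z).comp (leftInv f z)

/-- The shape operator of the focal map in the direction of the focal normal. -/
noncomputable def focalShape (Λ : Finset ℝ) (f N : V → W) (a : ℝ) (z : V) (u : W) : W :=
  focalForm (focalProj Λ f N a) (focalInv Λ f N a) z u (focalNormal f N a z)

theorem clm_eq_of_basis {ι : Type*} (b : Module.Basis ι ℝ V) {E : Type*} [NormedAddCommGroup E]
    [NormedSpace ℝ E] {L L' : V →L[ℝ] E} (hL : ∀ i, L (b i) = L' (b i)) : L = L' :=
  ContinuousLinearMap.coe_injective (b.ext hL)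

namespace LocalIsoparametric

variable {U : Set V} {f N : V → W} {Λ : Finset ℝ} (h : LocalIsoparametric U f N Λ)
include h

theorem exists_frame {z : V} (hz : z ∈ U) :
    ∃ (b : Module.Basis (Fin (Module.finrank ℝ V)) ℝ V) (lam : Fin (Module.finrank ℝ V) → ℝ),
      PrincipalFrame f N Λ z b lam := by
  obtain ⟨b, lam, h1, h2, h3⟩ := h.exists_principal_basis hz
  refine ⟨b, lam, fun i j => ?_, h2, h3⟩
  rw [h1 i j]
  congr

theorem deriv_N_of_shape {z : V} (hz : z ∈ U) {v : V} {c : ℝ} (hv : shape f N z v = c • v) :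
    fderiv ℝ N z v = -(c • fderiv ℝ f z v) := by
  rw [h.deriv_N hz, hv, map_smul]

theorem shape_of_deriv_N {z : V} (hz : z ∈ U) {v : V} {c : ℝ}
    (hv : fderiv ℝ N z v = -(c • fderiv ℝ f z v)) : shape f N z v = c • v := by
  apply h.injective z hz
  rw [h.deriv_N hz, neg_inj] at hv
  rw [hv, map_smul]

theorem exists_shape_eq {z : V} (hz : z ∈ U) {c : ℝ} (hc : c ∈ Λ) :
    ∃ v, v ≠ 0 ∧ shape f N z v = c • v := by
  obtain ⟨v, h0, hv⟩ := (h.mem_iff z hz c).1 hc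
  exact ⟨v, h0, h.shape_of_deriv_N hz hv⟩

/-- The Lagrange polynomial is `1` at `e` and `0` at the other principal curvatures. -/
theorem eigenProj_apply {z : V} {v : V} {c e : ℝ} (hc : c ∈ Λ) (he : e ∈ Λ)
    (hv : shape f N z v = c • v) : eigenProj Λ f N e z v = if c = e then v else 0 := by
  rw [eigenProj, aeval_apply_eigenvector hv]
  split_ifs with hce
  · subst hce
    have := Lagrange.eval_basis_self (Function.injective_id.injOn (s := (Λ : Set ℝ))) hc
    simp only [id] at this
    rw [this, one_smul]
  · have := Lagrange.eval_basis_of_ne (s := Λ) (v := id) (Ne.symm hce) hc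
    simp only [id] at this
    rw [this, zero_smul]

theorem shape_eigenProj {z : V} (hz : z ∈ U) {c : ℝ} (hc : c ∈ Λ) (v : V) :
    shape f N z (eigenProj Λ f N c z v) = c • eigenProj Λ f N c z v := by
  obtain ⟨b, lam, hb⟩ := h.exists_frame hz
  have : (shape f N z).comp (eigenProj Λ f N c z) = c • eigenProj Λ f N c z := by
    refine clm_eq_of_basis b fun i => ?_
    rw [ContinuousLinearMap.comp_apply, smul_apply,
      h.eigenProj_apply (hb.mem i) hc (hb.shape_b i)]
    split_ifs with hi
    · rw [hb.shape_b, hi]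
    · simp
  exact congrArg (fun L : V →L[ℝ] V => L v) this

/-- Self-adjointness with respect to `g₀`, which makes `focalProj` an orthogonal projection. Both
bilinear forms agree on an orthonormal principal frame. -/
theorem inner_eigenProj {z : V} (hz : z ∈ U) {c : ℝ} (hc : c ∈ Λ) (v w : V) :
    inner ℝ (fderiv ℝ f z (eigenProj Λ f N c z v)) (fderiv ℝ f z w) =
      (inner ℝ (fderiv ℝ f z v) (fderiv ℝ f z (eigenProj Λ f N c z w)) : ℝ) := by
  obtain ⟨b, lam, hb⟩ := h.exists_frame hz
  set L := fderiv ℝ f z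
  set τ := eigenProj Λ f N c z
  have : ((innerSL ℝ (E := W)).flip.comp L).flip.comp (L.comp τ)
      = ((innerSL ℝ (E := W)).flip.comp (L.comp τ)).flip.comp L := by
    refine clm_eq_of_basis b fun i => clm_eq_of_basis b fun j => ?_
    simp only [ContinuousLinearMap.comp_apply, ContinuousLinearMap.flip_apply, innerSL_apply_apply, τ,
      h.eigenProj_apply (hb.mem _) hc (hb.shape_b _)]
    by_cases hij : i = j
    · subst hij; split_ifs <;> simp
    · have := hb.orth i j
      rw [if_neg hij] at this
      split_ifs <;> simp [L, this]
  exact congrArg (fun M : V →L[ℝ] V →L[ℝ] ℝ => M v w) this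

theorem smooth_focalMap (a : ℝ) : ContDiffOn ℝ ∞ (focalMap f N a) U :=
  (contDiffOn_const.smul h.smooth).add h.smooth_normal

theorem smooth_focalNormal (a : ℝ) : ContDiffOn ℝ ∞ (focalNormal f N a) U :=
  (contDiffOn_const.smul h.smooth_normal).sub h.smooth

theorem deriv_focalMap {z : V} (hz : z ∈ U) (a : ℝ) :
    fderiv ℝ (focalMap f N a) z = a • fderiv ℝ f z + fderiv ℝ N z :=
  (((hasFDerivAt_of_smoothOn h.isOpen h.smooth hz).const_smul a).add
    (hasFDerivAt_of_smoothOn h.isOpen h.smooth_normal hz)).fderiv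

theorem deriv_focalNormal {z : V} (hz : z ∈ U) (a : ℝ) :
    fderiv ℝ (focalNormal f N a) z = a • fderiv ℝ N z - fderiv ℝ f z :=
  (((hasFDerivAt_of_smoothOn h.isOpen h.smooth_normal hz).const_smul a).sub
    (hasFDerivAt_of_smoothOn h.isOpen h.smooth hz)).fderiv

theorem deriv_focalMap_of_shape {z : V} (hz : z ∈ U) (a : ℝ) {v : V} {c : ℝ}
    (hv : shape f N z v = c • v) :
    fderiv ℝ (focalMap f N a) z v = (a - c) • fderiv ℝ f z v := by
  rw [h.deriv_focalMap hz]
  simp only [add_apply, smul_apply, h.deriv_N_of_shape hz hv]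
  module

theorem deriv_focalNormal_of_shape {z : V} (hz : z ∈ U) (a : ℝ) {v : V} {c : ℝ}
    (hv : shape f N z v = c • v) :
    fderiv ℝ (focalNormal f N a) z v = -((1 + a * c) • fderiv ℝ f z v) := by
  rw [h.deriv_focalNormal hz]
  simp only [sub_apply, smul_apply,
    h.deriv_N_of_shape hz hv]
  module

theorem focalProj_deriv {z : V} (hz : z ∈ U) (a : ℝ) (v : V) :
    focalProj Λ f N a z (fderiv ℝ f z v) = fderiv ℝ f z (v - eigenProj Λ f N a z v) := by
  simp [focalProj, h.leftInv_apply hz]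

theorem focalProj_of_shape {z : V} (hz : z ∈ U) {a : ℝ} (ha : a ∈ Λ) {v : V} {c : ℝ} (hc : c ∈ Λ)
    (hv : shape f N z v = c • v) :
    focalProj Λ f N a z (fderiv ℝ f z v) = if c = a then 0 else fderiv ℝ f z v := by
  rw [h.focalProj_deriv hz, h.eigenProj_apply hc ha hv]
  split_ifs <;> simp

theorem focalInv_of_shape {z : V} (hz : z ∈ U) {a : ℝ} {v : V} {c : ℝ} (hc : c ∈ Λ)
    (hv : shape f N z v = c • v) :
    focalInv Λ f N a z (fderiv ℝ f z v) = if c = a then 0 else (a - c)⁻¹ • v := by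
  simp only [focalInv, ContinuousLinearMap.comp_apply, h.leftInv_apply hz,
    sum_apply, smul_apply]
  have : ∀ e ∈ Λ.erase a, (a - e)⁻¹ • eigenProj Λ f N e z v
      = if c = e then (a - e)⁻¹ • v else 0 := by
    intro e he
    rw [h.eigenProj_apply hc (Finset.mem_of_mem_erase he) hv]
    split_ifs <;> simp
  rw [Finset.sum_congr rfl this, Finset.sum_ite_eq]
  simp [hc]

theorem focalProj_focalNormal {z : V} (hz : z ∈ U) (a b c : ℝ) :
    focalProj Λ f N a z (b • N z + c • f z) = 0 := by
  have e1 : leftInv f z (f z) = 0 := h.leftInv_eq_zero (h.inner_f_deriv hz)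
  have e2 : leftInv f z (N z) = 0 := h.leftInv_eq_zero (h.inner_N_deriv z hz)
  simp [focalProj, e1, e2]

theorem inner_deriv_left {z : V} (hz : z ∈ U) (v : V) (w : W) :
    (inner ℝ (fderiv ℝ f z v) w : ℝ) =
      inner ℝ (fderiv ℝ f z v) (fderiv ℝ f z (leftInv f z w)) := by
  rw [h.deriv_leftInv hz, inner_sub_right, inner_sub_right, inner_smul_right, inner_smul_right,
    real_inner_comm (f z), real_inner_comm (N z), h.inner_f_deriv hz, h.inner_N_deriv z hz]
  ring

theorem focalProj_symm {z : V} (hz : z ∈ U) {a : ℝ} (ha : a ∈ Λ) (u w : W) :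
    (inner ℝ (focalProj Λ f N a z u) w : ℝ) = inner ℝ u (focalProj Λ f N a z w) := by
  have e1 : ∀ u : W, focalProj Λ f N a z u
      = fderiv ℝ f z (leftInv f z u - eigenProj Λ f N a z (leftInv f z u)) := fun u => by
    simp [focalProj]
  rw [e1, e1, h.inner_deriv_left hz, real_inner_comm _ u, h.inner_deriv_left hz _ u]
  simp only [map_sub, inner_sub_left, h.inner_eigenProj hz ha]
  rw [real_inner_comm (fderiv ℝ f z (leftInv f z w)), real_inner_comm
    (fderiv ℝ f z (eigenProj Λ f N a z (leftInv f z w))), h.inner_eigenProj hz ha]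

theorem smooth_focalProj (a : ℝ) : ContDiffOn ℝ ∞ (focalProj Λ f N a) U := by
  have h1 : ContDiffOn ℝ ∞ (fun z => ContinuousLinearMap.id ℝ V - eigenProj Λ f N a z) U :=
    contDiffOn_const.sub (h.smooth_eigenProj a)
  exact (smoothOn_fderiv h.isOpen h.smooth).clm_comp (h1.clm_comp h.smooth_leftInv)

theorem smooth_focalInv (a : ℝ) : ContDiffOn ℝ ∞ (focalInv Λ f N a) U := by
  have h1 : ContDiffOn ℝ ∞ (fun z => ∑ e ∈ Λ.erase a, (a - e)⁻¹ • eigenProj Λ f N e z) U :=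
    ContDiffOn.sum fun e _ => (h.smooth_eigenProj e).const_smul _
  exact h1.clm_comp h.smooth_leftInv

/-- On a principal vector for `c` the differential is `(a - c) df`, so its kernel is the principal
space of `a`, and its range is the image under `df` of the other principal spaces. The identities
for `dφ` on all vectors follow from a principal frame. -/
theorem focal_constantRank {a : ℝ} (ha : a ∈ Λ) :
    ConstantRank U (focalMap f N a) (focalProj Λ f N a) (focalInv Λ f N a)
      (eigenProj Λ f N a) where
  isOpen := h.isOpen
  smooth := h.smooth_focalMap a
  smooth_P := h.smooth_focalProj a
  smooth_ρ := h.smooth_focalInv a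
  smooth_τ := h.smooth_eigenProj a
  idem := by
    intro z hz u
    have e1 : focalProj Λ f N a z u
      = fderiv ℝ f z (leftInv f z u - eigenProj Λ f N a z (leftInv f z u)) := by
      simp [focalProj]
    rw [e1, h.focalProj_deriv hz, map_sub (eigenProj Λ f N a z),
      h.eigenProj_apply ha ha (h.shape_eigenProj hz ha _)]
    simp
  symm := fun z hz => h.focalProj_symm hz ha
  P_deriv := by
    intro z hz v
    obtain ⟨b, lam, hb⟩ := h.exists_frame hz
    have : (focalProj Λ f N a z).comp (fderiv ℝ (focalMap f N a) z)
        = fderiv ℝ (focalMap f N a) z := by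
      refine clm_eq_of_basis b fun i => ?_
      rw [ContinuousLinearMap.comp_apply, h.deriv_focalMap_of_shape hz a (hb.shape_b i), map_smul,
        h.focalProj_of_shape hz ha (hb.mem i) (hb.shape_b i)]
      split_ifs with hi <;> simp [hi]
    exact congrArg (fun L : V →L[ℝ] W => L v) this
  deriv_ρ := by
    intro z hz u
    obtain ⟨b, lam, hb⟩ := h.exists_frame hz
    have : ((fderiv ℝ (focalMap f N a) z).comp (focalInv Λ f N a z)).comp (fderiv ℝ f z)
        = (focalProj Λ f N a z).comp (fderiv ℝ f z) := by
      refine clm_eq_of_basis b fun i => ?_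
      simp only [ContinuousLinearMap.comp_apply]
      rw [h.focalProj_of_shape hz ha (hb.mem i) (hb.shape_b i),
        h.focalInv_of_shape hz (hb.mem i) (hb.shape_b i)]
      split_ifs with hi
      · simp
      · rw [map_smul, h.deriv_focalMap_of_shape hz a (hb.shape_b i),
          inv_smul_smul₀ (sub_ne_zero.2 (Ne.symm hi))]
    have := congrArg (fun L : V →L[ℝ] W => L (leftInv f z u)) this
    simpa [focalProj, focalInv, h.leftInv_apply hz] using this
  deriv_τ := by
    intro z hz v
    rw [h.deriv_focalMap_of_shape hz a (h.shape_eigenProj hz ha v), sub_self, zero_smul]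
  τ_eq := by
    intro z hz v hv
    have : shape f N z v = a • v := by
      apply h.shape_of_deriv_N hz
      rw [h.deriv_focalMap hz] at hv
      rw [eq_neg_iff_add_eq_zero, add_comm]
      exact hv
    rw [h.eigenProj_apply ha ha this, if_pos rfl]

/-- On this vector `dη = -(1 + a c) df` and `dφ = (a - c) df`; the focal principal curvature is
minus the quotient. -/
theorem focalShape_of_shape {z : V} (hz : z ∈ U) {a : ℝ} (ha : a ∈ Λ) {v : V} {c : ℝ} (hc : c ∈ Λ)
    (hca : c ≠ a) (hv : shape f N z v = c • v) :
    focalShape Λ f N a z (fderiv ℝ f z v) = ((1 + a * c) / (a - c)) • fderiv ℝ f z v := by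
  rw [focalShape, (h.focal_constantRank ha).focalForm_apply (h.smooth_focalNormal a)
    (fun y hy => by simpa [focalNormal, sub_eq_add_neg] using h.focalProj_focalNormal hy a a (-1))
    hz, h.focalInv_of_shape hz hc hv, if_neg hca, map_smul, h.deriv_focalNormal_of_shape hz a hv,
    map_smul, map_neg, map_smul, h.focalProj_of_shape hz ha hc hv, if_neg hca, smul_neg, neg_neg,
    smul_smul]
  congr 1
  field_simp

theorem focalProj_focalShape {z : V} (hz : z ∈ U) {a : ℝ} (ha : a ∈ Λ) (u : W) :
    focalProj Λ f N a z (focalShape Λ f N a z u) = focalShape Λ f N a z u := by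
  rw [focalShape, (h.focal_constantRank ha).focalForm_apply (h.smooth_focalNormal a)
    (fun y hy => by simpa [focalNormal, sub_eq_add_neg] using h.focalProj_focalNormal hy a a (-1))
    hz, map_neg, (h.focal_constantRank ha).idem z hz]

/-- For normal `u` the lift `ρ u` is vertical, and `dP` vanishes on vertical vectors. -/
theorem focalShape_of_orth {z : V} (hz : z ∈ U) {a : ℝ} (ha : a ∈ Λ) {u : W}
    (hu : focalProj Λ f N a z u = 0) : focalShape Λ f N a z u = 0 := by
  have : focalInv Λ f N a z u = eigenProj Λ f N a z (focalInv Λ f N a z u) := by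
    refine ((h.focal_constantRank ha).τ_eq z hz _ ?_).symm
    rw [(h.focal_constantRank ha).deriv_ρ z hz, hu]
  rw [focalShape, focalForm, ContinuousLinearMap.comp_apply,
    (h.focal_constantRank ha).fderiv_P_eq_zero hz, zero_apply]
  rw [(h.focal_constantRank ha).deriv_ρ z hz, hu]

end LocalIsoparametric
end

/-! ### Curves in a leaf along which the focal normal rotates -/

/-- A function with vanishing derivative on an interval around `0` is constant there. -/
theorem eq_of_hasDerivAt_zero {E : Type*} [NormedAddCommGroup E] [NormedSpace ℝ E] {ε : ℝ}
    {c : ℝ → E} (hc : ∀ s ∈ Set.Ioo (-ε) ε, HasDerivAt c 0 s) {s : ℝ} (hs : s ∈ Set.Ioo (-ε) ε) :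
    c s = c 0 := by
  have h0 : (0 : ℝ) ∈ Set.Ioo (-ε) ε := by
    constructor <;> linarith [hs.1, hs.2]
  refine isOpen_Ioo.is_const_of_deriv_eq_zero isPreconnected_Ioo
    (fun t ht => (hc t ht).differentiableAt.differentiableWithinAt)
    (fun t ht => (hc t ht).deriv) hs h0

section
variable {V W : Type*} [NormedAddCommGroup V] [InnerProductSpace ℝ V] [FiniteDimensional ℝ V]
    [NormedAddCommGroup W] [InnerProductSpace ℝ W] [FiniteDimensional ℝ W]

/-- The rotation in the plane spanned by the orthogonal vectors `u` and `v` of squared length `r`. -/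
noncomputable def planeRotation (r : ℝ) (u v : W) : W →L[ℝ] W :=
  r⁻¹ • ((innerSL ℝ u).smulRight v - (innerSL ℝ v).smulRight u)

theorem planeRotation_apply (r : ℝ) (u v w : W) :
    planeRotation r u v w = r⁻¹ • ((inner ℝ u w : ℝ) • v - (inner ℝ v w : ℝ) • u) := by
  simp [planeRotation]

theorem inner_planeRotation_self (r : ℝ) (u v w : W) :
    inner ℝ (planeRotation r u v w) w = (0 : ℝ) := by
  rw [planeRotation_apply, inner_smul_left, inner_sub_left, inner_smul_left, inner_smul_left]
  simp only [conj_trivial]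
  ring

/-- The solution of `η' = Jη` is a great circle. -/
theorem eq_cos_add_sin {ε r : ℝ} (hr : r ≠ 0) {u v : W} (huu : inner ℝ u u = r)
    (hvv : inner ℝ v v = r) (huv : inner ℝ u v = (0 : ℝ)) {c : ℝ → W} (h0 : c 0 = u)
    (hc : ∀ s ∈ Set.Ioo (-ε) ε, HasDerivAt c (planeRotation r u v (c s)) s) {s : ℝ}
    (hs : s ∈ Set.Ioo (-ε) ε) : c s = Real.cos s • u + Real.sin s • v := by
  set δ : ℝ → W := fun s => c s - (Real.cos s • u + Real.sin s • v) with hδ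
  have hvu : inner ℝ v u = (0 : ℝ) := by rw [real_inner_comm]; exact huv
  have hd : ∀ s ∈ Set.Ioo (-ε) ε, HasDerivAt δ (planeRotation r u v (δ s)) s := by
    intro s hs
    have h1 := (hc s hs).sub (((Real.hasDerivAt_cos s).smul_const u).add
      ((Real.hasDerivAt_sin s).smul_const v))
    refine h1.congr_deriv ?_
    have e1 : planeRotation r u v u = v := by
      rw [planeRotation_apply, huu, hvu, zero_smul, sub_zero, inv_smul_smul₀ hr]
    have e2 : planeRotation r u v v = -u := by
      rw [planeRotation_apply, hvv, huv, zero_smul, zero_sub, smul_neg, inv_smul_smul₀ hr]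
    simp only [hδ, map_sub, map_add, map_smul, e1, e2]
    module
  -- The difference from the great circle satisfies the same linear equation with a skew operator,
  -- so its norm is constant, and it vanishes at `0`.
  have hq : ∀ s ∈ Set.Ioo (-ε) ε, HasDerivAt (fun s => (inner ℝ (δ s) (δ s) : ℝ)) 0 s := by
    intro s hs
    refine ((hd s hs).inner ℝ (hd s hs)).congr_deriv ?_
    rw [inner_planeRotation_self, real_inner_comm, inner_planeRotation_self, add_zero]
  have h1 := eq_of_hasDerivAt_zero hq hs
  have h2 : δ 0 = 0 := by simp [hδ, h0]
  simp only [h2, inner_zero_left] at h1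
  exact sub_eq_zero.1 (inner_self_eq_zero.1 h1)

namespace LocalIsoparametric

variable {U : Set V} {f N : V → W} {Λ : Finset ℝ} (h : LocalIsoparametric U f N Λ)
include h

theorem inner_focalNormal {z : V} (hz : z ∈ U) (a : ℝ) :
    inner ℝ (focalNormal f N a z) (focalNormal f N a z) = 1 + a ^ 2 := by
  have h3 := h.inner_N_f z hz
  have h4 : inner ℝ (f z) (N z) = (0 : ℝ) := by rw [real_inner_comm]; exact h3
  simp only [focalNormal, inner_sub_left, inner_sub_right, inner_smul_left, inner_smul_right,
    h.norm_f z hz, h.norm_N z hz, h3, h4, conj_trivial]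
  ring

theorem inner_focalMap_focalNormal {z : V} (hz : z ∈ U) (a : ℝ) :
    inner ℝ (focalMap f N a z) (focalNormal f N a z) = (0 : ℝ) := by
  have h3 := h.inner_N_f z hz
  have h4 : inner ℝ (f z) (N z) = (0 : ℝ) := by rw [real_inner_comm]; exact h3
  simp only [focalNormal, focalMap, inner_sub_right, inner_add_left, inner_smul_left,
    inner_smul_right, h.norm_f z hz, h.norm_N z hz, h3, h4, conj_trivial]
  ring

/-- Along a curve in a leaf of the principal distribution for `a`, the shape operator of the focal
map is a linear combination of two constant operators. -/
theorem exists_leaf_curve {z : V} (hz : z ∈ U) {a : ℝ} (ha : a ∈ Λ) {X : V}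
    (hX : shape f N z X = a • X)
    (hXn : (1 + a ^ 2) * inner ℝ (fderiv ℝ f z X) (fderiv ℝ f z X) = 1) :
    ∃ ε > 0, ∃ γ : ℝ → V, γ 0 = z ∧ HasDerivAt γ X 0 ∧ ∀ s ∈ Set.Ioo (-ε) ε, γ s ∈ U ∧
      ∀ u, focalShape Λ f N a (γ s) u = Real.cos s • focalShape Λ f N a z u + Real.sin s •
        focalForm (focalProj Λ f N a) (focalInv Λ f N a) z u
          (fderiv ℝ (focalNormal f N a) z X) := by
  have hr : (1 + a ^ 2 : ℝ) ≠ 0 := by positivity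
  set r := 1 + a ^ 2 with hrdef
  have hCR := h.focal_constantRank ha
  set η := focalNormal f N a with hη
  set φ := focalMap f N a with hφ
  set ζ := fderiv ℝ η z X with hζ
  have hζ' : ζ = -(r • fderiv ℝ f z X) := by
    rw [hζ, hη, h.deriv_focalNormal_of_shape hz a hX, hrdef, pow_two]
  set J := planeRotation r (η z) ζ with hJ
  -- On the leaf directions `dη = -(1 + a²) df`. This field is therefore the leaf direction for
  -- which `dη T` is the part of `J η` in the principal space of `a`; along the integral curve that
  -- part turns out to be all of `J η`.
  set T : V → V := fun y => -(r⁻¹ • eigenProj Λ f N a y (leftInv f y (J (η y)))) with hT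
  have hηz : inner ℝ (η z) (η z) = r := h.inner_focalNormal hz a
  have hζζ : inner ℝ ζ ζ = r := by
    rw [hζ']
    simp only [inner_neg_left, inner_neg_right, inner_smul_left, inner_smul_right, conj_trivial]
    linear_combination r * hXn
  have hfX : inner ℝ (f z) ζ = (0 : ℝ) := by
    rw [hζ', inner_neg_right, inner_smul_right, h.inner_f_deriv hz]; simp
  have hNX : inner ℝ (N z) ζ = (0 : ℝ) := by
    rw [hζ', inner_neg_right, inner_smul_right, h.inner_N_deriv z hz]; simp
  have hηζ : inner ℝ (η z) ζ = (0 : ℝ) := by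
    simp only [hη, focalNormal, inner_sub_left, inner_smul_left, hfX, hNX]; simp
  have hφζ : inner ℝ (φ z) ζ = (0 : ℝ) := by
    simp only [hφ, focalMap, inner_add_left, inner_smul_left, hfX, hNX]; simp
  have hφη : inner ℝ (φ z) (η z) = (0 : ℝ) := h.inner_focalMap_focalNormal hz a
  have hPη : focalProj Λ f N a z (η z) = 0 := by
    simpa [hη, focalNormal, sub_eq_add_neg] using h.focalProj_focalNormal hz a a (-1)
  have hPζ : focalProj Λ f N a z ζ = 0 := by
    rw [hζ', map_neg, map_smul, h.focalProj_of_shape hz ha ha hX, if_pos rfl]; simp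
  -- The plane of rotation is normal to the focal image at `z` and orthogonal to `φ z`. Both `φ` and
  -- `P` are constant along the curve, so this remains true at its other points.
  have hJs : ∀ w, focalProj Λ f N a z (J w) = 0 ∧ inner ℝ (φ z) (J w) = (0 : ℝ) := by
    intro w
    rw [hJ, planeRotation_apply]
    simp [inner_smul_right, inner_sub_right, hPη, hPζ, hφη, hφζ]
  have hTs : ContDiffOn ℝ ∞ T U :=
    (((h.smooth_eigenProj a).clm_apply (h.smooth_leftInv.clm_apply
      (contDiffOn_const.clm_apply (h.smooth_focalNormal a)))).const_smul _).neg
  have hT1 : ContDiffAt ℝ 1 T z :=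
    (hTs.contDiffAt (h.isOpen.mem_nhds hz)).of_le (by exact WithTop.coe_le_coe.2 le_top)
  obtain ⟨γ, hγ0, ε, hε, hγ⟩ :=
    hT1.exists_forall_mem_closedBall_exists_eq_forall_mem_Ioo_hasDerivAt₀ 0
  have hTz : T z = X := by
    have e1 : J (η z) = ζ := by
      rw [hJ, planeRotation_apply, hηz, real_inner_comm, hηζ, zero_smul, sub_zero,
        inv_smul_smul₀ hr]
    simp only [hT, e1, hζ', map_neg, map_smul, h.leftInv_apply hz, h.eigenProj_apply ha ha hX]
    simp [inv_smul_smul₀ hr]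
  have h00 : (0 : ℝ) ∈ Set.Ioo (0 - ε) (0 + ε) := by constructor <;> linarith
  have hcont : ContinuousAt γ 0 := (hγ 0 h00).continuousAt
  have hmem : ∀ᶠ s in 𝓝 (0 : ℝ), γ s ∈ U := hcont (by rw [hγ0]; exact h.isOpen.mem_nhds hz)
  obtain ⟨ε', hε', hU⟩ := Metric.eventually_nhds_iff_ball.1 hmem
  set ε₁ := min ε ε'
  have hγU : ∀ s ∈ Set.Ioo (-ε₁) ε₁, γ s ∈ U := by
    intro s hs
    apply hU
    rw [Metric.mem_ball, Real.dist_eq, sub_zero, abs_lt]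
    constructor <;> linarith [hs.1, hs.2, min_le_right ε ε']
  have hγd : ∀ s ∈ Set.Ioo (-ε₁) ε₁, HasDerivAt γ (T (γ s)) s := by
    intro s hs
    apply hγ
    constructor <;> linarith [hs.1, hs.2, min_le_left ε ε']
  have hTa : ∀ y ∈ U, shape f N y (T y) = a • T y := by
    intro y hy
    simp only [hT, map_neg, map_smul, h.shape_eigenProj hy ha, smul_neg]
    rw [smul_comm]
  have hφT : ∀ y ∈ U, fderiv ℝ φ y (T y) = 0 := by
    intro y hy
    rw [hφ, h.deriv_focalMap_of_shape hy a (hTa y hy), sub_self, zero_smul]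
  have hφγ : ∀ s ∈ Set.Ioo (-ε₁) ε₁, φ (γ s) = φ z := by
    intro s hs
    rw [← hγ0]
    refine eq_of_hasDerivAt_zero (c := fun s => φ (γ s)) (fun t ht => ?_) hs
    have := (hasFDerivAt_of_smoothOn h.isOpen (h.smooth_focalMap a)
      (hγU t ht)).comp_hasDerivAt t (hγd t ht)
    rwa [hφT _ (hγU t ht)] at this
  have hPγ : ∀ s ∈ Set.Ioo (-ε₁) ε₁, focalProj Λ f N a (γ s) = focalProj Λ f N a z := by
    intro s hs
    rw [← hγ0]
    refine eq_of_hasDerivAt_zero (c := fun s => focalProj Λ f N a (γ s)) (fun t ht => ?_) hs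
    have := (hasFDerivAt_of_smoothOn h.isOpen (h.smooth_focalProj a)
      (hγU t ht)).comp_hasDerivAt t (hγd t ht)
    rwa [hCR.fderiv_P_eq_zero (hγU t ht) (hφT _ (hγU t ht))] at this
  have hQγ : ∀ s ∈ Set.Ioo (-ε₁) ε₁, focalForm (focalProj Λ f N a) (focalInv Λ f N a) (γ s)
      = focalForm (focalProj Λ f N a) (focalInv Λ f N a) z := by
    intro s hs
    rw [← hγ0]
    refine eq_of_hasDerivAt_zero
      (c := fun s => focalForm (focalProj Λ f N a) (focalInv Λ f N a) (γ s)) (fun t ht => ?_) hs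
    have := (hasFDerivAt_of_smoothOn h.isOpen hCR.smooth_focalForm
      (hγU t ht)).comp_hasDerivAt t (hγd t ht)
    rwa [hCR.fderiv_focalForm (hγU t ht) (hφT _ (hγU t ht))] at this
  have hηd : ∀ s ∈ Set.Ioo (-ε₁) ε₁, HasDerivAt (fun s => η (γ s)) (J (η (γ s))) s := by
    intro s hs
    have hsU := hγU s hs
    refine ((hasFDerivAt_of_smoothOn h.isOpen (h.smooth_focalNormal a)
      hsU).comp_hasDerivAt s (hγd s hs)).congr_deriv ?_
    -- Here `w` is orthogonal to `η` and `φ`, hence to `f` and `N`, so it is tangent. Since `P w =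
    -- 0`, it comes from the principal space of `a`, and `dη T = w`.
    set w := J (η (γ s)) with hw
    have w1 : inner ℝ (η (γ s)) w = (0 : ℝ) := by
      rw [real_inner_comm]; exact inner_planeRotation_self _ _ _ _
    have w2 : inner ℝ (φ (γ s)) w = (0 : ℝ) := by rw [hφγ s hs]; exact (hJs _).2
    simp only [hη, hφ, focalNormal, focalMap, inner_sub_left, inner_add_left, inner_smul_left,
      conj_trivial] at w1 w2
    have w3 : inner ℝ (f (γ s)) w = (0 : ℝ) := by
      apply mul_left_cancel₀ hr
      linear_combination a * w2 - w1
    have w4 : inner ℝ (N (γ s)) w = (0 : ℝ) := by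
      apply mul_left_cancel₀ hr
      linear_combination w2 + a * w1
    have w5 := h.deriv_leftInv hsU w
    rw [w3, w4, zero_smul, zero_smul, sub_zero, sub_zero] at w5
    have w6 : focalProj Λ f N a (γ s) w = 0 := by rw [hPγ s hs]; exact (hJs _).1
    rw [← w5, h.focalProj_deriv hsU, map_sub, sub_eq_zero] at w6
    rw [h.deriv_focalNormal_of_shape hsU a (hTa _ hsU)]
    simp only [hT, map_neg, map_smul, smul_neg, neg_neg, ← pow_two, ← hrdef]
    rw [smul_inv_smul₀ hr, ← hw, ← w6, w5]
  refine ⟨ε₁, lt_min hε hε', γ, hγ0, ?_, fun s hs => ⟨hγU s hs, fun u => ?_⟩⟩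
  · have := hγ 0 h00
    rwa [hγ0, hTz] at this
  · have := eq_cos_add_sin hr hηz hζζ hηζ (c := fun s => η (γ s)) (by rw [hγ0]) hηd hs
    rw [focalShape, hQγ s hs, ← hη, this, map_add, map_smul, map_smul]
    rfl

end LocalIsoparametric
end

/-! ### Symmetry of the focal principal curvatures -/

/-- If `cos s A + sin s B` has the eigenvalue `μ` for all small `s`, then `A` has the
eigenvalue `-μ`. -/
theorem exists_eigenvector_neg {W : Type*} [AddCommGroup W] [Module ℝ W] [FiniteDimensional ℝ W]
    (A B : W →ₗ[ℝ] W) (μ ε : ℝ) (hε : 0 < ε)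
    (hs : ∀ s ∈ Set.Ioo (-ε) ε, ∃ u, u ≠ 0 ∧ Real.cos s • A u + Real.sin s • B u = μ • u) :
    ∃ u, u ≠ 0 ∧ A u = (-μ) • u := by
  set b := Module.finBasis ℝ W
  set A' := LinearMap.toMatrix b b A
  set B' := LinearMap.toMatrix b b B
  set M : ℝ → Matrix _ _ ℝ := fun s => Real.cos s • A' + Real.sin s • B' - μ • 1 with hM
  have hMs : ∀ s, M s = LinearMap.toMatrix b b
      (Real.cos s • A + Real.sin s • B - μ • LinearMap.id) := by
    intro s
    simp [hM, A', B']
  have hdet : ∀ s, (M s).det = 0 ↔ ∃ u, u ≠ 0 ∧ Real.cos s • A u + Real.sin s • B u = μ • u := by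
    intro s
    rw [hMs, LinearMap.det_toMatrix, LinearMap.det_eq_zero_iff_ker_ne_bot, Submodule.ne_bot_iff]
    simp only [LinearMap.mem_ker, LinearMap.sub_apply, LinearMap.add_apply, LinearMap.smul_apply,
      LinearMap.id_apply, sub_eq_zero]
    exact exists_congr fun u => and_comm
  -- The determinant is analytic in `s` and vanishes near `0`, hence everywhere. At `s = π` the
  -- operator is `-A`.
  have han : AnalyticOnNhd ℝ (fun s => (M s).det) Set.univ := by
    intro s _
    simp only [Matrix.det_apply, hM]
    refine Finset.analyticAt_fun_sum _ fun σ _ => ?_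
    refine AnalyticAt.const_smul ?_
    refine Finset.analyticAt_fun_prod _ fun i _ => ?_
    simp only [Matrix.sub_apply, Matrix.add_apply, Matrix.smul_apply, smul_eq_mul]
    fun_prop
  have h0 : (fun s => (M s).det) =ᶠ[𝓝 0] fun _ => 0 := by
    filter_upwards [Ioo_mem_nhds (by linarith : -ε < 0) hε] with s hs'
    exact (hdet s).2 (hs s hs')
  have h1 := congrFun (han.eq_of_eventuallyEq (fun _ _ => analyticAt_const) h0) Real.pi
  obtain ⟨u, hu0, hu⟩ := (hdet _).1 h1
  refine ⟨u, hu0, ?_⟩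
  simp at hu
  rw [neg_smul, ← hu, neg_neg]

section
variable {V W : Type*} [NormedAddCommGroup V] [InnerProductSpace ℝ V] [FiniteDimensional ℝ V]
    [NormedAddCommGroup W] [InnerProductSpace ℝ W] [FiniteDimensional ℝ W]

namespace LocalIsoparametric

variable {U : Set V} {f N : V → W} {Λ : Finset ℝ} (h : LocalIsoparametric U f N Λ)
include h

theorem inner_deriv_pos {z : V} (hz : z ∈ U) {v : V} (hv : v ≠ 0) :
    0 < (inner ℝ (fderiv ℝ f z v) (fderiv ℝ f z v) : ℝ) := by
  rw [real_inner_self_pos]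
  intro h0
  exact hv (h.injective z hz (by rw [h0, map_zero]))

/-- This normalization gives `dη X = -(1 + a²) df X` the same length as `η`, so that `s` is the
angle of rotation. -/
theorem exists_unit_principal {z : V} (hz : z ∈ U) {a : ℝ} (ha : a ∈ Λ) :
    ∃ X, shape f N z X = a • X ∧
      (1 + a ^ 2) * inner ℝ (fderiv ℝ f z X) (fderiv ℝ f z X) = 1 := by
  obtain ⟨v, hv, hva⟩ := h.exists_shape_eq hz ha
  have hp := h.inner_deriv_pos hz hv
  set q : ℝ := inner ℝ (fderiv ℝ f z v) (fderiv ℝ f z v)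
  have hq : 0 < (1 + a ^ 2) * q := by positivity
  refine ⟨(Real.sqrt ((1 + a ^ 2) * q))⁻¹ • v, ?_, ?_⟩
  · rw [map_smul, hva, smul_comm]
  · rw [map_smul, inner_smul_left, inner_smul_right, conj_trivial]
    change _ * (_ * (_ * q)) = 1
    have := Real.mul_self_sqrt hq.le
    have h0 : Real.sqrt ((1 + a ^ 2) * q) ≠ 0 := (Real.sqrt_pos.2 hq).ne'
    calc _ = ((1 + a ^ 2) * q) / (Real.sqrt ((1 + a ^ 2) * q) * Real.sqrt ((1 + a ^ 2) * q)) := by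
          field_simp
      _ = 1 := by rw [this, div_self hq.ne']

/-- The principal curvatures of the focal map are symmetric with respect to `0`. -/
theorem exists_reflection {z : V} (hz : z ∈ U) {a c : ℝ} (ha : a ∈ Λ) (hc : c ∈ Λ) (hca : c ≠ a) :
    ∃ e ∈ Λ, e ≠ a ∧ (1 + a * e) / (a - e) = -((1 + a * c) / (a - c)) := by
  obtain ⟨X, hX, hXn⟩ := h.exists_unit_principal hz ha
  obtain ⟨ε, hε, γ, hγ0, -, hγ⟩ := h.exists_leaf_curve hz ha hX hXn
  set μ := (1 + a * c) / (a - c) with hμ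
  by_cases hμ0 : μ = 0
  · exact ⟨c, hc, hca, by rw [← hμ, hμ0, neg_zero]⟩
  set Q := focalForm (focalProj Λ f N a) (focalInv Λ f N a) z
  obtain ⟨u, hu0, hu⟩ := exists_eigenvector_neg (Q.flip (focalNormal f N a z) : W →ₗ[ℝ] W)
    (Q.flip (fderiv ℝ (focalNormal f N a) z X) : W →ₗ[ℝ] W) μ ε hε (by
      intro s hs
      obtain ⟨hU, hK⟩ := hγ s hs
      obtain ⟨v, hv, hvc⟩ := h.exists_shape_eq hU hc
      refine ⟨fderiv ℝ f (γ s) v, fun h0 => hv (h.injective _ hU (by rw [h0, map_zero])), ?_⟩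
      rw [← h.focalShape_of_shape hU ha hc hca hvc, hK]
      rfl)
  have hu' : focalShape Λ f N a z u = (-μ) • u := hu
  -- The values of the shape operator are tangent to the focal image, so an eigenvector for a
  -- nonzero eigenvalue is tangent as well. This is why `μ = 0` was treated separately.
  have hPu : focalProj Λ f N a z u = u := by
    have := h.focalProj_focalShape hz ha u
    rw [hu', map_smul] at this
    exact smul_right_injective W (neg_ne_zero.2 hμ0) this
  obtain ⟨v, rfl⟩ : ∃ v, fderiv ℝ f z v = u := by
    refine ⟨_, hPu⟩
  obtain ⟨b, lam, hb⟩ := h.exists_frame hz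
  set k : Fin (Module.finrank ℝ V) → ℝ :=
    fun i => if lam i = a then 0 else (1 + a * lam i) / (a - lam i) with hk
  have hKb : ∀ i, focalShape Λ f N a z (fderiv ℝ f z (b i)) = k i • fderiv ℝ f z (b i) := by
    intro i
    by_cases hi : lam i = a
    · simp only [hk, hi, if_true, zero_smul]
      refine h.focalShape_of_orth hz ha ?_
      rw [h.focalProj_of_shape hz ha (hb.mem i) (hb.shape_b i), if_pos hi]
    · simp only [hk, hi, if_false]
      exact h.focalShape_of_shape hz ha (hb.mem i) hi (hb.shape_b i)
  have hv0 : v ≠ 0 := by rintro rfl; exact hu0 (map_zero _)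
  -- The frame diagonalizes the shape operator, so `-μ` is the eigenvalue of any frame vector with a
  -- nonzero coefficient in `v`.
  obtain ⟨i, hi⟩ : ∃ i, b.repr v i ≠ 0 := by
    by_contra! h0
    exact hv0 (b.repr.map_eq_zero_iff.1 (Finsupp.ext h0))
  have hsum : fderiv ℝ f z (∑ i, (k i * b.repr v i) • b i) = fderiv ℝ f z ((-μ) • v) := by
    have e1 : focalShape Λ f N a z (fderiv ℝ f z v)
        = ∑ i, b.repr v i • focalShape Λ f N a z (fderiv ℝ f z (b i)) := by
      conv_lhs => rw [← b.sum_repr v]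
      have : ∀ u, focalShape Λ f N a z u = Q.flip (focalNormal f N a z) u := fun u => rfl
      simp only [this, map_sum, map_smul]
    rw [map_smul, ← hu', e1, map_sum]
    refine Finset.sum_congr rfl fun i _ => ?_
    rw [hKb, map_smul, smul_smul, mul_comm]
  have h1 := congrArg (fun w => b.repr w i) (h.injective z hz hsum)
  simp only [b.repr_sum_self, map_smul, Finsupp.smul_apply, smul_eq_mul] at h1
  have h2 : k i = -μ := mul_right_cancel₀ hi h1
  by_cases hia : lam i = a
  · simp only [hk, hia, if_true] at h2
    exact absurd (neg_eq_zero.1 h2.symm) hμ0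
  · simp only [hk, hia, if_false] at h2
    exact ⟨lam i, hb.mem i, hia, h2⟩

end LocalIsoparametric
end

/-! ### The cubic form and Cartan's identity -/

section
variable {V W : Type*} [NormedAddCommGroup V] [InnerProductSpace ℝ V] [FiniteDimensional ℝ V]
    [NormedAddCommGroup W] [InnerProductSpace ℝ W] [FiniteDimensional ℝ W]

/-- The cubic form `g₀((∇_X A) Z, Y)`, in terms of second derivatives. -/
noncomputable def cubic (f N : V → W) (z X Z Y : V) : ℝ :=
  inner ℝ (fderiv ℝ (fderiv ℝ f) z X Z) (fderiv ℝ N z Y)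
    - inner ℝ (fderiv ℝ (fderiv ℝ N) z X Z) (fderiv ℝ f z Y)

theorem cubic_add_left (f N : V → W) (z X X' Z Y : V) :
    cubic f N z (X + X') Z Y = cubic f N z X Z Y + cubic f N z X' Z Y := by
  simp only [cubic, map_add, add_apply, inner_add_left]; ring

theorem cubic_add_middle (f N : V → W) (z X Z Z' Y : V) :
    cubic f N z X (Z + Z') Y = cubic f N z X Z Y + cubic f N z X Z' Y := by
  simp only [cubic, map_add, inner_add_left]; ring

theorem cubic_smul_left (f N : V → W) (z : V) (t : ℝ) (X Z Y : V) :
    cubic f N z (t • X) Z Y = t * cubic f N z X Z Y := by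
  simp only [cubic, map_smul, smul_apply, inner_smul_left, conj_trivial]; ring

namespace LocalIsoparametric

variable {U : Set V} {f N : V → W} {Λ : Finset ℝ} (h : LocalIsoparametric U f N Λ)
include h

theorem cubic_comm_left {z : V} (hz : z ∈ U) (X Z Y : V) :
    cubic f N z X Z Y = cubic f N z Z X Y := by
  rw [cubic, fderiv_fderiv_comm h.isOpen h.smooth hz,
    fderiv_fderiv_comm h.isOpen h.smooth_normal hz, cubic]

/-- Differentiate the symmetry of the second fundamental form. Together with the symmetry of second
derivatives this makes the cubic form totally symmetric: the Codazzi equation. -/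
theorem cubic_comm_right {z : V} (hz : z ∈ U) (X Z Y : V) :
    cubic f N z X Z Y = cubic f N z X Y Z := by
  have df : ∀ v : V, HasFDerivAt (fun y => fderiv ℝ f y v) _ z := fun v =>
    (hasFDerivAt_of_smoothOn h.isOpen (smoothOn_fderiv h.isOpen h.smooth) hz).clm_apply
    (hasFDerivAt_const v z)
  have dN : ∀ v : V, HasFDerivAt (fun y => fderiv ℝ N y v) _ z := fun v =>
    (hasFDerivAt_of_smoothOn h.isOpen (smoothOn_fderiv h.isOpen h.smooth_normal) hz).clm_apply
    (hasFDerivAt_const v z)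
  have d1 := ((dN Z).inner ℝ (df Y)).congr_of_eventuallyEq
    (f₁ := fun y => inner ℝ (fderiv ℝ f y Z) (fderiv ℝ N y Y))
    (by filter_upwards [h.isOpen.mem_nhds hz] with y hy using (h.inner_deriv_N_comm hy Z Y).symm)
  have := congrArg (fun L => L X) (d1.unique ((df Z).inner ℝ (dN Y)))
  simp at this
  rw [cubic, cubic, real_inner_comm (fderiv ℝ N z Z), real_inner_comm (fderiv ℝ f z Z)]
  linarith

/-- The derivative in the direction `X` of a field of principal vectors extending `Z`. -/
noncomputable def _root_.Isoparametric.principalDeriv (Λ : Finset ℝ) (f N : V → W) (z : V) (c : ℝ)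
    (X Z : V) : W :=
  fderiv ℝ (fderiv ℝ f) z X Z
    + fderiv ℝ f z (fderiv ℝ (fun y => eigenProj Λ f N c y Z) z X)

/-- Differentiate `(c df + dN) τ_c Z = 0` along `X` and pair with `df Y`. In particular the cubic
form vanishes on two vectors of one principal space. -/
theorem cubic_eq {z : V} (hz : z ∈ U) {c e : ℝ} (hc : c ∈ Λ) (X : V) {Z Y : V}
    (hZ : shape f N z Z = c • Z) (hY : shape f N z Y = e • Y) :
    cubic f N z X Z Y
      = (c - e) * inner ℝ (principalDeriv Λ f N z c X Z) (fderiv ℝ f z Y) := by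
  have hd := smoothOn_fderiv h.isOpen (h.smooth_focalMap c)
  have e1 := fderiv_apply_apply h.isOpen hd
      ((h.smooth_eigenProj c).clm_apply (contDiffOn_const (c := Z)))
      (fun y hy => (h.focal_constantRank hc).deriv_τ y hy Z) hz X
  simp only [fderiv_fun_const, Pi.zero_apply, zero_apply] at e1
  have e2 : fderiv ℝ (fderiv ℝ (focalMap f N c)) z X Z
      = c • fderiv ℝ (fderiv ℝ f) z X Z + fderiv ℝ (fderiv ℝ N) z X Z := by
    have d := ((hasFDerivAt_of_smoothOn h.isOpen (smoothOn_fderiv h.isOpen h.smooth)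
      hz).const_smul c).add (hasFDerivAt_of_smoothOn h.isOpen
        (smoothOn_fderiv h.isOpen h.smooth_normal) hz)
    have d2 := d.congr_of_eventuallyEq (f₁ := fderiv ℝ (focalMap f N c))
      (by filter_upwards [h.isOpen.mem_nhds hz] with y hy using h.deriv_focalMap hy c)
    rw [d2.fderiv]
    simp
  rw [h.eigenProj_apply hc hc hZ, if_pos rfl, e2, h.deriv_focalMap hz] at e1
  set v := fderiv ℝ (fun y => eigenProj Λ f N c y Z) z X
  have e3 := congrArg (fun u => (inner ℝ u (fderiv ℝ f z Y) : ℝ)) e1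
  simp only [inner_zero_left, inner_add_left, add_apply, smul_apply, inner_smul_left,
    conj_trivial, h.inner_deriv_N_comm hz v Y, h.deriv_N_of_shape hz hY, inner_neg_right,
    inner_smul_right] at e3
  rw [cubic, principalDeriv, h.deriv_N_of_shape hz hY, inner_neg_right, inner_smul_right,
    inner_add_left]
  linear_combination e3

theorem cubic_eq_zero {z : V} (hz : z ∈ U) {c : ℝ} (hc : c ∈ Λ) (X : V) {Z Y : V}
    (hZ : shape f N z Z = c • Z) (hY : shape f N z Y = c • Y) : cubic f N z X Z Y = 0 := by
  rw [h.cubic_eq hz hc X hZ hY, sub_self, zero_mul]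

/-- Parseval for the frame. The vector `w` may have normal components, since it is only paired with
tangent vectors. -/
theorem sum_inner_frame {z : V} {ι : Type*} [Fintype ι] {b : Module.Basis ι ℝ V}
    {lam : ι → ℝ} (hb : PrincipalFrame f N Λ z b lam) (w : W) (y : V) :
    (inner ℝ w (fderiv ℝ f z y) : ℝ) = ∑ i, inner ℝ (fderiv ℝ f z y) (fderiv ℝ f z (b i)) *
      inner ℝ w (fderiv ℝ f z (b i)) := by
  classical
  have e1 : ∀ i, (inner ℝ (fderiv ℝ f z y) (fderiv ℝ f z (b i)) : ℝ) = b.repr y i := by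
    intro i
    conv_lhs => rw [← b.sum_repr y]
    simp only [map_sum, map_smul, sum_inner, inner_smul_left, hb.orth, conj_trivial]
    simp
  simp only [e1]
  conv_lhs => rw [← b.sum_repr y]
  simp only [map_sum, map_smul, inner_sum, inner_smul_right]

/-- The vector `u s` of the principal space of `c` satisfies `(cos s K₀ + sin s K₁) u = μ u`. Its
derivative at `0` is `(μ - K₀) w = K₁ u₀`. Pairing with `w` in the frame gives the sum; a finer
expansion at `0` gives the right side. There are no terms with `lam i = a`, because `K₁ u₀` is
tangent to the focal image. -/
theorem cartan_aux {z : V} (hz : z ∈ U) {ι : Type*} [Fintype ι] {b : Module.Basis ι ℝ V}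
    {lam : ι → ℝ} (hb : PrincipalFrame f N Λ z b lam) {a c : ℝ} (ha : a ∈ Λ) (hc : c ∈ Λ)
    (hca : c ≠ a) {X Z : V} (hX : shape f N z X = a • X)
    (hXn : (1 + a ^ 2) * inner ℝ (fderiv ℝ f z X) (fderiv ℝ f z X) = 1)
    (hZ : shape f N z Z = c • Z) :
    ∑ i, (if lam i = a then 0 else ((1 + a * c) / (a - c) - (1 + a * lam i) / (a - lam i)) *
      (inner ℝ (principalDeriv Λ f N z c X Z) (fderiv ℝ f z (b i))) ^ 2) =
    (1 / 2) * ((1 + a * c) / (a - c)) * inner ℝ (fderiv ℝ f z Z) (fderiv ℝ f z Z) := by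
  obtain ⟨ε, hε, γ, hγ0, hγX, hγ⟩ := h.exists_leaf_curve hz ha hX hXn
  have hCR := h.focal_constantRank ha
  set μ := (1 + a * c) / (a - c) with hμ
  set w := principalDeriv Λ f N z c X Z with hw
  set Q := focalForm (focalProj Λ f N a) (focalInv Λ f N a) z with hQ
  have hPη : focalProj Λ f N a z (focalNormal f N a z) = 0 := by
    simpa [focalNormal, sub_eq_add_neg] using h.focalProj_focalNormal hz a a (-1)
  have hPζ : focalProj Λ f N a z (fderiv ℝ (focalNormal f N a) z X) = 0 := by
    rw [h.deriv_focalNormal_of_shape hz a hX, map_neg, map_smul,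
      h.focalProj_of_shape hz ha ha hX, if_pos rfl]
    simp
  set K0 : W →L[ℝ] W := Q.flip (focalNormal f N a z) with hK0
  set K1 : W →L[ℝ] W := Q.flip (fderiv ℝ (focalNormal f N a) z X) with hK1
  have hK0' : ∀ u, K0 u = focalShape Λ f N a z u := fun u => rfl
  have s0 : ∀ u v, (inner ℝ (K0 u) v : ℝ) = inner ℝ u (K0 v) := hCR.inner_focalForm hz hPη
  have s1 : ∀ u v, (inner ℝ (K1 u) v : ℝ) = inner ℝ u (K1 v) := hCR.inner_focalForm hz hPζ
  set u : ℝ → W := fun s => fderiv ℝ f (γ s) (eigenProj Λ f N c (γ s) Z) with hu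
  set u0 := fderiv ℝ f z Z with hu0
  have hτ : eigenProj Λ f N c z Z = Z := by rw [h.eigenProj_apply hc hc hZ, if_pos rfl]
  have hu00 : u 0 = u0 := by simp only [hu, hγ0, hτ, hu0]
  have hud : HasDerivAt u w 0 := by
    have hd := smoothOn_fderiv h.isOpen h.smooth
    have hs := (h.smooth_eigenProj c).clm_apply (contDiffOn_const (c := Z))
    have d1 := hasFDerivAt_of_smoothOn h.isOpen (hd.clm_apply hs) hz
    rw [← hγ0] at d1
    have d2 := d1.comp_hasDerivAt 0 hγX
    refine d2.congr_deriv ?_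
    rw [hγ0, fderiv_apply_apply h.isOpen hd hs (fun y hy => rfl) hz X, hτ, hw, principalDeriv,
      add_comm]
  have hK : ∀ s ∈ Set.Ioo (-ε) ε, Real.cos s • K0 (u s) + Real.sin s • K1 (u s) = μ • u s := by
    intro s hs
    obtain ⟨hU, hs2⟩ := hγ s hs
    have := hs2 (u s)
    rw [h.focalShape_of_shape hU ha hc hca (h.shape_eigenProj hU hc Z)] at this
    exact this.symm
  have hn : Set.Ioo (-ε) ε ∈ 𝓝 (0 : ℝ) := Ioo_mem_nhds (by linarith) hε
  have hK0u : K0 u0 = μ • u0 := by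
    have := hK 0 ⟨by linarith, hε⟩
    simpa [hu00] using this
  have E1 : K0 w + K1 u0 = μ • w := by
    have d1 := ((Real.hasDerivAt_cos 0).smul (K0.hasFDerivAt.comp_hasDerivAt 0 hud)).add
      ((Real.hasDerivAt_sin 0).smul (K1.hasFDerivAt.comp_hasDerivAt 0 hud))
    have d2 := (hud.const_smul μ).congr_of_eventuallyEq (f₁ := fun s =>
      Real.cos s • K0 (u s) + Real.sin s • K1 (u s))
      (by filter_upwards [hn] with s hs using hK s hs)
    have := d1.unique d2
    simpa [hu00] using this
  -- This is second-order information obtained from first derivatives. Pairing with `u₀` gives `(cos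
  -- s - 1) q + sin s p = 0`; division by `2 sin (s/2)` leaves `cos (s/2) p = sin (s/2) q`, whose
  -- derivative at `0` is `p' = q / 2`.
  have E2 : (inner ℝ w (K1 u0) : ℝ) = 1 / 2 * μ * inner ℝ u0 u0 := by
    set p : ℝ → ℝ := fun s => inner ℝ (u s) (K1 u0)
    set q : ℝ → ℝ := fun s => μ * inner ℝ (u s) u0
    have hp : HasDerivAt p (inner ℝ w (K1 u0)) 0 := by
      simpa using hud.inner ℝ (hasDerivAt_const (0 : ℝ) (K1 u0))
    have hq : HasDerivAt q _ 0 := (hud.inner ℝ (hasDerivAt_const (0 : ℝ) u0)).const_mul μ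
    have hpq : ∀ s ∈ Set.Ioo (-ε) ε, (Real.cos s - 1) * q s + Real.sin s * p s = 0 := by
      intro s hs
      have e := congrArg (fun x => (inner ℝ x u0 : ℝ)) (hK s hs)
      simp only [inner_add_left, inner_smul_left, conj_trivial, s0, s1, hK0u,
        inner_smul_right] at e
      simp only [p, q]
      linear_combination e
    have hp0 : p 0 = 0 := by
      have d1 := (((Real.hasDerivAt_cos 0).sub_const 1).mul hq).add
        ((Real.hasDerivAt_sin 0).mul hp)
      have d2 := (hasDerivAt_const (0 : ℝ) (0 : ℝ)).congr_of_eventuallyEq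
        (f₁ := fun s => (Real.cos s - 1) * q s + Real.sin s * p s)
        (by filter_upwards [hn] with s hs using hpq s hs)
      simpa using d1.unique d2
    have hhalf : HasDerivAt (fun s : ℝ => s / 2) (1 / 2) 0 := (hasDerivAt_id (0 : ℝ)).div_const 2
    have d1 := (hhalf.cos.mul hp).sub (hhalf.sin.mul hq)
    have d2 := (hasDerivAt_const (0 : ℝ) (0 : ℝ)).congr_of_eventuallyEq
      (f₁ := fun s => Real.cos (s / 2) * p s - Real.sin (s / 2) * q s) (by
        filter_upwards [hn, Ioo_mem_nhds (neg_lt_zero.2 Real.pi_pos) Real.pi_pos] with s hs hs'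
        by_cases hs0 : s = 0
        · simp [hs0, hp0]
        · have h1 : Real.sin (s / 2) ≠ 0 := by
            rw [Ne, Real.sin_eq_zero_iff_of_lt_of_lt 
              (by linarith [hs'.1, Real.pi_pos]) (by linarith [hs'.2, Real.pi_pos])]
            simpa using hs0
          have h2 := hpq s hs
          have h3 : Real.cos s = 1 - 2 * Real.sin (s / 2) ^ 2 := by
            rw [← Real.cos_sq_add_sin_sq (s / 2)]
            conv_lhs => rw [show s = 2 * (s / 2) by ring, Real.cos_two_mul']
            ring
          have h4 : Real.sin s = 2 * Real.sin (s / 2) * Real.cos (s / 2) := by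
            rw [← Real.sin_two_mul]; ring_nf
          rw [h3, h4] at h2
          apply mul_left_cancel₀ h1
          linear_combination h2 / 2)
    have e := d1.unique d2
    simp [q, hu00] at e
    rw [real_inner_self_eq_norm_sq]
    linear_combination e
  have hsum := h.sum_inner_frame hb w (leftInv f z (K1 u0))
  have hPK : focalProj Λ f N a z (K1 u0) = K1 u0 := hCR.P_fderiv_P hz _ hPζ
  have hdf : fderiv ℝ f z (leftInv f z (K1 u0)) = K1 u0 := by
    conv_lhs => rw [← hPK]
    conv_rhs => rw [← hPK]
    simp [focalProj, h.leftInv_apply hz]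
  rw [hdf, E2] at hsum
  rw [hsum]
  refine Finset.sum_congr rfl fun i _ => ?_
  split_ifs with hi
  · rw [← hPK, hCR.symm z hz, h.focalProj_of_shape hz ha (hb.mem i) (hb.shape_b i), if_pos hi,
      inner_zero_right, zero_mul]
  · rw [eq_sub_of_add_eq' E1, inner_sub_left, s0, hK0', h.focalShape_of_shape hz ha (hb.mem i) hi
      (hb.shape_b i), inner_smul_left, inner_smul_right, conj_trivial]
    ring

/-- Cartan's identity for two principal vectors. -/
theorem cartan {z : V} (hz : z ∈ U) {ι : Type*} [Fintype ι] {b : Module.Basis ι ℝ V}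
    {lam : ι → ℝ} (hb : PrincipalFrame f N Λ z b lam) {a c : ℝ} (ha : a ∈ Λ) (hc : c ∈ Λ)
    (hca : c ≠ a) {X Z : V} (hX : shape f N z X = a • X) (hZ : shape f N z Z = c • Z) :
    2 * ∑ i, cubic f N z X Z (b i) ^ 2 / ((a - lam i) * (c - lam i)) =
      (1 + a * c) * (inner ℝ (fderiv ℝ f z X) (fderiv ℝ f z X) *
        inner ℝ (fderiv ℝ f z Z) (fderiv ℝ f z Z)) := by
  have hac : a - c ≠ 0 := sub_ne_zero.2 hca.symm
  have key : ∀ X, shape f N z X = a • X →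
      (1 + a ^ 2) * inner ℝ (fderiv ℝ f z X) (fderiv ℝ f z X) = 1 →
      2 * (1 + a ^ 2) * ∑ i, cubic f N z X Z (b i) ^ 2 / ((a - lam i) * (c - lam i)) =
      (1 + a * c) * inner ℝ (fderiv ℝ f z Z) (fderiv ℝ f z Z) := by
    intro X hX hXn
    have h1 := h.cartan_aux hz hb ha hc hca hX hXn hZ
    -- The difference of focal curvatures is `(1 + a²)(c - lam i) / ((a - c)(a - lam i))`, and
    -- `cubic` supplies the factor `c - lam i` twice. For `lam i = a` or `lam i = c` the quotient
    -- has denominator `0` and counts as `0`.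
    have h2 : ∑ i, (if lam i = a then 0 else ((1 + a * c) / (a - c) - (1 + a * lam i) / (a - lam i))
        * (inner ℝ (principalDeriv Λ f N z c X Z) (fderiv ℝ f z (b i))) ^ 2)
        = (1 + a ^ 2) / (a - c)
          * ∑ i, cubic f N z X Z (b i) ^ 2 / ((a - lam i) * (c - lam i)) := by
      rw [Finset.mul_sum]
      refine Finset.sum_congr rfl fun i _ => ?_
      rw [h.cubic_eq hz hc X hZ (hb.shape_b i)]
      split_ifs with hi
      · simp [hi]
      · by_cases hi' : lam i = c
        · simp [hi']
        · have h3 : a - lam i ≠ 0 := sub_ne_zero.2 (Ne.symm hi)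
          have h4 : c - lam i ≠ 0 := sub_ne_zero.2 (Ne.symm hi')
          field_simp
          ring
    rw [h2] at h1
    field_simp at h1
    linear_combination h1
  by_cases hX0 : X = 0
  · subst hX0
    simp [cubic]
  · have hp := h.inner_deriv_pos hz hX0
    set q : ℝ := inner ℝ (fderiv ℝ f z X) (fderiv ℝ f z X) with hq
    have hr : 0 < (1 + a ^ 2) * q := by positivity
    set t := Real.sqrt ((1 + a ^ 2) * q) with ht
    have htt : t * t = (1 + a ^ 2) * q := Real.mul_self_sqrt hr.le
    have ht0 : t ≠ 0 := (Real.sqrt_pos.2 hr).ne'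
    -- Both sides are quadratic in `X`, so the normalization can be undone.
    have h1 := key (t⁻¹ • X) (by rw [map_smul, hX, smul_comm]) (by
      rw [map_smul, inner_smul_left, inner_smul_right, conj_trivial, ← hq]
      field_simp
      linear_combination -htt)
    simp only [cubic_smul_left, mul_pow, mul_div_assoc, ← Finset.mul_sum] at h1
    have h2 : (t⁻¹) ^ 2 = ((1 + a ^ 2) * q)⁻¹ := by rw [← htt, inv_pow, pow_two]
    rw [h2] at h1
    have h3 : (1 + a ^ 2 : ℝ) ≠ 0 := by positivity
    have h4 := hp.ne'
    field_simp at h1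
    linear_combination h1

/-- The polarization of Cartan's identity. -/
theorem cartan_polarized {z : V} (hz : z ∈ U) {ι : Type*} [Fintype ι] {b : Module.Basis ι ℝ V}
    {lam : ι → ℝ} (hb : PrincipalFrame f N Λ z b lam) {a c : ℝ} (ha : a ∈ Λ) (hc : c ∈ Λ)
    (hca : c ≠ a) {X Y Z T : V} (hX : shape f N z X = a • X) (hY : shape f N z Y = a • Y)
    (hZ : shape f N z Z = c • Z) (hT : shape f N z T = c • T) :
    ∑ i, (cubic f N z X Z (b i) * cubic f N z Y T (b i) +
        cubic f N z X T (b i) * cubic f N z Y Z (b i)) / ((a - lam i) * (c - lam i)) =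
      (1 + a * c) * (inner ℝ (fderiv ℝ f z X) (fderiv ℝ f z Y) *
        inner ℝ (fderiv ℝ f z Z) (fderiv ℝ f z T)) := by
  have hXY : shape f N z (X + Y) = a • (X + Y) := by rw [map_add, hX, hY, smul_add]
  have hZT : shape f N z (Z + T) = c • (Z + T) := by rw [map_add, hZ, hT, smul_add]
  have C := fun {X Z : V} => h.cartan (X := X) (Z := Z) hz hb ha hc hca
  have c1 := C hX hZ
  have c2 := C hX hT
  have c3 := C hY hZ
  have c4 := C hY hT
  have c5 := C hXY hZ
  have c6 := C hXY hT
  have c7 := C hX hZT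
  have c8 := C hY hZT
  have c9 := C hXY hZT
  -- Second difference of the biquadratic form in both pairs: all unmixed terms cancel.
  have key : ∑ i, (cubic f N z X Z (b i) * cubic f N z Y T (b i) +
        cubic f N z X T (b i) * cubic f N z Y Z (b i)) / ((a - lam i) * (c - lam i))
      = 1 / 2 * ((∑ i, cubic f N z (X + Y) (Z + T) (b i) ^ 2 / ((a - lam i) * (c - lam i)))
        - (∑ i, cubic f N z (X + Y) Z (b i) ^ 2 / ((a - lam i) * (c - lam i)))
        - (∑ i, cubic f N z (X + Y) T (b i) ^ 2 / ((a - lam i) * (c - lam i)))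
        - (∑ i, cubic f N z X (Z + T) (b i) ^ 2 / ((a - lam i) * (c - lam i)))
        - (∑ i, cubic f N z Y (Z + T) (b i) ^ 2 / ((a - lam i) * (c - lam i)))
        + (∑ i, cubic f N z X Z (b i) ^ 2 / ((a - lam i) * (c - lam i)))
        + (∑ i, cubic f N z X T (b i) ^ 2 / ((a - lam i) * (c - lam i)))
        + (∑ i, cubic f N z Y Z (b i) ^ 2 / ((a - lam i) * (c - lam i)))
        + (∑ i, cubic f N z Y T (b i) ^ 2 / ((a - lam i) * (c - lam i)))) := by
    simp only [← Finset.sum_add_distrib, ← Finset.sum_sub_distrib, Finset.mul_sum]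
    refine Finset.sum_congr rfl fun i _ => ?_
    simp only [cubic_add_left, cubic_add_middle]
    ring
  rw [key]
  simp only [map_add, inner_add_left, inner_add_right,
    real_inner_comm (fderiv ℝ f z X) (fderiv ℝ f z Y),
    real_inner_comm (fderiv ℝ f z Z) (fderiv ℝ f z T)] at c5 c6 c7 c8 c9
  linear_combination 1 / 4 * (c9 - c5 - c6 - c7 - c8 + c1 + c2 + c3 + c4)

end LocalIsoparametric
end

/-! ### Equal spacing: reflections and roots of unity -/

/-- A finite set `S ∋ 1` of units of a field which is closed under the reflections `y ↦ x² y⁻¹` is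
the group of roots of unity of order `|S|`. -/
theorem pow_card_eq_one_of_reflection {K : Type*} [Field K] [DecidableEq K] (S : Finset Kˣ)
    (h1 : 1 ∈ S) (hS : ∀ x ∈ S, ∀ y ∈ S, x ^ 2 * y⁻¹ ∈ S) {x : Kˣ} (hx : x ∈ S) :
    x ^ S.card = 1 := by
  have hinv : ∀ x ∈ S, x⁻¹ ∈ S := fun x hx => by simpa using hS 1 h1 x hx
  -- The reflection in `x` and the inversion both permute `S`; compare the products over `S`.
  have hsq : ∀ x ∈ S, x ^ (2 * S.card) = 1 := by
    intro x hx
    have e : ∏ y ∈ S, x ^ 2 * y⁻¹ = ∏ y ∈ S, y := by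
      refine Finset.prod_bij (fun y _ => x ^ 2 * y⁻¹) (fun y hy => hS x hx y hy)
        (fun y _ z _ hyz => inv_injective (mul_left_cancel hyz))
        (fun y hy => ⟨x ^ 2 * y⁻¹, hS x hx y hy, by simp⟩) (fun y _ => rfl)
    have e' : ∏ y ∈ S, y⁻¹ = ∏ y ∈ S, y :=
      Finset.prod_bij (fun y _ => y⁻¹) hinv (fun y _ z _ hyz => inv_injective hyz)
        (fun y hy => ⟨y⁻¹, hinv y hy, inv_inv y⟩) (fun y _ => rfl)
    rw [Finset.prod_mul_distrib, Finset.prod_const, e', ← pow_mul] at e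
    exact mul_eq_right.1 e
  -- The stabilizer of `S` under translation. Composing the reflections in `1` and in `t` is
  -- translation by `t²`, so it contains the squares of the group generated by `S`.
  set H : Subgroup Kˣ :=
    { carrier := {t | ∀ s, t * s ∈ S ↔ s ∈ S}
      mul_mem' := fun {a b} ha hb s => by rw [mul_assoc, ha, hb]
      one_mem' := fun s => by rw [one_mul]
      inv_mem' := fun {a} ha s => by rw [← ha (a⁻¹ * s), mul_inv_cancel_left] }
  have hH : ∀ t, t ∈ H ↔ ∀ s, t * s ∈ S ↔ s ∈ S := fun t => Iff.rfl
  set G := Subgroup.closure (S : Set Kˣ)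
  have hGH : ∀ t ∈ G, t ^ 2 ∈ H := by
    intro t ht
    induction ht using Subgroup.closure_induction with
    | mem t ht =>
      intro s
      constructor
      · intro h
        have := hS _ (hinv t ht) _ (hinv _ h)
        simpa using this
      · intro h
        simpa using hS t ht _ (hinv s h)
    | one => simp [H.one_mem]
    | mul a b _ _ ha hb => rw [mul_pow]; exact H.mul_mem ha hb
    | inv a _ ha => rw [inv_pow]; exact H.inv_mem ha
  have hpos : 0 < S.card := Finset.card_pos.2 ⟨1, h1⟩
  have hle : G ≤ rootsOfUnity (2 * S.card) K := by
    rw [Subgroup.closure_le]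
    intro t ht
    exact (mem_rootsOfUnity _ _).2 (hsq t ht)
  have : NeZero (2 * S.card) := ⟨by omega⟩
  have : Finite G := Finite.of_injective _ (Subgroup.inclusion_injective hle)
  obtain ⟨⟨w, hw⟩, hgen⟩ := IsCyclic.exists_generator (α := G)
  have hpow : ∀ t ∈ S, ∃ k : ℤ, w ^ k = t := by
    intro t ht
    obtain ⟨k, hk⟩ := Subgroup.mem_zpowers_iff.1 (hgen ⟨t, Subgroup.subset_closure ht⟩)
    exact ⟨k, congrArg Subtype.val hk⟩
  have heven : ∀ k : ℤ, Even k → w ^ k ∈ H := by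
    rintro _ ⟨k, rfl⟩
    have := H.zpow_mem (hGH w hw) k
    rwa [← zpow_natCast, ← zpow_mul, Nat.cast_ofNat, two_mul] at this
  -- Write `x` and `y` as powers of a generator `w`. Even powers stabilize `S`; if both exponents
  -- are odd, then `x y` is an even power and translates `1 ∈ S`.
  have hmul : ∀ y ∈ S, x * y ∈ S := by
    intro y hy
    obtain ⟨i, hi⟩ := hpow x hx
    obtain ⟨j, hj⟩ := hpow y hy
    by_cases hie : Even i
    · exact ((hi ▸ heven i hie : x ∈ H) y).2 hy
    · by_cases hje : Even j
      · rw [mul_comm]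
        exact ((hj ▸ heven j hje : y ∈ H) x).2 hx
      · have : w ^ (i + j) ∈ H := heven _ (by
          rw [Int.not_even_iff_odd] at hie hje
          exact hie.add_odd hje)
        rw [zpow_add, hi, hj] at this
        simpa using (this 1).2 h1
  have e : ∏ y ∈ S, x * y = ∏ y ∈ S, y := by
    have himg : S.image (fun y => x * y) = S :=
      Finset.eq_of_subset_of_card_le (fun t ht => by
        obtain ⟨y, hy, rfl⟩ := Finset.mem_image.1 ht
        exact hmul y hy) (by rw [Finset.card_image_of_injective _ (mul_right_injective x)])
    conv_rhs => rw [← himg]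
    rw [Finset.prod_image (fun y _ z _ hyz => mul_left_cancel hyz)]
  rw [Finset.prod_mul_distrib, Finset.prod_const] at e
  exact mul_eq_right.1 e

/-- The eigenvalue `(c + i) / (c - i)` of `B₀` for the principal curvature `c`. -/
noncomputable def cayley (c : ℝ) : ℂ := ((c : ℂ) + Complex.I) / ((c : ℂ) - Complex.I)

theorem add_I_ne_zero (c : ℝ) : (c : ℂ) + Complex.I ≠ 0 := fun h => by
  simpa using congrArg Complex.im h

theorem sub_I_ne_zero (c : ℝ) : (c : ℂ) - Complex.I ≠ 0 := fun h => by
  simpa using congrArg Complex.im h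

theorem cayley_ne_zero (c : ℝ) : cayley c ≠ 0 := div_ne_zero (add_I_ne_zero c) (sub_I_ne_zero c)

theorem cayley_sub (a c : ℝ) : cayley a - cayley c =
    2 * Complex.I * (c - a) / (((a : ℂ) - Complex.I) * ((c : ℂ) - Complex.I)) := by
  have h1 := sub_I_ne_zero a
  have h2 := sub_I_ne_zero c
  rw [cayley, cayley]
  field_simp
  ring

theorem cayley_injective : Function.Injective cayley := by
  intro a c h
  have h1 := sub_I_ne_zero a
  have h2 := sub_I_ne_zero c
  have h3 := cayley_sub a c
  rw [h, sub_self, eq_comm, div_eq_zero_iff] at h3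
  simp [h1, h2, sub_eq_zero] at h3
  exact h3.symm

/-- In angles: `cot (θ_e - θ_a) = -cot (θ_c - θ_a)` means `θ_e + θ_c = 2 θ_a` modulo `π`. -/
theorem cayley_mul_of_reflection {a c e : ℝ} (hc : c ≠ a) (he : e ≠ a)
    (h : (1 + a * e) / (a - e) = -((1 + a * c) / (a - c))) : cayley e * cayley c = cayley a ^ 2 := by
  have h1 := sub_I_ne_zero a
  have h2 := sub_I_ne_zero c
  have h3 := sub_I_ne_zero e
  have h4 : a - e ≠ 0 := sub_ne_zero.2 he.symm
  have h5 : a - c ≠ 0 := sub_ne_zero.2 hc.symm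
  field_simp at h
  have h6 : ((1 : ℂ) + a * e) * (a - c) + (1 + a * c) * (a - e) = 0 := by
    have : (1 + a * e) * (a - c) + (1 + a * c) * (a - e) = 0 := by linarith
    exact_mod_cast this
  rw [cayley, cayley, cayley, div_mul_div_comm, div_pow, div_eq_div_iff (mul_ne_zero h3 h2)
    (pow_ne_zero 2 h1)]
  linear_combination 2 * Complex.I * h6 + 2 * Complex.I * (e + c - 2 * a) * Complex.I_sq

/-- The principal curvatures are equally spaced. -/
theorem cayley_div_pow_card {Λ : Finset ℝ}
    (hΛ : ∀ a ∈ Λ, ∀ c ∈ Λ, c ≠ a → ∃ e ∈ Λ, e ≠ a ∧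
      (1 + a * e) / (a - e) = -((1 + a * c) / (a - c)))
    {a b : ℝ} (ha : a ∈ Λ) (hb : b ∈ Λ) : (cayley a / cayley b) ^ Λ.card = 1 := by
  classical
  -- Dividing by `cayley b` puts `1` into the set and preserves closure under reflections.
  set u : ℝ → ℂˣ := fun c => Units.mk0 _ (cayley_ne_zero c) * (Units.mk0 _ (cayley_ne_zero b))⁻¹
    with hu
  have hval : ∀ c, ((u c : ℂˣ) : ℂ) = cayley c / cayley b := fun c => by
    simp [hu, div_eq_mul_inv]
  have hinj : Function.Injective u := by
    intro c d h
    have := congrArg (Units.val) h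
    rw [hval, hval, div_left_inj' (cayley_ne_zero b)] at this
    exact cayley_injective this
  have h := pow_card_eq_one_of_reflection (Λ.image u)
    (Finset.mem_image.2 ⟨b, hb, by simp [hu]⟩) (by
      intro x hx y hy
      obtain ⟨c, hc, rfl⟩ := Finset.mem_image.1 hx
      obtain ⟨d, hd, rfl⟩ := Finset.mem_image.1 hy
      by_cases hdc : d = c
      · subst hdc
        simpa [pow_two] using ⟨d, hd, rfl⟩
      · obtain ⟨e, he, hec, h⟩ := hΛ c hc d hd hdc
        refine Finset.mem_image.2 ⟨e, he, ?_⟩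
        rw [eq_mul_inv_iff_mul_eq]
        ext
        rw [Units.val_mul, Units.val_pow_eq_pow_val, hval, hval, hval, div_mul_div_comm,
          cayley_mul_of_reflection hdc hec h, div_pow, pow_two (cayley b)])
    (Finset.mem_image_of_mem u ha)
  rw [Finset.card_image_of_injective _ hinj] at h
  have := congrArg (Units.val) h
  rwa [Units.val_pow_eq_pow_val, hval] at this

theorem sum_pow_of_pow_eq_one {K : Type*} [Field K] [DecidableEq K] {x : K} {g : ℕ}
    (h : x ^ g = 1) : ∑ l ∈ Finset.range g, x ^ l = if x = 1 then (g : K) else 0 := by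
  split_ifs with hx
  · simp [hx]
  · rw [geom_sum_eq hx, h, sub_self, zero_div]

/-! ### The coordinate expressions in terms of derivatives -/

section
variable {n : ℕ}

theorem EuclideanSpace.sum_smul_single (v : EuclideanSpace ℝ (Fin n)) :
    ∑ i, v i • EuclideanSpace.single i (1 : ℝ) = v := by
  ext k
  simp [Finset.sum_apply, Pi.single_apply]

theorem map_eq_sum_single {E : Type*} [NormedAddCommGroup E] [NormedSpace ℝ E]
    (L : EuclideanSpace ℝ (Fin n) →L[ℝ] E) (v : EuclideanSpace ℝ (Fin n)) :
    ∑ i, v i • L (EuclideanSpace.single i 1) = L v := by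
  conv_rhs => rw [← EuclideanSpace.sum_smul_single v]
  simp only [map_sum, map_smul]

namespace LocalIsoparametric

variable {U : Set (EuclideanSpace ℝ (Fin n))}
  {f N : EuclideanSpace ℝ (Fin n) → EuclideanSpace ℝ (Fin (n + 2))} {Λ : Finset ℝ}
  (h : LocalIsoparametric U f N Λ)
include h

omit h in
theorem firstForm_mulVec (f : EuclideanSpace ℝ (Fin n) → EuclideanSpace ℝ (Fin (n + 2)))
    (z v : EuclideanSpace ℝ (Fin n)) (i : Fin n) :
    (firstForm f z *ᵥ v.ofLp) i =
      inner ℝ (fderiv ℝ f z (EuclideanSpace.single i 1)) (fderiv ℝ f z v) := by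
  rw [← map_eq_sum_single (fderiv ℝ f z) v, inner_sum]
  simp only [Matrix.mulVec, dotProduct, firstForm, Matrix.of_apply, partialDeriv,
    inner_smul_right]
  exact Finset.sum_congr rfl fun j _ => mul_comm _ _

theorem isUnit_firstForm {z : EuclideanSpace ℝ (Fin n)} (hz : z ∈ U) : IsUnit (firstForm f z) := by
  rw [← Matrix.mulVec_injective_iff_isUnit, ← Matrix.coe_mulVecLin,
    injective_iff_map_eq_zero (Matrix.mulVecLin (firstForm f z))]
  intro v hv
  have h1 : fderiv ℝ f z (WithLp.toLp 2 v) = 0 := by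
    rw [← inner_self_eq_zero (𝕜 := ℝ)]
    conv_lhs => rw [← map_eq_sum_single (fderiv ℝ f z) (WithLp.toLp 2 v), sum_inner]
    refine Finset.sum_eq_zero fun i _ => ?_
    rw [map_eq_sum_single, inner_smul_left, ← firstForm_mulVec]
    have := congrFun hv i
    simp only [Matrix.mulVecLin_apply] at this
    rw [this]; simp
  have h2 : (WithLp.toLp 2 v : EuclideanSpace ℝ (Fin n)) = 0 :=
    h.injective z hz (by rw [h1, map_zero])
  exact congrArg WithLp.ofLp h2

/-- Raising the index of `⟨∂_l f, w⟩` gives the coordinates of the tangential part of `w`, for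
arbitrary ambient `w`. -/
theorem firstForm_inv_mulVec {z : EuclideanSpace ℝ (Fin n)} (hz : z ∈ U)
    (w : EuclideanSpace ℝ (Fin (n + 2))) :
    (firstForm f z)⁻¹ *ᵥ (fun l => inner ℝ (fderiv ℝ f z (EuclideanSpace.single l 1)) w) =
      (leftInv f z w).ofLp := by
  have hu := (Matrix.isUnit_iff_isUnit_det _).1 (h.isUnit_firstForm hz)
  have : (fun l => (inner ℝ (fderiv ℝ f z (EuclideanSpace.single l 1)) w : ℝ))
      = firstForm f z *ᵥ (leftInv f z w).ofLp := by
    ext i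
    rw [firstForm_mulVec, h.inner_deriv_left hz]
  rw [this, Matrix.mulVec_mulVec, Matrix.nonsing_inv_mul _ hu, Matrix.one_mulVec]

theorem shapeOperator_apply {z : EuclideanSpace ℝ (Fin n)} (hz : z ∈ U) (k j : Fin n) :
    shapeOperator f N z k j = shape f N z (EuclideanSpace.single j 1) k := by
  have h1 := congrFun (h.firstForm_inv_mulVec hz
    (-fderiv ℝ N z (EuclideanSpace.single j 1))) k
  rw [map_neg] at h1
  rw [shape]
  simp only [neg_apply, ContinuousLinearMap.comp_apply]
  rw [← h1, shapeOperator, Matrix.mul_apply]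
  simp [Matrix.mulVec, dotProduct, secondForm, partialDeriv]

theorem partialDeriv_firstForm {z : EuclideanSpace ℝ (Fin n)} (hz : z ∈ U) (i j l : Fin n) :
    partialDeriv (fun y => firstForm f y j l) i z =
      inner ℝ (fderiv ℝ f z (EuclideanSpace.single j 1))
        (fderiv ℝ (fderiv ℝ f) z (EuclideanSpace.single i 1) (EuclideanSpace.single l 1)) +
      inner ℝ (fderiv ℝ (fderiv ℝ f) z (EuclideanSpace.single i 1) (EuclideanSpace.single j 1))
        (fderiv ℝ f z (EuclideanSpace.single l 1)) := by
  have df : ∀ v : EuclideanSpace ℝ (Fin n), HasFDerivAt (fun y => fderiv ℝ f y v) _ z := fun v =>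
    (hasFDerivAt_of_smoothOn h.isOpen (smoothOn_fderiv h.isOpen h.smooth) hz).clm_apply
    (hasFDerivAt_const v z)
  rw [partialDeriv]
  have := ((df (EuclideanSpace.single j 1)).inner ℝ (df (EuclideanSpace.single l 1))).fderiv
  simp only [firstForm, Matrix.of_apply, partialDeriv]
  rw [this]
  simp

/-- In the Koszul combination of derivatives of the induced metric only `2 ⟨∂ᵢ∂ⱼ f, ∂_l f⟩`
survives: the connection is the tangential part of `d²f`. -/
theorem christoffel_apply {z : EuclideanSpace ℝ (Fin n)} (hz : z ∈ U) (k i j : Fin n) :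
    christoffel (firstForm f) k i j z = leftInv f z (fderiv ℝ (fderiv ℝ f) z
      (EuclideanSpace.single i 1) (EuclideanSpace.single j 1)) k := by
  have h1 := congrFun (h.firstForm_inv_mulVec hz (fderiv ℝ (fderiv ℝ f) z
      (EuclideanSpace.single i 1) (EuclideanSpace.single j 1))) k
  rw [← h1, christoffel, Matrix.mulVec, dotProduct, Finset.mul_sum]
  refine Finset.sum_congr rfl fun l _ => ?_
  rw [h.partialDeriv_firstForm hz, h.partialDeriv_firstForm hz, h.partialDeriv_firstForm hz,
    fderiv_fderiv_comm h.isOpen h.smooth hz (EuclideanSpace.single l 1) (EuclideanSpace.single j 1),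
    fderiv_fderiv_comm h.isOpen h.smooth hz (EuclideanSpace.single l 1) (EuclideanSpace.single i 1),
    fderiv_fderiv_comm h.isOpen h.smooth hz (EuclideanSpace.single j 1) (EuclideanSpace.single i 1),
    real_inner_comm (fderiv ℝ f z (EuclideanSpace.single l 1)),
    real_inner_comm (fderiv ℝ f z (EuclideanSpace.single j 1))]
  ring

theorem partialDeriv_shapeOperator {z : EuclideanSpace ℝ (Fin n)} (hz : z ∈ U) (i j k : Fin n) :
    partialDeriv (fun y => shapeOperator f N y k j) i z =
      fderiv ℝ (shape f N) z (EuclideanSpace.single i 1) (EuclideanSpace.single j 1) k := by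
  have d := (hasFDerivAt_of_smoothOn h.isOpen h.smooth_shape hz).clm_apply
    (hasFDerivAt_const (EuclideanSpace.single j (1 : ℝ)) z)
  have d1 := (EuclideanSpace.proj (𝕜 := ℝ) k).hasFDerivAt.comp z d
  have d2 := d1.congr_of_eventuallyEq (f₁ := fun y => shapeOperator f N y k j)
    (by filter_upwards [h.isOpen.mem_nhds hz] with y hy using h.shapeOperator_apply hy k j)
  rw [partialDeriv, d2.fderiv]
  simp

theorem covDeriv_apply {z : EuclideanSpace ℝ (Fin n)} (hz : z ∈ U) (i j k : Fin n) :
    covDeriv (firstForm f) (shapeOperator f N) i j k z =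
      (fderiv ℝ (shape f N) z (EuclideanSpace.single i 1) (EuclideanSpace.single j 1)
        + leftInv f z (fderiv ℝ (fderiv ℝ f) z (EuclideanSpace.single i 1)
          (shape f N z (EuclideanSpace.single j 1)))
        - shape f N z (leftInv f z (fderiv ℝ (fderiv ℝ f) z
          (EuclideanSpace.single i 1) (EuclideanSpace.single j 1)))) k := by
  have e1 := map_eq_sum_single ((leftInv f z).comp (fderiv ℝ (fderiv ℝ f) z
    (EuclideanSpace.single i 1))) (shape f N z (EuclideanSpace.single j 1))
  have e2 := map_eq_sum_single (shape f N z) (leftInv f z (fderiv ℝ (fderiv ℝ f) z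
          (EuclideanSpace.single i 1) (EuclideanSpace.single j 1)))
  simp only [ContinuousLinearMap.comp_apply] at e1
  rw [← e1, ← e2, covDeriv, h.partialDeriv_shapeOperator hz]
  simp only [h.christoffel_apply hz, h.shapeOperator_apply hz]
  simp only [PiLp.sub_apply, PiLp.add_apply, WithLp.ofLp_sum, WithLp.ofLp_smul, Finset.sum_apply,
    Pi.smul_apply, smul_eq_mul, mul_comm]

/-- The covariant derivative of the shape operator in terms of second derivatives. -/
theorem alphaCoord_eq {z : EuclideanSpace ℝ (Fin n)} (hz : z ∈ U) (i j k : Fin n) :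
    alphaCoord f N i j k z = cubic f N z (EuclideanSpace.single i 1) (EuclideanSpace.single j 1)
      (EuclideanSpace.single k 1) := by
  set ei := EuclideanSpace.single i (1 : ℝ)
  set ej := EuclideanSpace.single j (1 : ℝ)
  set ek := EuclideanSpace.single k (1 : ℝ)
  set C := fderiv ℝ (shape f N) z ei ej
        + leftInv f z (fderiv ℝ (fderiv ℝ f) z ei (shape f N z ej))
        - shape f N z (leftInv f z (fderiv ℝ (fderiv ℝ f) z ei ej)) with hC
  have e1 : alphaCoord f N i j k z = inner ℝ (fderiv ℝ f z C) (fderiv ℝ f z ek) := by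
    rw [← map_eq_sum_single (fderiv ℝ f z) C, sum_inner]
    simp only [alphaCoord, inner_smul_left, h.covDeriv_apply hz]
    rfl
  -- Differentiating `df A = -dN` expresses the derivative of `A` by second derivatives of `f` and
  -- `N`.
  have e2 := fderiv_apply_apply h.isOpen (smoothOn_fderiv h.isOpen h.smooth)
    (h.smooth_shape.clm_apply (contDiffOn_const (c := ej))) (c := fun y => -fderiv ℝ N y ej)
    (fun y hy => by rw [h.deriv_N hy, neg_neg]) hz ei
  rw [fderiv_clm_apply_const h.isOpen h.smooth_shape ej hz, fderiv_fun_neg, neg_apply,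
    fderiv_clm_apply_const h.isOpen (smoothOn_fderiv h.isOpen h.smooth_normal) ej hz] at e2
  have e3 : fderiv ℝ f z (fderiv ℝ (shape f N) z ei ej)
      = -fderiv ℝ (fderiv ℝ N) z ei ej - fderiv ℝ (fderiv ℝ f) z ei (shape f N z ej) := by
    rw [e2]; abel
  have e4 : ∀ w, (inner ℝ (fderiv ℝ f z (leftInv f z w)) (fderiv ℝ f z ek) : ℝ)
      = inner ℝ w (fderiv ℝ f z ek) := fun w => by
    rw [real_inner_comm, ← h.inner_deriv_left hz, real_inner_comm]
  have e5 : (inner ℝ (fderiv ℝ f z (shape f N z (leftInv f z (fderiv ℝ (fderiv ℝ f) z ei ej))))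
      (fderiv ℝ f z ek) : ℝ) = - inner ℝ (fderiv ℝ (fderiv ℝ f) z ei ej) (fderiv ℝ N z ek) := by
    rw [eq_neg_iff_add_eq_zero, ← neg_neg (fderiv ℝ f z (shape f N z _)), ← h.deriv_N hz,
      inner_neg_left, h.inner_deriv_N_comm hz, h.deriv_N hz ek, inner_neg_right, inner_neg_right,
      real_inner_comm _ (fderiv ℝ f z (leftInv f z _)), ← h.inner_deriv_left hz,
      real_inner_comm (fderiv ℝ f z _)]
    ring
  rw [e1, hC, map_sub, map_add, inner_sub_left, inner_add_left, e3, e4, e5, cubic, inner_sub_left,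
    inner_neg_left]
  ring

theorem gHatCoord_eq {z : EuclideanSpace ℝ (Fin n)} (hz : z ∈ U) (i j : Fin n) :
    gHatCoord f N z i j = (1 / 2) *
      (inner ℝ (fderiv ℝ f z (EuclideanSpace.single i 1))
        (fderiv ℝ f z (EuclideanSpace.single j 1)) +
      inner ℝ (fderiv ℝ N z (EuclideanSpace.single i 1))
        (fderiv ℝ N z (EuclideanSpace.single j 1))) := by
  have df := fun a => (EuclideanSpace.proj (𝕜 := ℝ) a).hasFDerivAt.comp z
    (hasFDerivAt_of_smoothOn h.isOpen h.smooth hz)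
  have dN := fun a => (EuclideanSpace.proj (𝕜 := ℝ) a).hasFDerivAt.comp z
    (hasFDerivAt_of_smoothOn h.isOpen h.smooth_normal hz)
  have d := fun a => (((Complex.ofRealCLM.hasFDerivAt.comp z (df a)).add
    ((Complex.ofRealCLM.hasFDerivAt.comp z (dN a)).const_mul Complex.I)).mul_const
      ((Real.sqrt 2 : ℂ)⁻¹)).congr_of_eventuallyEq (f₁ := fun y => stiefelLift f N y a)
      (Filter.Eventually.of_forall fun y => by simp [stiefelLift, div_eq_mul_inv])
  have hs : DifferentiableAt ℝ (stiefelLift f N) z :=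
    (differentiableAt_piLp 2).2 fun a => (d a).differentiableAt
  have e : ∀ i, ∀ a, partialDeriv (stiefelLift f N) i z a =
      ((fderiv ℝ f z (EuclideanSpace.single i 1) a : ℂ)
        + Complex.I * (fderiv ℝ N z (EuclideanSpace.single i 1) a : ℂ)) * (Real.sqrt 2 : ℂ)⁻¹ := by
    intro i a
    have d2 := (EuclideanSpace.proj (𝕜 := ℂ) a).restrictScalars ℝ |>.hasFDerivAt.comp z
      hs.hasFDerivAt
    have d3 := congrArg (fun L => L (EuclideanSpace.single i (1 : ℝ))) (d2.unique (d a))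
    simp at d3
    rw [partialDeriv, d3]
    ring
  rw [gHatCoord, Matrix.of_apply, PiLp.inner_apply, PiLp.inner_apply, PiLp.inner_apply]
  simp only [e]
  rw [← Finset.sum_add_distrib, Finset.mul_sum, Complex.re_sum]
  refine Finset.sum_congr rfl fun a _ => ?_
  have h2 : Real.sqrt 2 * Real.sqrt 2 = 2 := Real.mul_self_sqrt (by norm_num)
  have h3 : (Real.sqrt 2)⁻¹ * (Real.sqrt 2)⁻¹ = 1 / 2 := by rw [← mul_inv, h2, one_div]
  set r := Real.sqrt 2
  simp only [← Complex.ofReal_inv, RCLike.inner_apply, conj_trivial, Complex.mul_re, map_mul,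
    map_add, Complex.conj_I, Complex.conj_ofReal, Complex.add_re, Complex.add_im, Complex.mul_im,
    Complex.ofReal_re, Complex.ofReal_im, Complex.I_re, Complex.I_im, Complex.neg_re,
    Complex.neg_im]
  linear_combination (fderiv ℝ f z (EuclideanSpace.single i 1) a *
    fderiv ℝ f z (EuclideanSpace.single j 1) a + fderiv ℝ N z (EuclideanSpace.single i 1) a *
    fderiv ℝ N z (EuclideanSpace.single j 1) a) * h3

end LocalIsoparametric
end

/-! ### From the manifold to a chart -/

section
variable {n : ℕ} {M : Type*} [TopologicalSpace M] [ChartedSpace (EuclideanSpace ℝ (Fin n)) M]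
  [IsManifold 𝓘(ℝ, EuclideanSpace ℝ (Fin n)) ∞ M]

theorem inChart_contDiffOn {m : ℕ} {F : M → EuclideanSpace ℝ (Fin m)}
    (hF : ContMDiff 𝓘(ℝ, EuclideanSpace ℝ (Fin n)) 𝓘(ℝ, EuclideanSpace ℝ (Fin m)) ∞ F) (p : M) :
    ContDiffOn ℝ ∞ (inChart p F) (chartAt (EuclideanSpace ℝ (Fin n)) p).target := by
  rw [← contMDiffOn_iff_contDiffOn]
  exact hF.comp_contMDiffOn contMDiffOn_chart_symm

/-- `D` is the differential of the inverse chart. It carries injectivity, tangency and principal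
vectors between the chart and the manifold at every point of the chart domain, not only at `p`. -/
theorem exists_chart_differential (p : M) {z : EuclideanSpace ℝ (Fin n)}
    (hz : z ∈ (chartAt (EuclideanSpace ℝ (Fin n)) p).target) :
    ∃ D : EuclideanSpace ℝ (Fin n) → TangentSpace 𝓘(ℝ, EuclideanSpace ℝ (Fin n))
      ((chartAt (EuclideanSpace ℝ (Fin n)) p).symm z),
      Function.Bijective D ∧ D 0 = 0 ∧ ∀ {m : ℕ} {F : M → EuclideanSpace ℝ (Fin m)},
      ContMDiff 𝓘(ℝ, EuclideanSpace ℝ (Fin n)) 𝓘(ℝ, EuclideanSpace ℝ (Fin m)) ∞ F →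
      ∀ v, fderiv ℝ (inChart p F) z v = differential F _ (D v) := by
  have hc := mdifferentiable_chart (I := 𝓘(ℝ, EuclideanSpace ℝ (Fin n))) (M := M) p
  refine ⟨mfderiv 𝓘(ℝ, EuclideanSpace ℝ (Fin n)) 𝓘(ℝ, EuclideanSpace ℝ (Fin n))
    (chartAt (EuclideanSpace ℝ (Fin n)) p).symm z, hc.symm.mfderiv_bijective hz, map_zero _, ?_⟩
  intro m F hF v
  have := mfderiv_comp z (hF.mdifferentiable (by simp) _) (hc.mdifferentiableAt_symm hz)
  rw [← mfderiv_eq_fderiv]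
  exact congrArg (fun L => L v) this

theorem mem_principalCurvatures (F ν : M → EuclideanSpace ℝ (Fin (n + 2))) (p : M) (κ : ℝ) :
    κ ∈ principalCurvatures F ν p ↔
      ∃ v, v ≠ 0 ∧ differential (n := n) ν p v = -(κ • differential (n := n) F p v) := by
  rw [principalCurvatures, Set.mem_ofPred_eq, Submodule.ne_bot_iff]
  refine exists_congr fun v => ?_
  rw [and_comm, eq_neg_iff_add_eq_zero]
  rfl

/-- With a left inverse `G` of `dF`, they are eigenvalues of the endomorphism `-G dν`. -/
theorem principalCurvatures_finite {F ν : M → EuclideanSpace ℝ (Fin (n + 2))} {p : M}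
    (hF : Function.Injective (differential (n := n) F p)) :
    (principalCurvatures F ν p).Finite := by
  have : FiniteDimensional ℝ (TangentSpace 𝓘(ℝ, EuclideanSpace ℝ (Fin n)) p) :=
    inferInstanceAs (FiniteDimensional ℝ (EuclideanSpace ℝ (Fin n)))
  set L : TangentSpace 𝓘(ℝ, EuclideanSpace ℝ (Fin n)) p →ₗ[ℝ] EuclideanSpace ℝ (Fin (n + 2)) :=
    (differential (n := n) F p).toLinearMap
  set L' : TangentSpace 𝓘(ℝ, EuclideanSpace ℝ (Fin n)) p →ₗ[ℝ] EuclideanSpace ℝ (Fin (n + 2)) :=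
    (differential (n := n) ν p).toLinearMap
  obtain ⟨G, hG⟩ := L.exists_leftInverse_of_injective (LinearMap.ker_eq_bot.2 hF)
  refine (Module.End.finite_hasEigenvalue (-(G ∘ₗ L'))).subset ?_
  intro κ hκ
  obtain ⟨v, hv, h⟩ := (mem_principalCurvatures F ν p κ).1 hκ
  refine Module.End.hasEigenvalue_of_hasEigenvector (x := v)
    ⟨Module.End.mem_eigenspace_iff.2 ?_, hv⟩
  have hGv : G (differential F p v) = v := congrArg (fun L => L v) hG
  have h2 : L' v = -(κ • differential F p v) := h
  simp [h2, hGv]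

theorem IsIsoparametric.principalCurvatures_eq {F ν : M → EuclideanSpace ℝ (Fin (n + 2))}
    (hF : IsIsoparametric F ν) (p q : M) :
    principalCurvatures F ν p = principalCurvatures F ν q := by
  have : ∀ p : M, FiniteDimensional ℝ (TangentSpace 𝓘(ℝ, EuclideanSpace ℝ (Fin n)) p) :=
    fun p => inferInstanceAs (FiniteDimensional ℝ (EuclideanSpace ℝ (Fin n)))
  ext κ
  rw [principalCurvatures, principalCurvatures, Set.mem_ofPred_eq, Set.mem_ofPred_eq,
    ne_eq, ne_eq, ← Submodule.finrank_eq_zero (R := ℝ), ← Submodule.finrank_eq_zero (R := ℝ),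
    hF.principal_const p q]

theorem IsIsoparametric.exists_local {F ν : M → EuclideanSpace ℝ (Fin (n + 2))}
    (hF : IsIsoparametric F ν) (p : M) :
    ∃ Λ : Finset ℝ, (Λ : Set ℝ) = principalCurvatures F ν p ∧
      LocalIsoparametric (chartAt (EuclideanSpace ℝ (Fin n)) p).target (inChart p F)
        (inChart p ν) Λ := by
  refine ⟨(principalCurvatures_finite (ν := ν) (hF.immersion p)).toFinset, by simp, ?_⟩
  refine
    { isOpen := (chartAt _ p).open_target
      finrank_eq := by simp
      smooth := inChart_contDiffOn hF.smooth p
      smooth_normal := inChart_contDiffOn hF.normal_smooth p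
      injective := ?_
      norm_f := fun z _ => by simp [inChart, hF.mem_sphere]
      norm_N := fun z _ => by simp [inChart, hF.normal_norm]
      inner_N_f := fun z _ => hF.normal_orth_position _
      inner_N_deriv := ?_
      mem_iff := ?_ }
  · intro z hz
    obtain ⟨D, hD, -, h⟩ := exists_chart_differential p hz
    intro v w hvw
    rw [h hF.smooth, h hF.smooth] at hvw
    exact hD.1 (hF.immersion _ hvw)
  · intro z hz v
    obtain ⟨D, hD, -, h⟩ := exists_chart_differential p hz
    rw [h hF.smooth]
    exact hF.normal_orth_tangent _ _
  · intro z hz κ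
    obtain ⟨D, hD, hD0, h⟩ := exists_chart_differential p hz
    rw [Set.Finite.mem_toFinset,
      hF.principalCurvatures_eq p ((chartAt (EuclideanSpace ℝ (Fin n)) p).symm z),
      mem_principalCurvatures]
    constructor
    · rintro ⟨v, hv, hv2⟩
      obtain ⟨w, rfl⟩ := hD.2 v
      refine ⟨w, fun hw => hv (by rw [hw, hD0]), ?_⟩
      rw [h hF.smooth, h hF.normal_smooth, hv2]
    · rintro ⟨w, hw, hw2⟩
      refine ⟨D w, fun h0 => hw (hD.1 (by rw [h0, hD0])), ?_⟩
      rw [h hF.smooth, h hF.normal_smooth] at hw2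
      exact hw2

end

/-! ### Complexified tensors in a principal frame -/

/-- A real vector as a complex vector. -/
def toComplexVec {n : ℕ} (v : EuclideanSpace ℝ (Fin n)) : Fin n → ℂ := fun i => (v i : ℂ)

section
variable {n : ℕ}

theorem toComplexVec_add (v w : EuclideanSpace ℝ (Fin n)) :
    toComplexVec (v + w) = toComplexVec v + toComplexVec w := by
  ext i; simp [toComplexVec]

theorem toComplexVec_smul (t : ℝ) (v : EuclideanSpace ℝ (Fin n)) :
    toComplexVec (t • v) = (t : ℂ) • toComplexVec v := by
  ext i; simp [toComplexVec]

theorem span_toComplexVec {ι : Type*} (b : Module.Basis ι ℝ (EuclideanSpace ℝ (Fin n))) :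
    Submodule.span ℂ (Set.range fun i => toComplexVec (b i)) = ⊤ := by
  set S := Submodule.span ℂ (Set.range fun i => toComplexVec (b i))
  have h1 : ∀ v, toComplexVec v ∈ S := by
    intro v
    have hv : v ∈ Submodule.span ℝ (Set.range b) := by rw [b.span_eq]; trivial
    induction hv using Submodule.span_induction with
    | mem x hx =>
      obtain ⟨i, rfl⟩ := hx
      exact Submodule.subset_span ⟨i, rfl⟩
    | zero => convert S.zero_mem; ext i; simp [toComplexVec]
    | add x y _ _ hx hy => rw [toComplexVec_add]; exact S.add_mem hx hy
    | smul t x _ hx => rw [toComplexVec_smul]; exact S.smul_mem _ hx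
  rw [eq_top_iff]
  intro v _
  rw [pi_eq_sum_univ' v]
  refine S.sum_mem fun i _ => S.smul_mem _ ?_
  convert h1 (EuclideanSpace.single i 1)
  ext k
  by_cases hik : i = k <;> simp [toComplexVec, hik]

/-- A matrix with a spanning set of eigenvectors for nonzero eigenvalues is invertible. -/
theorem isUnit_of_eigenvectors {ι : Type*} {c : ι → Fin n → ℂ}
    (hc : Submodule.span ℂ (Set.range c) = ⊤) {A : Matrix (Fin n) (Fin n) ℂ} {m : ι → ℂ}
    (hm : ∀ i, m i ≠ 0) (hA : ∀ i, A *ᵥ c i = m i • c i) : IsUnit A := by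
  rw [← Matrix.mulVec_surjective_iff_isUnit]
  have : LinearMap.range A.mulVecLin = ⊤ := by
    rw [eq_top_iff, ← hc, Submodule.span_le]
    rintro _ ⟨i, rfl⟩
    refine ⟨(m i)⁻¹ • c i, ?_⟩
    rw [Matrix.mulVecLin_apply, Matrix.mulVec_smul, hA, inv_smul_smul₀ (hm i)]
  exact LinearMap.range_eq_top.1 this

theorem inv_mulVec_of_eigenvector {A : Matrix (Fin n) (Fin n) ℂ} (hA : IsUnit A) {m : ℂ}
    (hm : m ≠ 0) {v : Fin n → ℂ} (hv : A *ᵥ v = m • v) : A⁻¹ *ᵥ v = m⁻¹ • v := by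
  have hu := (Matrix.isUnit_iff_isUnit_det _).1 hA
  have : v = m⁻¹ • (A *ᵥ v) := by rw [hv, inv_smul_smul₀ hm]
  conv_lhs => rw [this]
  rw [Matrix.mulVec_smul, Matrix.mulVec_mulVec, Matrix.nonsing_inv_mul _ hu, Matrix.one_mulVec]

theorem pow_mulVec_of_eigenvector {A : Matrix (Fin n) (Fin n) ℂ} {m : ℂ}
    {v : Fin n → ℂ} (hv : A *ᵥ v = m • v) (k : ℕ) : (A ^ k) *ᵥ v = m ^ k • v := by
  induction k with
  | zero => simp
  | succ k ih =>
    rw [pow_succ, ← Matrix.mulVec_mulVec, hv, Matrix.mulVec_smul, ih, smul_smul, pow_succ, mul_comm]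

theorem zpow_mulVec_of_eigenvector {A : Matrix (Fin n) (Fin n) ℂ} (hA : IsUnit A) {m : ℂ}
    (hm : m ≠ 0) {v : Fin n → ℂ} (hv : A *ᵥ v = m • v) (k : ℤ) : (A ^ k) *ᵥ v = m ^ k • v := by
  obtain ⟨k, rfl | rfl⟩ := k.eq_nat_or_neg
  · rw [zpow_natCast, zpow_natCast, pow_mulVec_of_eigenvector hv]
  · rw [zpow_neg, zpow_natCast, ← inv_pow]
    have hu := (Matrix.isUnit_iff_isUnit_det _).1 hA
    rw [Matrix.zpow_neg hu, zpow_natCast, ← Matrix.inv_pow',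
      pow_mulVec_of_eigenvector (inv_mulVec_of_eigenvector hA hm hv)]

theorem LocalIsoparametric.exists_frame_fin {U : Set (EuclideanSpace ℝ (Fin n))}
    {f N : EuclideanSpace ℝ (Fin n) → EuclideanSpace ℝ (Fin (n + 2))} {Λ : Finset ℝ}
    (h : LocalIsoparametric U f N Λ) {z : EuclideanSpace ℝ (Fin n)} (hz : z ∈ U) :
    ∃ (b : Module.Basis (Fin n) ℝ (EuclideanSpace ℝ (Fin n))) (lam : Fin n → ℝ),
      PrincipalFrame f N Λ z b lam := by
  obtain ⟨b, lam, hb⟩ := h.exists_frame hz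
  set e : Fin (Module.finrank ℝ (EuclideanSpace ℝ (Fin n))) ≃ Fin n :=
    finCongr finrank_euclideanSpace_fin
  refine ⟨b.reindex e, lam ∘ e.symm, fun i j => ?_, fun i => ?_, fun i => hb.mem _⟩
  · simp [hb.orth]
  · simp [hb.shape_b]

/-- By total symmetry each argument can be moved to the last place, where the form is evidently
linear. -/
theorem LocalIsoparametric.cubic_eq_sum {U : Set (EuclideanSpace ℝ (Fin n))}
    {f N : EuclideanSpace ℝ (Fin n) → EuclideanSpace ℝ (Fin (n + 2))} {Λ : Finset ℝ}
    (h : LocalIsoparametric U f N Λ) {z : EuclideanSpace ℝ (Fin n)} (hz : z ∈ U)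
    (x y w : EuclideanSpace ℝ (Fin n)) :
    cubic f N z x y w = ∑ i, ∑ j, ∑ k, cubic f N z (EuclideanSpace.single i 1)
      (EuclideanSpace.single j 1) (EuclideanSpace.single k 1) * x i * y j * w k := by
  have e : ∀ x y w, cubic f N z x y w
      = ∑ k, w k * cubic f N z x y (EuclideanSpace.single k 1) := fun x y w =>
    (map_eq_sum_single ((innerSL ℝ (fderiv ℝ (fderiv ℝ f) z x y)).comp (fderiv ℝ N z)
      - (innerSL ℝ (fderiv ℝ (fderiv ℝ N) z x y)).comp (fderiv ℝ f z)) w).symm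
  have e1 : cubic f N z x y w = ∑ i, x i * cubic f N z (EuclideanSpace.single i 1) y w := by
    rw [h.cubic_comm_left hz, h.cubic_comm_right hz, e]
    refine Finset.sum_congr rfl fun i _ => ?_
    rw [h.cubic_comm_right hz, h.cubic_comm_left hz]
  rw [e1]
  refine Finset.sum_congr rfl fun i _ => ?_
  rw [h.cubic_comm_right hz, e, Finset.mul_sum]
  refine Finset.sum_congr rfl fun j _ => ?_
  rw [h.cubic_comm_right hz, e, Finset.mul_sum, Finset.mul_sum]
  refine Finset.sum_congr rfl fun k _ => ?_
  ring

end

section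
variable {n : ℕ} {M : Type*} [TopologicalSpace M] [ChartedSpace (EuclideanSpace ℝ (Fin n)) M]
  {F ν : M → EuclideanSpace ℝ (Fin (n + 2))} {p : M} {U : Set (EuclideanSpace ℝ (Fin n))}
  {Λ : Finset ℝ} (h : LocalIsoparametric U (inChart p F) (inChart p ν) Λ)
  (hz : chartAt (EuclideanSpace ℝ (Fin n)) p p ∈ U)
include h hz

theorem alpha_toComplexVec (x y w : EuclideanSpace ℝ (Fin n)) :
    alpha F ν p (toComplexVec x) (toComplexVec y) (toComplexVec w) =
      (cubic (inChart p F) (inChart p ν) (chartAt (EuclideanSpace ℝ (Fin n)) p p) x y w : ℂ) := by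
  rw [h.cubic_eq_sum hz x y w]
  simp only [alpha, toComplexVec, h.alphaCoord_eq hz]
  push_cast
  rfl

theorem shapeC_mulVec (x : EuclideanSpace ℝ (Fin n)) :
    shapeC F ν p *ᵥ toComplexVec x = toComplexVec
      (shape (inChart (n := n) p F) (inChart (n := n) p ν) (chartAt (EuclideanSpace ℝ (Fin n)) p p) x) := by
  ext k
  rw [← map_eq_sum_single (shape _ _ _) x]
  simp only [shapeC, Matrix.mulVec, dotProduct, toComplexVec, Matrix.map_apply,
    h.shapeOperator_apply hz]
  simp [mul_comm]

variable {b : Module.Basis (Fin n) ℝ (EuclideanSpace ℝ (Fin n))} {lam : Fin n → ℝ}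
  (hb : PrincipalFrame (inChart p F) (inChart p ν) Λ (chartAt (EuclideanSpace ℝ (Fin n)) p p) b lam)
include hb

/-- The principal curvatures are real, so `A₀ - i` and `B₀` have nonzero eigenvalues on a spanning
set and are invertible; hence negative powers are genuine inverses. -/
theorem powB_frame (k : ℤ) (i : Fin n) :
    powB F ν p k (toComplexVec (b i)) = cayley (lam i) ^ k • toComplexVec (b i) := by
  have hA : ∀ i, shapeC F ν p *ᵥ toComplexVec (b i) = (lam i : ℂ) • toComplexVec (b i) :=
    fun i => by rw [shapeC_mulVec h hz, hb.shape_b, toComplexVec_smul]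
  have hs := span_toComplexVec b
  have h1 : ∀ i, (shapeC F ν p - Complex.I • (1 : Matrix (Fin n) (Fin n) ℂ)) *ᵥ toComplexVec (b i)
      = ((lam i : ℂ) - Complex.I) • toComplexVec (b i) := fun i => by
    rw [Matrix.sub_mulVec, hA, Matrix.smul_mulVec, Matrix.one_mulVec, sub_smul]
  have h2 : ∀ i, (shapeC F ν p + Complex.I • (1 : Matrix (Fin n) (Fin n) ℂ)) *ᵥ toComplexVec (b i)
      = ((lam i : ℂ) + Complex.I) • toComplexVec (b i) := fun i => by
    rw [Matrix.add_mulVec, hA, Matrix.smul_mulVec, Matrix.one_mulVec, add_smul]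
  have hu := isUnit_of_eigenvectors hs (fun i => sub_I_ne_zero (lam i)) h1
  have h3 : ∀ i, opB F ν p *ᵥ toComplexVec (b i) = cayley (lam i) • toComplexVec (b i) :=
    fun i => by
    rw [opB, ← Matrix.mulVec_mulVec, inv_mulVec_of_eigenvector hu (sub_I_ne_zero _) (h1 i),
      Matrix.mulVec_smul, h2, smul_smul, cayley, div_eq_mul_inv, mul_comm]
  exact zpow_mulVec_of_eigenvector (isUnit_of_eigenvectors hs (fun i => cayley_ne_zero _) h3)
    (cayley_ne_zero _) (h3 i) k

/-- Since `dN = -lam df` on principal vectors and `ĝ = (⟨df, df⟩ + ⟨dN, dN⟩) / 2`, the frame stays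
orthogonal with weight `(1 + lam²) / 2`. -/
theorem sum_gHatMatrix_frame (i j : Fin n) :
    ∑ a, ∑ c, gHatMatrix F ν p a c * b i a * b j c =
      if i = j then (1 + lam i ^ 2) / 2 else 0 := by
  set f := inChart (n := n) p F
  set N := inChart (n := n) p ν
  set z := chartAt (EuclideanSpace ℝ (Fin n)) p p
  have e : ∀ x y : EuclideanSpace ℝ (Fin n), ∑ a, ∑ c, gHatMatrix F ν p a c * x a * y c
      = (1 / 2) * (inner ℝ (fderiv ℝ f z x) (fderiv ℝ f z y)
        + inner ℝ (fderiv ℝ N z x) (fderiv ℝ N z y)) := by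
    intro x y
    rw [← map_eq_sum_single (fderiv ℝ f z) x, ← map_eq_sum_single (fderiv ℝ f z) y,
      ← map_eq_sum_single (fderiv ℝ N z) x, ← map_eq_sum_single (fderiv ℝ N z) y]
    have hG : gHatMatrix F ν p = gHatCoord f N z := rfl
    simp only [hG, h.gHatCoord_eq hz, sum_inner, inner_sum, inner_smul_left,
      inner_smul_right, conj_trivial]
    simp only [← Finset.sum_add_distrib, Finset.mul_sum]
    rw [Finset.sum_comm]
    refine Finset.sum_congr rfl fun a _ => ?_
    refine Finset.sum_congr rfl fun c _ => ?_
    ring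
  have h1 := hb.orth i j
  rw [e, h.deriv_N_of_shape hz (hb.shape_b i), h.deriv_N_of_shape hz (hb.shape_b j),
    inner_neg_left, inner_neg_right, inner_smul_left, inner_smul_right, h1, conj_trivial]
  by_cases hij : i = j
  · subst hij; simp; ring
  · simp [hij]

theorem gHat_frame (i j : Fin n) :
    gHat F ν p (toComplexVec (b i)) (toComplexVec (b j)) =
      if i = j then ((1 + lam i ^ 2) / 2 : ℂ) else 0 := by
  have := congrArg (fun t : ℝ => (t : ℂ)) (sum_gHatMatrix_frame h hz hb i j)
  simp only [gHat, toComplexVec]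
  push_cast at this
  rw [this]
  split_ifs <;> simp

/-- If the columns of `P` are the frame, then `Pᵀ G P = D` is diagonal, so `G⁻¹ = P D⁻¹ Pᵀ`. -/
theorem gHatMatrix_inv_apply (a c : Fin n) :
    (gHatMatrix F ν p)⁻¹ a c = ∑ i, b i a * b i c * ((1 + lam i ^ 2) / 2)⁻¹ := by
  set P : Matrix (Fin n) (Fin n) ℝ := Matrix.of fun a i => b i a with hP
  set D : Matrix (Fin n) (Fin n) ℝ := Matrix.diagonal fun i => (1 + lam i ^ 2) / 2 with hD
  set D' : Matrix (Fin n) (Fin n) ℝ := Matrix.diagonal fun i => ((1 + lam i ^ 2) / 2)⁻¹ with hD'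
  have h0 : ∀ i, (1 + lam i ^ 2) / 2 ≠ 0 := fun i => by positivity
  have h1 : Pᵀ * gHatMatrix F ν p * P = D := by
    ext i j
    have := sum_gHatMatrix_frame h hz hb i j
    rw [hD, Matrix.diagonal_apply, ← this, Matrix.mul_apply]
    simp only [Matrix.mul_apply, Finset.sum_mul]
    rw [Finset.sum_comm]
    refine Finset.sum_congr rfl fun a _ => Finset.sum_congr rfl fun c _ => ?_
    simp only [hP, Matrix.transpose_apply, Matrix.of_apply]
    ring
  have h2 : D' * D = 1 := by
    rw [hD, hD', Matrix.diagonal_mul_diagonal, ← Matrix.diagonal_one]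
    congr 1
    ext i
    exact inv_mul_cancel₀ (h0 i)
  have h3 : (D' * Pᵀ * gHatMatrix F ν p) * P = 1 := by
    rw [← h2, ← h1]; simp only [Matrix.mul_assoc]
  have h4 := mul_eq_one_comm.1 h3
  have h5 : (P * D' * Pᵀ) * gHatMatrix F ν p = 1 := by
    rw [← h4]; simp only [Matrix.mul_assoc]
  rw [Matrix.inv_eq_left_inv h5, Matrix.mul_apply]
  refine Finset.sum_congr rfl fun i _ => ?_
  rw [hD', Matrix.mul_diagonal]
  simp only [hP, Matrix.transpose_apply, Matrix.of_apply]
  ring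

theorem traceHat_frame (φ ψ : (Fin n → ℂ) →ₗ[ℂ] ℂ) :
    traceHat F ν p (fun u v => φ u * ψ v) =
      ∑ i, ((1 + lam i ^ 2) / 2 : ℂ)⁻¹ * (φ (toComplexVec (b i)) * ψ (toComplexVec (b i))) := by
  have e : ∀ (φ : (Fin n → ℂ) →ₗ[ℂ] ℂ) (v : EuclideanSpace ℝ (Fin n)),
      φ (toComplexVec v) = ∑ a, (v a : ℂ) * φ (Pi.single a 1) := by
    intro φ v
    conv_lhs => rw [pi_eq_sum_univ' (toComplexVec v)]
    simp only [map_sum, map_smul, smul_eq_mul, toComplexVec]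
  have e2 : ∀ i, φ (toComplexVec (b i)) * ψ (toComplexVec (b i)) = ∑ a, ∑ c,
      ((b i a : ℂ) * φ (Pi.single a 1)) * ((b i c : ℂ) * ψ (Pi.single c 1)) := fun i => by
    rw [e, e, Finset.sum_mul_sum]
  simp only [traceHat, gHatMatrix_inv_apply h hz hb, e2]
  push_cast
  simp only [Finset.sum_mul, Finset.mul_sum]
  conv_lhs =>
    enter [2, a]
    rw [Finset.sum_comm]
  rw [Finset.sum_comm]
  refine Finset.sum_congr rfl fun i _ => Finset.sum_congr rfl fun a _ =>
    Finset.sum_congr rfl fun c _ => ?_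
  ring

end

/-! ### Multilinearity of the traces -/

section
variable {n : ℕ} {M : Type*} [TopologicalSpace M] [ChartedSpace (EuclideanSpace ℝ (Fin n)) M]
  (F ν : M → EuclideanSpace ℝ (Fin (n + 2))) (p : M)

theorem alpha_add_left (x x' y w : Fin n → ℂ) :
    alpha F ν p (x + x') y w = alpha F ν p x y w + alpha F ν p x' y w := by
  simp only [alpha, Pi.add_apply, mul_add, add_mul, Finset.sum_add_distrib]

theorem alpha_add_middle (x y y' w : Fin n → ℂ) :
    alpha F ν p x (y + y') w = alpha F ν p x y w + alpha F ν p x y' w := by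
  simp only [alpha, Pi.add_apply, mul_add, add_mul, Finset.sum_add_distrib]

theorem alpha_add_right (x y w w' : Fin n → ℂ) :
    alpha F ν p x y (w + w') = alpha F ν p x y w + alpha F ν p x y w' := by
  simp only [alpha, Pi.add_apply, mul_add, Finset.sum_add_distrib]

theorem alpha_smul_left (t : ℂ) (x y w : Fin n → ℂ) :
    alpha F ν p (t • x) y w = t * alpha F ν p x y w := by
  simp only [alpha, Pi.smul_apply, smul_eq_mul, Finset.mul_sum]
  refine Finset.sum_congr rfl fun _ _ => Finset.sum_congr rfl fun _ _ =>
    Finset.sum_congr rfl fun _ _ => by ring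

theorem alpha_smul_middle (t : ℂ) (x y w : Fin n → ℂ) :
    alpha F ν p x (t • y) w = t * alpha F ν p x y w := by
  simp only [alpha, Pi.smul_apply, smul_eq_mul, Finset.mul_sum]
  refine Finset.sum_congr rfl fun _ _ => Finset.sum_congr rfl fun _ _ =>
    Finset.sum_congr rfl fun _ _ => by ring

theorem alpha_smul_right (t : ℂ) (x y w : Fin n → ℂ) :
    alpha F ν p x y (t • w) = t * alpha F ν p x y w := by
  simp only [alpha, Pi.smul_apply, smul_eq_mul, Finset.mul_sum]
  refine Finset.sum_congr rfl fun _ _ => Finset.sum_congr rfl fun _ _ =>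
    Finset.sum_congr rfl fun _ _ => by ring

theorem gHat_add_left (x x' y : Fin n → ℂ) :
    gHat F ν p (x + x') y = gHat F ν p x y + gHat F ν p x' y := by
  simp only [gHat, Pi.add_apply, mul_add, add_mul, Finset.sum_add_distrib]

theorem gHat_add_right (x y y' : Fin n → ℂ) :
    gHat F ν p x (y + y') = gHat F ν p x y + gHat F ν p x y' := by
  simp only [gHat, Pi.add_apply, mul_add, Finset.sum_add_distrib]

theorem gHat_smul_left (t : ℂ) (x y : Fin n → ℂ) :
    gHat F ν p (t • x) y = t * gHat F ν p x y := by
  simp only [gHat, Pi.smul_apply, smul_eq_mul, Finset.mul_sum]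
  refine Finset.sum_congr rfl fun _ _ => Finset.sum_congr rfl fun _ _ => by ring

theorem gHat_smul_right (t : ℂ) (x y : Fin n → ℂ) :
    gHat F ν p x (t • y) = t * gHat F ν p x y := by
  simp only [gHat, Pi.smul_apply, smul_eq_mul, Finset.mul_sum]
  refine Finset.sum_congr rfl fun _ _ => Finset.sum_congr rfl fun _ _ => by ring

theorem powB_add (k : ℤ) (x y : Fin n → ℂ) :
    powB F ν p k (x + y) = powB F ν p k x + powB F ν p k y := Matrix.mulVec_add _ _ _

theorem powB_smul (k : ℤ) (t : ℂ) (x : Fin n → ℂ) :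
    powB F ν p k (t • x) = t • powB F ν p k x := Matrix.mulVec_smul _ _ _

theorem traceHat_add (β β' : (Fin n → ℂ) → (Fin n → ℂ) → ℂ) :
    traceHat F ν p (fun u v => β u v + β' u v) = traceHat F ν p β + traceHat F ν p β' := by
  simp only [traceHat, mul_add, Finset.sum_add_distrib]

theorem traceHat_sub (β β' : (Fin n → ℂ) → (Fin n → ℂ) → ℂ) :
    traceHat F ν p (fun u v => β u v - β' u v) = traceHat F ν p β - traceHat F ν p β' := by
  simp only [traceHat, mul_sub, Finset.sum_sub_distrib]

theorem traceHat_mul (t : ℂ) (β : (Fin n → ℂ) → (Fin n → ℂ) → ℂ) :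
    traceHat F ν p (fun u v => t * β u v) = t * traceHat F ν p β := by
  simp only [traceHat, Finset.mul_sum]
  refine Finset.sum_congr rfl fun _ _ => Finset.sum_congr rfl fun _ _ => by ring

/-- The linear form `α(x, y, ·)`. -/
noncomputable def alphaForm (x y : Fin n → ℂ) : (Fin n → ℂ) →ₗ[ℂ] ℂ where
  toFun := alpha F ν p x y
  map_add' := alpha_add_right F ν p x y
  map_smul' := fun t w => alpha_smul_right F ν p t x y w

/-- The sum over `k` in the trace formula, as a linear form. -/
noncomputable def alphaSum (l j : ℕ) (X Z : Fin n → ℂ) : (Fin n → ℂ) →ₗ[ℂ] ℂ :=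
  ∑ k ∈ Finset.range j,
    (alphaForm F ν p (powB F ν p l X) (powB F ν p (k + 1) Z) ∘ₗ
        (opB F ν p ^ ((j : ℤ) - k - 1)).mulVecLin
      + alphaForm F ν p (powB F ν p l X) (powB F ν p k Z) ∘ₗ
        (opB F ν p ^ ((j : ℤ) - k)).mulVecLin)

theorem alphaSum_apply (l j : ℕ) (X Z v : Fin n → ℂ) :
    alphaSum F ν p l j X Z v = ∑ k ∈ Finset.range j,
      (alpha F ν p (powB F ν p l X) (powB F ν p (k + 1) Z) (powB F ν p (j - k - 1) v)
        + alpha F ν p (powB F ν p l X) (powB F ν p k Z) (powB F ν p (j - k) v)) := by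
  simp only [alphaSum, LinearMap.sum_apply]
  rfl

theorem alphaSum_add_left (l j : ℕ) (X X' Z v : Fin n → ℂ) :
    alphaSum F ν p l j (X + X') Z v = alphaSum F ν p l j X Z v + alphaSum F ν p l j X' Z v := by
  simp only [alphaSum_apply, powB_add, alpha_add_left, ← Finset.sum_add_distrib]
  exact Finset.sum_congr rfl fun _ _ => by ring

theorem alphaSum_add_right (l j : ℕ) (X Z Z' v : Fin n → ℂ) :
    alphaSum F ν p l j X (Z + Z') v = alphaSum F ν p l j X Z v + alphaSum F ν p l j X Z' v := by
  simp only [alphaSum_apply, powB_add, alpha_add_middle, ← Finset.sum_add_distrib]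
  exact Finset.sum_congr rfl fun _ _ => by ring

theorem alphaSum_smul_left (l j : ℕ) (t : ℂ) (X Z v : Fin n → ℂ) :
    alphaSum F ν p l j (t • X) Z v = t * alphaSum F ν p l j X Z v := by
  simp only [alphaSum_apply, powB_smul, alpha_smul_left, Finset.mul_sum]
  exact Finset.sum_congr rfl fun _ _ => by ring

theorem alphaSum_smul_right (l j : ℕ) (t : ℂ) (X Z v : Fin n → ℂ) :
    alphaSum F ν p l j X (t • Z) v = t * alphaSum F ν p l j X Z v := by
  simp only [alphaSum_apply, powB_smul, alpha_smul_middle, Finset.mul_sum]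
  exact Finset.sum_congr rfl fun _ _ => by ring

/-- One of the four terms of the trace formula. -/
noncomputable def mixedTrace (l j : ℕ) (X Y Z W : Fin n → ℂ) : ℂ :=
  traceHat F ν p fun u v =>
    alphaForm F ν p (powB F ν p (-l) Y) (powB F ν p (-j) W) u * alphaSum F ν p l j X Z v

/-- One of the four terms of the trace formula, summed over `l` and `j`. -/
noncomputable def mixedTraceSum (g : ℕ) (X Y Z W : Fin n → ℂ) : ℂ :=
  ∑ l ∈ Finset.range g, ∑ j ∈ Finset.range g, mixedTrace F ν p l j X Y Z W

theorem mixedTraceSum_add₁ (g : ℕ) (X X' Y Z W : Fin n → ℂ) :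
    mixedTraceSum F ν p g (X + X') Y Z W =
      mixedTraceSum F ν p g X Y Z W + mixedTraceSum F ν p g X' Y Z W := by
  simp only [mixedTraceSum, mixedTrace, alphaSum_add_left, mul_add, traceHat_add,
    Finset.sum_add_distrib]

theorem mixedTraceSum_add₂ (g : ℕ) (X Y Y' Z W : Fin n → ℂ) :
    mixedTraceSum F ν p g X (Y + Y') Z W =
      mixedTraceSum F ν p g X Y Z W + mixedTraceSum F ν p g X Y' Z W := by
  have : ∀ y y' w u, alphaForm F ν p (y + y') w u
      = alphaForm F ν p y w u + alphaForm F ν p y' w u := alpha_add_left F ν p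
  simp only [mixedTraceSum, mixedTrace, powB_add, this, add_mul, traceHat_add,
    Finset.sum_add_distrib]

theorem mixedTraceSum_add₃ (g : ℕ) (X Y Z Z' W : Fin n → ℂ) :
    mixedTraceSum F ν p g X Y (Z + Z') W =
      mixedTraceSum F ν p g X Y Z W + mixedTraceSum F ν p g X Y Z' W := by
  simp only [mixedTraceSum, mixedTrace, alphaSum_add_right, mul_add, traceHat_add,
    Finset.sum_add_distrib]

theorem mixedTraceSum_add₄ (g : ℕ) (X Y Z W W' : Fin n → ℂ) :
    mixedTraceSum F ν p g X Y Z (W + W') =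
      mixedTraceSum F ν p g X Y Z W + mixedTraceSum F ν p g X Y Z W' := by
  have : ∀ y w w' u, alphaForm F ν p y (w + w') u
      = alphaForm F ν p y w u + alphaForm F ν p y w' u := alpha_add_middle F ν p
  simp only [mixedTraceSum, mixedTrace, powB_add, this, add_mul, traceHat_add,
    Finset.sum_add_distrib]

theorem mixedTraceSum_smul₁ (g : ℕ) (t : ℂ) (X Y Z W : Fin n → ℂ) :
    mixedTraceSum F ν p g (t • X) Y Z W = t * mixedTraceSum F ν p g X Y Z W := by
  simp only [mixedTraceSum, mixedTrace, alphaSum_smul_left, mul_left_comm _ t, traceHat_mul,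
    Finset.mul_sum]

theorem mixedTraceSum_smul₂ (g : ℕ) (t : ℂ) (X Y Z W : Fin n → ℂ) :
    mixedTraceSum F ν p g X (t • Y) Z W = t * mixedTraceSum F ν p g X Y Z W := by
  have : ∀ y w u, alphaForm F ν p (t • y) w u = t * alphaForm F ν p y w u :=
    alpha_smul_left F ν p t
  simp only [mixedTraceSum, mixedTrace, powB_smul, this, mul_assoc, traceHat_mul, Finset.mul_sum]

theorem mixedTraceSum_smul₃ (g : ℕ) (t : ℂ) (X Y Z W : Fin n → ℂ) :
    mixedTraceSum F ν p g X Y (t • Z) W = t * mixedTraceSum F ν p g X Y Z W := by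
  simp only [mixedTraceSum, mixedTrace, alphaSum_smul_right, mul_left_comm _ t, traceHat_mul,
    Finset.mul_sum]

theorem mixedTraceSum_smul₄ (g : ℕ) (t : ℂ) (X Y Z W : Fin n → ℂ) :
    mixedTraceSum F ν p g X Y Z (t • W) = t * mixedTraceSum F ν p g X Y Z W := by
  have : ∀ y w u, alphaForm F ν p y (t • w) u = t * alphaForm F ν p y w u :=
    alpha_smul_middle F ν p t
  simp only [mixedTraceSum, mixedTrace, powB_smul, this, mul_assoc, traceHat_mul, Finset.mul_sum]

end

/-- Used for the defect of the trace formula, which is only real linear in each argument because of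
the imaginary part in `T`. -/
theorem eq_zero_of_basis {V ι : Type*} [AddCommGroup V] [Module ℝ V] (b : Module.Basis ι ℝ V)
    {L : V → ℂ} (hadd : ∀ x y, L (x + y) = L x + L y) (hsmul : ∀ (t : ℝ) x, L (t • x) = t * L x)
    (hb : ∀ i, L (b i) = 0) (x : V) : L x = 0 := by
  have hx : x ∈ Submodule.span ℝ (Set.range b) := by rw [b.span_eq]; trivial
  induction hx using Submodule.span_induction with
  | mem x hx => obtain ⟨i, rfl⟩ := hx; exact hb i
  | zero => simpa using hsmul 0 0
  | add x y _ _ hx hy => rw [hadd, hx, hy, add_zero]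
  | smul t x _ hx => rw [hsmul, hx, mul_zero]

/-! ### Summation over the powers of `B₀` -/

/-- The sum over `l`, `j` and `k` for fixed eigenvalues. -/
theorem sum_sum_pow {g : ℕ} {x y r s e : ℂ} (hy : y ≠ 0) (hs : s ≠ 0)
    (hxy : (x / y) ^ g = 1) (hrs : (r / s) ^ g = 1) (hes : (e / s) ^ g = 1) (hre : r ≠ e)
    (hse : s ≠ e) :
    ∑ l ∈ Finset.range g, ∑ j ∈ Finset.range g, (y ^ (-(l : ℤ)) * s ^ (-(j : ℤ)) *
      ∑ k ∈ Finset.range j, (x ^ (l : ℤ) * r ^ ((k : ℤ) + 1) * e ^ ((j : ℤ) - k - 1) +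
        x ^ (l : ℤ) * r ^ (k : ℤ) * e ^ ((j : ℤ) - k))) =
    if x = y ∧ r = s then (g : ℂ) ^ 2 * ((r + e) / (r - e)) else 0 := by
  have hre' : r - e ≠ 0 := sub_ne_zero.2 hre
  have h1 : ∀ l j : ℕ, y ^ (-(l : ℤ)) * s ^ (-(j : ℤ)) *
      ∑ k ∈ Finset.range j, (x ^ (l : ℤ) * r ^ ((k : ℤ) + 1) * e ^ ((j : ℤ) - k - 1) +
        x ^ (l : ℤ) * r ^ (k : ℤ) * e ^ ((j : ℤ) - k)) =
      (x / y) ^ l * (((r + e) / (r - e)) * ((r / s) ^ j - (e / s) ^ j)) := by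
    intro l j
    have h2 : ∑ k ∈ Finset.range j, (x ^ (l : ℤ) * r ^ ((k : ℤ) + 1) * e ^ ((j : ℤ) - k - 1) +
        x ^ (l : ℤ) * r ^ (k : ℤ) * e ^ ((j : ℤ) - k)) =
        x ^ l * (r + e) * ∑ k ∈ Finset.range j, r ^ k * e ^ (j - 1 - k) := by
      rw [Finset.mul_sum]
      refine Finset.sum_congr rfl fun k hk => ?_
      have hk' := Finset.mem_range.1 hk
      -- As `k < j`, the integer exponents are natural numbers and no truncation occurs.
      have e1 : (j : ℤ) - k - 1 = ((j - 1 - k : ℕ) : ℤ) := by omega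
      have e2 : (j : ℤ) - k = ((j - 1 - k + 1 : ℕ) : ℤ) := by omega
      have e3 : (k : ℤ) + 1 = ((k + 1 : ℕ) : ℤ) := by push_cast; ring
      rw [e1, e2, e3]
      simp only [zpow_natCast]
      ring
    rw [h2, (Commute.all r e).geom_sum₂ hre, zpow_neg, zpow_neg, zpow_natCast, zpow_natCast, div_pow, div_pow,
      div_pow]
    field_simp
  simp only [h1]
  simp only [← Finset.mul_sum, ← Finset.sum_mul, Finset.sum_sub_distrib]
  -- Orthogonality of characters; the sum of the powers of `e / s` vanishes because `s ≠ e`.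
  rw [sum_pow_of_pow_eq_one hxy, sum_pow_of_pow_eq_one hrs, sum_pow_of_pow_eq_one hes]
  simp only [div_eq_one_iff_eq hy, div_eq_one_iff_eq hs, hse.symm, if_false]
  by_cases hxy : x = y <;> by_cases hrs : r = s <;> simp [hxy, hrs]
  ring

section
variable {n : ℕ} {M : Type*} [TopologicalSpace M] [ChartedSpace (EuclideanSpace ℝ (Fin n)) M]
  {F ν : M → EuclideanSpace ℝ (Fin (n + 2))} {p : M} {U : Set (EuclideanSpace ℝ (Fin n))}
  {Λ : Finset ℝ} (h : LocalIsoparametric U (inChart p F) (inChart p ν) Λ)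
  (hz : chartAt (EuclideanSpace ℝ (Fin n)) p p ∈ U)
  {b : Module.Basis (Fin n) ℝ (EuclideanSpace ℝ (Fin n))} {lam : Fin n → ℝ}
  (hb : PrincipalFrame (inChart p F) (inChart p ν) Λ (chartAt (EuclideanSpace ℝ (Fin n)) p p) b lam)
include h hz hb

/-- In the frame each trace term is a scalar sum evaluated by `sum_sum_pow`; equal spacing of the
principal curvatures supplies the roots of unity. -/
theorem mixedTraceSum_frame (P Q R S : Fin n) :
    mixedTraceSum F ν p Λ.card (toComplexVec (b P)) (toComplexVec (b Q)) (toComplexVec (b R))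
      (toComplexVec (b S)) = if lam P = lam Q ∧ lam R = lam S then
        (Λ.card : ℂ) ^ 2 * ∑ i, ((1 + lam i ^ 2) / 2 : ℂ)⁻¹ *
          ((cayley (lam R) + cayley (lam i)) / (cayley (lam R) - cayley (lam i))) *
          (cubic (inChart (n := n) p F) (inChart (n := n) p ν)
            (chartAt (EuclideanSpace ℝ (Fin n)) p p) (b Q) (b S) (b i) *
          cubic (inChart (n := n) p F) (inChart (n := n) p ν)
            (chartAt (EuclideanSpace ℝ (Fin n)) p p) (b P) (b R) (b i) : ℝ) else 0 := by
  set z := chartAt (EuclideanSpace ℝ (Fin n)) p p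
  set f := inChart (n := n) p F
  set N := inChart (n := n) p ν
  have hΛ : ∀ a ∈ Λ, ∀ c ∈ Λ, c ≠ a → ∃ e ∈ Λ, e ≠ a ∧
      (1 + a * e) / (a - e) = -((1 + a * c) / (a - c)) :=
    fun a ha c hc hca => h.exists_reflection hz ha hc hca
  have hpow : ∀ i j, (cayley (lam i) / cayley (lam j)) ^ Λ.card = 1 := fun i j =>
    cayley_div_pow_card hΛ (hb.mem i) (hb.mem j)
  have e1 : ∀ l j : ℕ, mixedTrace F ν p l j (toComplexVec (b P)) (toComplexVec (b Q))
      (toComplexVec (b R)) (toComplexVec (b S)) = ∑ i, ((1 + lam i ^ 2) / 2 : ℂ)⁻¹ *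
        ((cubic f N z (b Q) (b S) (b i) * cubic f N z (b P) (b R) (b i) : ℝ) *
        (cayley (lam Q) ^ (-(l : ℤ)) * cayley (lam S) ^ (-(j : ℤ)) *
      ∑ k ∈ Finset.range j, (cayley (lam P) ^ (l : ℤ) * cayley (lam R) ^ ((k : ℤ) + 1) *
        cayley (lam i) ^ ((j : ℤ) - k - 1) +
        cayley (lam P) ^ (l : ℤ) * cayley (lam R) ^ (k : ℤ) * cayley (lam i) ^ ((j : ℤ) - k)))) := by
    intro l j
    rw [mixedTrace, traceHat_frame h hz hb]
    refine Finset.sum_congr rfl fun i _ => ?_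
    congr 1
    have e2 : ∀ x y w, alphaForm F ν p x y w = alpha F ν p x y w := fun _ _ _ => rfl
    simp only [e2, alphaSum_apply, powB_frame h hz hb, alpha_smul_left, alpha_smul_middle,
      alpha_smul_right, alpha_toComplexVec h hz, Finset.mul_sum]
    refine Finset.sum_congr rfl fun k _ => ?_
    push_cast
    ring
  simp only [mixedTraceSum, e1]
  have e3 : ∀ i, ∑ l ∈ Finset.range Λ.card, ∑ j ∈ Finset.range Λ.card,
      ((1 + lam i ^ 2) / 2 : ℂ)⁻¹ *
        ((cubic f N z (b Q) (b S) (b i) * cubic f N z (b P) (b R) (b i) : ℝ) *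
        (cayley (lam Q) ^ (-(l : ℤ)) * cayley (lam S) ^ (-(j : ℤ)) *
      ∑ k ∈ Finset.range j, (cayley (lam P) ^ (l : ℤ) * cayley (lam R) ^ ((k : ℤ) + 1) *
        cayley (lam i) ^ ((j : ℤ) - k - 1) +
        cayley (lam P) ^ (l : ℤ) * cayley (lam R) ^ (k : ℤ) * cayley (lam i) ^ ((j : ℤ) - k)))) =
      if lam P = lam Q ∧ lam R = lam S then
        (Λ.card : ℂ) ^ 2 * (((1 + lam i ^ 2) / 2 : ℂ)⁻¹ *
          ((cayley (lam R) + cayley (lam i)) / (cayley (lam R) - cayley (lam i))) *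
          (cubic f N z (b Q) (b S) (b i) * cubic f N z (b P) (b R) (b i) : ℝ)) else 0 := by
    intro i
    simp only [← Finset.mul_sum]
    -- Equal eigenvalues would make the geometric sum degenerate or break orthogonality, but in
    -- these cases one of the two factors `cubic` is zero.
    by_cases h1 : lam R = lam i
    · rw [h.cubic_eq_zero hz (hb.mem i) (b P) (h1 ▸ hb.shape_b R) (hb.shape_b i)]
      simp
    by_cases h2 : lam S = lam i
    · rw [h.cubic_eq_zero hz (hb.mem i) (b Q) (h2 ▸ hb.shape_b S) (hb.shape_b i)]
      simp
    simp only [Finset.mul_sum]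
    simp only [← Finset.mul_sum]
    rw [sum_sum_pow (cayley_ne_zero _) (cayley_ne_zero _) (hpow _ _) (hpow _ _) (hpow _ _)
      (cayley_injective.ne h1) (cayley_injective.ne h2)]
    simp only [cayley_injective.eq_iff]
    split_ifs
    · ring
    · simp
  rw [Finset.sum_congr rfl fun l _ => Finset.sum_comm, Finset.sum_comm]
  simp only [e3]
  split_ifs
  · rw [Finset.mul_sum]
  · simp

end

/-! ### Coefficients and the formula on the frame -/

theorem cayley_add_div_sub (a e : ℝ) :
    (cayley a + cayley e) / (cayley a - cayley e) = -Complex.I * (1 + a * e) / (e - a) := by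
  have h1 := sub_I_ne_zero a
  have h2 := sub_I_ne_zero e
  have h3 : cayley a + cayley e =
      2 * (1 + a * e) / (((a : ℂ) - Complex.I) * ((e : ℂ) - Complex.I)) := by
    rw [cayley, cayley]
    field_simp
    linear_combination -2 * Complex.I_sq
  rw [h3, cayley_sub, div_div_div_cancel_right₀ (mul_ne_zero h1 h2)]
  by_cases h4 : (e : ℂ) - a = 0
  · simp [h4]
  have h5 := Complex.I_ne_zero
  field_simp
  linear_combination (1 + (a : ℂ) * e) * Complex.I_sq

theorem one_add_sq_ne_zero (a : ℝ) : (1 + (a : ℂ) ^ 2) ≠ 0 := by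
  have : (1 + a ^ 2 : ℝ) ≠ 0 := by positivity
  exact_mod_cast this

/-- Over the common denominator the numerator is `(c - a)(1 + e²)`, up to a constant, and `1 + e²`
cancels against the weight of the `ĝ`-trace. -/
theorem cayley_coefficient {a c e : ℝ} (ha : a ≠ e) (hc : c ≠ e) :
    ((1 + (e : ℂ) ^ 2) / 2)⁻¹ * ((cayley c + cayley e) / (cayley c - cayley e)
      - (cayley a + cayley e) / (cayley a - cayley e)) =
    -2 * Complex.I * (c - a) * (((a - e) * (c - e) : ℝ) : ℂ)⁻¹ := by
  have h1 : (a : ℂ) - e ≠ 0 := by exact_mod_cast sub_ne_zero.2 ha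
  have h2 : (c : ℂ) - e ≠ 0 := by exact_mod_cast sub_ne_zero.2 hc
  have h3 : (e : ℂ) - a ≠ 0 := by exact_mod_cast sub_ne_zero.2 ha.symm
  have h4 : (e : ℂ) - c ≠ 0 := by exact_mod_cast sub_ne_zero.2 hc.symm
  have h5 := one_add_sq_ne_zero e
  rw [cayley_add_div_sub, cayley_add_div_sub]
  push_cast
  rw [← neg_sub (e : ℂ) a, ← neg_sub (e : ℂ) c]
  field_simp
  ring

/-- The product is the square of `(a + i)(c - i) = (1 + a c) + i (c - a)` divided by its squared
modulus. -/
theorem im_cayley_mul_inv (a c : ℝ) : (cayley a * (cayley c)⁻¹).im =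
    2 * (1 + a * c) * (c - a) / ((1 + a ^ 2) * (1 + c ^ 2)) := by
  have h1 : cayley a * (cayley c)⁻¹ = ((((1 + a * c) ^ 2 - (c - a) ^ 2) / ((1 + a ^ 2) * (1 + c ^ 2))
      : ℝ) : ℂ) + ((2 * (1 + a * c) * (c - a) / ((1 + a ^ 2) * (1 + c ^ 2)) : ℝ) : ℂ) * Complex.I := by
    have h2 := sub_I_ne_zero a
    have h3 := add_I_ne_zero c
    have h4 := one_add_sq_ne_zero a
    have h5 := one_add_sq_ne_zero c
    have ha : cayley a = ((a : ℂ) + Complex.I) ^ 2 / (1 + (a : ℂ) ^ 2) := by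
      rw [cayley, div_eq_div_iff h2 h4]
      linear_combination ((a : ℂ) + Complex.I) * Complex.I_sq
    have hc : (cayley c)⁻¹ = ((c : ℂ) - Complex.I) ^ 2 / (1 + (c : ℂ) ^ 2) := by
      rw [cayley, inv_div, div_eq_div_iff h3 h5]
      linear_combination ((c : ℂ) - Complex.I) * Complex.I_sq
    rw [ha, hc]
    push_cast
    field_simp
    linear_combination (((c : ℂ) - a) ^ 2 + Complex.I ^ 2 - 1 - 2 * a * c
      - 2 * (c - a) * Complex.I) * Complex.I_sq
  rw [h1, Complex.add_im, Complex.ofReal_im, Complex.im_ofReal_mul, Complex.I_im]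
  ring

section
variable {n : ℕ} {M : Type*} [TopologicalSpace M] [ChartedSpace (EuclideanSpace ℝ (Fin n)) M]
  {F ν : M → EuclideanSpace ℝ (Fin (n + 2))} {p : M} {U : Set (EuclideanSpace ℝ (Fin n))}
  {Λ : Finset ℝ} (h : LocalIsoparametric U (inChart p F) (inChart p ν) Λ)
  (hz : chartAt (EuclideanSpace ℝ (Fin n)) p p ∈ U)
include h hz

/-- Unless `lam P = lam Q` and `lam R = lam S`, every term is zero. Otherwise the first two terms
carry the coefficient of `c`, the last two that of `a`, and the symmetry of the cubic form gives
them the same products; their difference is the left side of Cartan's identity. -/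
theorem trace_formula_frame
    {b : Module.Basis (Fin n) ℝ (EuclideanSpace ℝ (Fin n))} {lam : Fin n → ℝ}
    (hb : PrincipalFrame (inChart p F) (inChart p ν) Λ (chartAt (EuclideanSpace ℝ (Fin n)) p p) b lam)
    (P Q R S : Fin n) :
    -4 * Complex.I * (Λ.card : ℂ) ^ 2 *
      (((gHat F ν p (powB F ν p 1 (toComplexVec (b P))) (toComplexVec (b Q)) *
        gHat F ν p (powB F ν p (-1) (toComplexVec (b R))) (toComplexVec (b S))).im : ℝ) : ℂ) =
      mixedTraceSum F ν p Λ.card (toComplexVec (b P)) (toComplexVec (b Q)) (toComplexVec (b R))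
        (toComplexVec (b S)) +
      mixedTraceSum F ν p Λ.card (toComplexVec (b P)) (toComplexVec (b Q)) (toComplexVec (b S))
        (toComplexVec (b R)) -
      mixedTraceSum F ν p Λ.card (toComplexVec (b R)) (toComplexVec (b S)) (toComplexVec (b P))
        (toComplexVec (b Q)) -
      mixedTraceSum F ν p Λ.card (toComplexVec (b R)) (toComplexVec (b S)) (toComplexVec (b Q))
        (toComplexVec (b P)) := by
  simp only [mixedTraceSum_frame h hz hb, powB_frame h hz hb, gHat_smul_left, gHat_frame h hz hb]
  set z := chartAt (EuclideanSpace ℝ (Fin n)) p p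
  set f := inChart (n := n) p F
  set N := inChart (n := n) p ν
  by_cases hPQ : lam P = lam Q
  swap
  · have h1 : P ≠ Q := fun h => hPQ (by rw [h])
    have h2 : lam Q ≠ lam P := Ne.symm hPQ
    simp [hPQ, h1, h2]
  by_cases hRS : lam R = lam S
  swap
  · have h1 : R ≠ S := fun h => hRS (by rw [h])
    have h2 : lam S ≠ lam R := Ne.symm hRS
    simp [hRS, h1, h2]
  have hsP := hb.shape_b P
  have hsQ := hb.shape_b Q
  have hsR := hb.shape_b R
  have hsS := hb.shape_b S
  have haΛ := hb.mem P
  have hcΛ := hb.mem R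
  rw [← hPQ] at hsQ
  rw [← hRS] at hsS
  simp only [← hPQ, ← hRS, and_self, if_true, zpow_one, zpow_neg]
  set a := lam P
  set c := lam R
  have hc1 : ∀ i, cubic f N z (b R) (b P) (b i) = cubic f N z (b P) (b R) (b i) := fun i =>
    h.cubic_comm_left hz _ _ _
  have hc2 : ∀ i, cubic f N z (b S) (b Q) (b i) = cubic f N z (b Q) (b S) (b i) := fun i =>
    h.cubic_comm_left hz _ _ _
  have hc3 : ∀ i, cubic f N z (b S) (b P) (b i) = cubic f N z (b P) (b S) (b i) := fun i =>
    h.cubic_comm_left hz _ _ _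
  have hc4 : ∀ i, cubic f N z (b R) (b Q) (b i) = cubic f N z (b Q) (b R) (b i) := fun i =>
    h.cubic_comm_left hz _ _ _
  have q : ∀ (i j : Fin n) (t : ℝ), (if i = j then (1 + (t : ℂ) ^ 2) / 2 else 0) =
      ((if i = j then (1 + t ^ 2) / 2 else 0 : ℝ) : ℂ) := fun i j t => by split_ifs <;> simp
  have him : ∀ x y : ℝ, (cayley a * (x : ℂ) * ((cayley c)⁻¹ * (y : ℂ))).im
      = x * y * (2 * (1 + a * c) * (c - a) / ((1 + a ^ 2) * (1 + c ^ 2))) := fun x y => by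
    rw [← im_cayley_mul_inv, ← Complex.im_ofReal_mul]
    push_cast
    congr 1
    ring
  rw [q, q, him]
  have hL : (if P = Q then (1 + a ^ 2) / 2 else 0 : ℝ) * (if R = S then (1 + c ^ 2) / 2 else 0)
      * (2 * (1 + a * c) * (c - a) / ((1 + a ^ 2) * (1 + c ^ 2)))
      = (c - a) / 2 * ((1 + a * c) * ((if P = Q then 1 else 0) * (if R = S then 1 else 0))) := by
    have h1 : 1 + a ^ 2 ≠ 0 := by positivity
    have h2 : 1 + c ^ 2 ≠ 0 := by positivity
    split_ifs <;> field_simp <;> simp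
  rw [hL]
  -- If `c = a`, then the factor `c - a` on the left vanishes, and so does the cubic form on two
  -- vectors of the same principal space.
  by_cases hac : c = a
  · rw [hac] at hsR hsS
    have z1 : ∀ i, cubic f N z (b P) (b R) (b i) = 0 := fun i => by
      rw [h.cubic_comm_right hz, h.cubic_comm_left hz, h.cubic_eq_zero hz haΛ _ hsP hsR]
    have z2 : ∀ i, cubic f N z (b P) (b S) (b i) = 0 := fun i => by
      rw [h.cubic_comm_right hz, h.cubic_comm_left hz, h.cubic_eq_zero hz haΛ _ hsP hsS]
    simp [hc1, hc3, z1, z2, hac]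
  · have hcart := h.cartan_polarized hz hb haΛ hcΛ hac hsP hsQ hsR hsS
    have hsum : ∀ i, ((1 + lam i ^ 2) / 2 : ℂ)⁻¹ *
        ((cayley c + cayley (lam i)) / (cayley c - cayley (lam i)) -
          (cayley a + cayley (lam i)) / (cayley a - cayley (lam i))) *
        ((cubic f N z (b P) (b R) (b i) * cubic f N z (b Q) (b S) (b i) +
        cubic f N z (b P) (b S) (b i) * cubic f N z (b Q) (b R) (b i) : ℝ) : ℂ) =
        -2 * Complex.I * (c - a) * (((cubic f N z (b P) (b R) (b i) * cubic f N z (b Q) (b S) (b i) +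
        cubic f N z (b P) (b S) (b i) * cubic f N z (b Q) (b R) (b i)) /
          ((a - lam i) * (c - lam i)) : ℝ) : ℂ) := by
      intro i
      by_cases hia : a = lam i
      · rw [← hc1, ← hc3, h.cubic_eq_zero hz haΛ _ hsP (hia ▸ hb.shape_b i),
          h.cubic_eq_zero hz haΛ _ hsP (hia ▸ hb.shape_b i)]
        simp
      by_cases hic : c = lam i
      · rw [h.cubic_eq_zero hz hcΛ _ hsR (hic ▸ hb.shape_b i),
          h.cubic_eq_zero hz hcΛ (b P) hsS (hic ▸ hb.shape_b i)]
        simp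
      rw [cayley_coefficient hia hic]
      push_cast
      ring
    simp only [← mul_add, ← mul_sub, ← Finset.sum_add_distrib, ← Finset.sum_sub_distrib]
    rw [Finset.sum_congr rfl fun i _ => (?_ : _ = -2 * Complex.I * (c - a) *
      (((cubic f N z (b P) (b R) (b i) * cubic f N z (b Q) (b S) (b i) +
        cubic f N z (b P) (b S) (b i) * cubic f N z (b Q) (b R) (b i)) /
          ((a - lam i) * (c - lam i)) : ℝ) : ℂ))]
    · rw [← Finset.mul_sum, ← Complex.ofReal_sum, hcart, hb.orth, hb.orth]
      split_ifs <;> push_cast <;> ring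
    · rw [← hsum, hc1, hc2, hc3, hc4]
      push_cast
      ring

end

/-! ### Extension to all tangent vectors -/

section
variable {n : ℕ} {M : Type*} [TopologicalSpace M] [ChartedSpace (EuclideanSpace ℝ (Fin n)) M]
  {F ν : M → EuclideanSpace ℝ (Fin (n + 2))} {p : M} {U : Set (EuclideanSpace ℝ (Fin n))}
  {Λ : Finset ℝ} (h : LocalIsoparametric U (inChart p F) (inChart p ν) Λ)
  (hz : chartAt (EuclideanSpace ℝ (Fin n)) p p ∈ U)
include h hz

theorem trace_formula (X Y Z W : EuclideanSpace ℝ (Fin n)) :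
    -4 * Complex.I * (Λ.card : ℂ) ^ 2 *
      (((gHat F ν p (powB F ν p 1 (toComplexVec X)) (toComplexVec Y) *
        gHat F ν p (powB F ν p (-1) (toComplexVec Z)) (toComplexVec W)).im : ℝ) : ℂ) =
      mixedTraceSum F ν p Λ.card (toComplexVec X) (toComplexVec Y) (toComplexVec Z)
        (toComplexVec W) +
      mixedTraceSum F ν p Λ.card (toComplexVec X) (toComplexVec Y) (toComplexVec W)
        (toComplexVec Z) -
      mixedTraceSum F ν p Λ.card (toComplexVec Z) (toComplexVec W) (toComplexVec X)
        (toComplexVec Y) -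
      mixedTraceSum F ν p Λ.card (toComplexVec Z) (toComplexVec W) (toComplexVec Y)
        (toComplexVec X) := by
  obtain ⟨b, lam, hb⟩ := h.exists_frame_fin hz
  set T := fun X Y Z W : EuclideanSpace ℝ (Fin n) =>
    gHat F ν p (powB F ν p 1 (toComplexVec X)) (toComplexVec Y) *
      gHat F ν p (powB F ν p (-1) (toComplexVec Z)) (toComplexVec W) with hT
  set D := fun X Y Z W : EuclideanSpace ℝ (Fin n) =>
    -4 * Complex.I * (Λ.card : ℂ) ^ 2 * (((T X Y Z W).im : ℝ) : ℂ) -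
      (mixedTraceSum F ν p Λ.card (toComplexVec X) (toComplexVec Y) (toComplexVec Z)
        (toComplexVec W) +
      mixedTraceSum F ν p Λ.card (toComplexVec X) (toComplexVec Y) (toComplexVec W)
        (toComplexVec Z) -
      mixedTraceSum F ν p Λ.card (toComplexVec Z) (toComplexVec W) (toComplexVec X)
        (toComplexVec Y) -
      mixedTraceSum F ν p Λ.card (toComplexVec Z) (toComplexVec W) (toComplexVec Y)
        (toComplexVec X)) with hD
  -- Taking the imaginary part is additive and real homogeneous, which is all that is needed for
  -- real arguments.
  have hadd : ∀ s t u : ℂ, s = t + u → ((s.im : ℝ) : ℂ) = (t.im : ℂ) + (u.im : ℂ) := by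
    rintro _ t u rfl
    simp
  have hsmul : ∀ (r : ℝ) (s t : ℂ), s = r * t → ((s.im : ℝ) : ℂ) = r * (t.im : ℂ) := by
    rintro r _ t rfl
    rw [Complex.im_ofReal_mul, Complex.ofReal_mul]
  suffices D X Y Z W = 0 from sub_eq_zero.1 this
  refine eq_zero_of_basis b (L := fun X => D X Y Z W) (fun X X' => ?_) (fun t X => ?_)
    (fun P => ?_) X
  · simp only [hD]
    rw [hadd (T (X + X') Y Z W) (T X Y Z W) (T X' Y Z W) (by
      simp only [hT, toComplexVec_add, powB_add, gHat_add_left]; ring)]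
    simp only [toComplexVec_add, mixedTraceSum_add₁, mixedTraceSum_add₃, mixedTraceSum_add₄]
    ring
  · simp only [hD]
    rw [hsmul t (T (t • X) Y Z W) (T X Y Z W) (by
      simp only [hT, toComplexVec_smul, powB_smul, gHat_smul_left]; ring)]
    simp only [toComplexVec_smul, mixedTraceSum_smul₁, mixedTraceSum_smul₃, mixedTraceSum_smul₄]
    ring
  refine eq_zero_of_basis b (L := fun Y => D (b P) Y Z W) (fun Y Y' => ?_) (fun t Y => ?_)
    (fun Q => ?_) Y
  · simp only [hD]
    rw [hadd (T (b P) (Y + Y') Z W) (T (b P) Y Z W) (T (b P) Y' Z W) (by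
      simp only [hT, toComplexVec_add, gHat_add_right]; ring)]
    simp only [toComplexVec_add, mixedTraceSum_add₂, mixedTraceSum_add₃, mixedTraceSum_add₄]
    ring
  · simp only [hD]
    rw [hsmul t (T (b P) (t • Y) Z W) (T (b P) Y Z W) (by
      simp only [hT, toComplexVec_smul, gHat_smul_right]; ring)]
    simp only [toComplexVec_smul, mixedTraceSum_smul₂, mixedTraceSum_smul₃, mixedTraceSum_smul₄]
    ring
  refine eq_zero_of_basis b (L := fun Z => D (b P) (b Q) Z W) (fun Z Z' => ?_) (fun t Z => ?_)
    (fun R => ?_) Z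
  · simp only [hD]
    rw [hadd (T (b P) (b Q) (Z + Z') W) (T (b P) (b Q) Z W) (T (b P) (b Q) Z' W) (by
      simp only [hT, toComplexVec_add, powB_add, gHat_add_left]; ring)]
    simp only [toComplexVec_add, mixedTraceSum_add₁, mixedTraceSum_add₃, mixedTraceSum_add₄]
    ring
  · simp only [hD]
    rw [hsmul t (T (b P) (b Q) (t • Z) W) (T (b P) (b Q) Z W) (by
      simp only [hT, toComplexVec_smul, powB_smul, gHat_smul_left]; ring)]
    simp only [toComplexVec_smul, mixedTraceSum_smul₁, mixedTraceSum_smul₃, mixedTraceSum_smul₄]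
    ring
  refine eq_zero_of_basis b (L := fun W => D (b P) (b Q) (b R) W) (fun W W' => ?_)
    (fun t W => ?_) (fun S => ?_) W
  · simp only [hD]
    rw [hadd (T (b P) (b Q) (b R) (W + W')) (T (b P) (b Q) (b R) W) (T (b P) (b Q) (b R) W') (by
      simp only [hT, toComplexVec_add, gHat_add_right]; ring)]
    simp only [toComplexVec_add, mixedTraceSum_add₂, mixedTraceSum_add₃, mixedTraceSum_add₄]
    ring
  · simp only [hD]
    rw [hsmul t (T (b P) (b Q) (b R) (t • W)) (T (b P) (b Q) (b R) W) (by
      simp only [hT, toComplexVec_smul, gHat_smul_right]; ring)]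
    simp only [toComplexVec_smul, mixedTraceSum_smul₂, mixedTraceSum_smul₃, mixedTraceSum_smul₄]
    ring
  exact sub_eq_zero.2 (trace_formula_frame h hz hb P Q R S)

omit h hz in
theorem mixedTraceSum_swap (F ν : M → EuclideanSpace ℝ (Fin (n + 2))) (p : M) (g : ℕ)
    (X Y Z W : Fin n → ℂ) : mixedTraceSum F ν p g X Y Z W =
      ∑ j ∈ Finset.range g, ∑ l ∈ Finset.range g, mixedTrace F ν p l j X Y Z W :=
  Finset.sum_comm

end
end Isoparametric

theorem mainTheorem3 (n g : ℕ) {M : Type*} [TopologicalSpace M]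
    [ChartedSpace (EuclideanSpace ℝ (Fin n)) M]
    [IsManifold 𝓘(ℝ, EuclideanSpace ℝ (Fin n)) ∞ M] [ConnectedSpace M]
    (F ν : M → EuclideanSpace ℝ (Fin (n + 2))) (hF : IsIsoparametric F ν)
    (hg : ∀ p : M, (principalCurvatures F ν p).ncard = g)
    (p : M) (X Y Z W : TangentSpace 𝓘(ℝ, EuclideanSpace ℝ (Fin n)) p) :
    -4 * Complex.I * (g : ℂ) ^ 2 * (tensorT F ν p X Y Z W : ℂ) =
      ∑ l ∈ Finset.range g, ∑ j ∈ Finset.range g, traceHat F ν p fun u v =>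
        alpha F ν p (powB F ν p (-l) (toComplex Y)) (powB F ν p (-j) (toComplex W)) u *
          ∑ k ∈ Finset.range j,
            (alpha F ν p (powB F ν p l (toComplex X)) (powB F ν p (k + 1) (toComplex Z))
                (powB F ν p (j - k - 1) v)
              + alpha F ν p (powB F ν p l (toComplex X)) (powB F ν p k (toComplex Z))
                (powB F ν p (j - k) v))
        + alpha F ν p (powB F ν p (-l) (toComplex Y)) (powB F ν p (-j) (toComplex Z)) u *
          ∑ k ∈ Finset.range j,
            (alpha F ν p (powB F ν p l (toComplex X)) (powB F ν p (k + 1) (toComplex W))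
                (powB F ν p (j - k - 1) v)
              + alpha F ν p (powB F ν p l (toComplex X)) (powB F ν p k (toComplex W))
                (powB F ν p (j - k) v))
        - alpha F ν p (powB F ν p (-j) (toComplex W)) (powB F ν p (-l) (toComplex Y)) u *
          ∑ k ∈ Finset.range l,
            (alpha F ν p (powB F ν p j (toComplex Z)) (powB F ν p (k + 1) (toComplex X))
                (powB F ν p (l - k - 1) v)
              + alpha F ν p (powB F ν p j (toComplex Z)) (powB F ν p k (toComplex X))
                (powB F ν p (l - k) v))
        - alpha F ν p (powB F ν p (-j) (toComplex W)) (powB F ν p (-l) (toComplex X)) u *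
          ∑ k ∈ Finset.range l,
            (alpha F ν p (powB F ν p j (toComplex Z)) (powB F ν p (k + 1) (toComplex Y))
                (powB F ν p (l - k - 1) v)
              + alpha F ν p (powB F ν p j (toComplex Z)) (powB F ν p k (toComplex Y))
                (powB F ν p (l - k) v)) := by
  obtain ⟨Λ, hΛ, h⟩ := hF.exists_local p
  have hcard : Λ.card = g := by rw [← hg p, ← hΛ, Set.ncard_coe_finset]
  have := trace_formula h (mem_chart_target _ p) X Y Z W
  rw [hcard] at this
  refine this.trans ?_
  -- In the last two terms the roles of `l` and `j` are exchanged, so their summation order is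
  -- swapped before comparing termwise.
  rw [mixedTraceSum_swap F ν p g (toComplexVec Z), mixedTraceSum_swap F ν p g (toComplexVec Z)]
  simp only [mixedTraceSum, ← Finset.sum_add_distrib, ← Finset.sum_sub_distrib]
  refine Finset.sum_congr rfl fun l _ => Finset.sum_congr rfl fun j _ => ?_
  simp only [mixedTrace, alphaSum_apply, ← traceHat_add, ← traceHat_sub]
  rfl
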